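/- **Setting.** Let $X$ be a smooth manifold (Hausdorff, second countable) with a tangent Lie structure: a smooth bundle $\mathfrak G(X)\to X$ of simply connected Lie groups $\mathfrak G_x$, a smooth subbundle, proper over $X$, of maximal compact subgroups $\mathfrak K_x\subset\mathfrak G_x$, and a smooth family of linear isomorphisms $\mathrm{Lie}(\mathfrak G_x)/\mathrm{Lie}(\mathfrak K_x)\simeq T_x(X)$. Fix left Haar measures on the groups $\mathfrak G_x$ that vary smoothly with $x$; let $\mu$ denote the modular functions, with $d(g^{-1})=\mu(g)^{-1}dg$. Let $\mathfrak Z$ be a smooth Hermitian vector bundle over $X$ with a smooth fibrewise unitary action of the groups $\mathfrak K_x$, and let $E_x=\mathfrak G_x\times_{\mathfrak K_x}\mathfrak Z_x$ be the associated bundle over $\mathfrak G_x/\mathfrak K_x$, whose sections are the functions $e:\mathfrak G_x\to\mathfrak Z_x$ with $e(gk)=k^{-1}e(g)$. A smooth section of the field $(E_x)_{x\in X}$ with compact support is a family $e=(e_x)$ of sections that is smooth and compactly supported on the total space $\mathfrak G(X)$. The Hilbert module $\mathcal E$ over $C^*_r(\mathfrak G(X))$ is the completion of the space of these sections for $$(e\cdot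 b)(h)=\int_{\mathfrak G_x}e(g^{-1}h)\,b(g^{-1})\,\mu(g)^{-1/2}dg,\qquad (e,f)(g)=\mu(g)^{-1/2}\int_{\mathfrak G_x}\langle e(h),f(g^{-1}h)\rangle\,dh ,$$ $\mathcal L(\mathcal E)$ is the algebra of its adjointable operators, and $\mathcal K(\mathcal E)$ is the norm closure of the span of the operators $w\mapsto a\,(b,w)$, $a,b\in\mathcal E$. A *cosymbol* $D=\{D_x\}$ is a family of left $\mathfrak G_x$-invariant differential operators $D_x$ on $C_c^\infty(E_x)$ that is smooth in $x$, i.e. maps smooth compactly supported sections of $(E_x)$ to such sections. It is *symmetric* if $\langle D_xe,f\rangle_{L^2(E_x)}=\langle e,D_xf\rangle_{L^2(E_x)}$ for all $x\in X$ and $e,f\in C_c^\infty(E_x)$. A *cosymbol parametrix* for $D$ is a smooth family $P=\{P_x\}$ of left-invariant, properly supported operators on $C_c^\infty(E_x)$, with formal adjoints that again form a smooth family, such that $R=1-PD$ and $S=1-DP$ are families of convolution operators with properly supported kernels smooth on $\mathfrak G(X)$ and $\mathfrak K_x$-invariant in each variable, and such that $P,R,S$ extend to elements of $\mathcal K(\mathcal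 E)$. **Proposition.** Let $D$ be a symmetric cosymbol that has a cosymbol parametrix. Then $D$, as an unbounded operator on $\mathcal E$ with domain the smooth compactly supported sections, is closable, and with $D$ also denoting its closure, $\tilde\sigma=D(D^2+1)^{-1/2}$ is a well-defined element of $\mathcal L(\mathcal E)$: the operator $D^2+1$ has an inverse $(D^2+1)^{-1}\in\mathcal L(\mathcal E)$, this inverse has a positive square root $(D^2+1)^{-1/2}\in\mathcal L(\mathcal E)$ whose range is in the domain of $D$, and the composition $\tilde\sigma=D(D^2+1)^{-1/2}$, which is uniquely determined, is in $\mathcal L(\mathcal E)$. Moreover, $1-\tilde\sigma^2\in\mathcal K(\mathcal E)$. -/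

import Mathlib

open scoped Manifold ContDiff ENNReal Topology
open MeasureTheory

noncomputable section

namespace CoarsePDO

universe u v w

/-! ### Hilbert modules of fields of operators

`H x` and `H' x` are Hilbert spaces indexed by `x : X`. A closed subspace `M` of the bounded fields
of operators `(u x : H x → H' x)`, with the supremum norm, is regarded as a Hilbert module with the
inner product `⟨u, v⟩ = u* v`, a bounded field of operators `H x → H x`. (Enlarging the coefficient
algebra in which the inner product takes its values changes neither the norm nor the adjointable
nor the compact operators of a Hilbert module.) -/

section HilbertModule

variable {X : Type u} {H : X → Type v} {H' : X → Type w}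
  [∀ x, NormedAddCommGroup (H x)] [∀ x, InnerProductSpace ℂ (H x)] [∀ x, CompleteSpace (H x)]
  [∀ x, NormedAddCommGroup (H' x)] [∀ x, InnerProductSpace ℂ (H' x)] [∀ x, CompleteSpace (H' x)]

variable (H H') in
/-- Bounded fields of operators `H x → H' x`, with the supremum norm. -/
def OperatorFields : Type (max u v w) := lp (fun x => H x →L[ℂ] H' x) ∞

instance : NormedAddCommGroup (OperatorFields H H') :=
  inferInstanceAs (NormedAddCommGroup (lp (fun x => H x →L[ℂ] H' x) ∞))

instance : NormedSpace ℂ (OperatorFields H H') :=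
  inferInstanceAs (NormedSpace ℂ (lp (fun x => H x →L[ℂ] H' x) ∞))

/-- The operator of the field `u` at the point `x`. -/
def OperatorFields.op (u : OperatorFields H H') (x : X) : H x →L[ℂ] H' x :=
  (show lp (fun x => H x →L[ℂ] H' x) ∞ from u : ∀ x, H x →L[ℂ] H' x) x

variable {M : Submodule ℂ (OperatorFields H H')}

variable (M) in
/-- Bounded operators on the Hilbert module `M`. -/
abbrev Ops : Type _ := M →L[ℂ] M

/-- The inner product `⟨u, v⟩ = u* v`. -/
def innerProd (u v : M) (x : X) : H x →L[ℂ] H x :=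
  (ContinuousLinearMap.adjoint (u.1.op x)).comp (v.1.op x)

/-- `S` and `S'` are adjoint to each other: `⟨S u, v⟩ = ⟨u, S' v⟩`. -/
def AreAdjoint (S S' : Ops M) : Prop :=
  ∀ u v : M, innerProd (S u) v = innerProd u (S' v)

/-- `S` belongs to `𝓛(M)`, the algebra of operators on `M` that have an adjoint. -/
def IsAdjointable (S : Ops M) : Prop :=
  ∃ S' : Ops M, AreAdjoint S S'

/-- `⟨S u, u⟩ ≥ 0` for all `u`. -/
def IsPositiveOp (S : Ops M) : Prop :=
  ∀ (u : M) (x : X), (innerProd (S u) u x).IsPositive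

/-- `S` is the rank one operator `w ↦ a ⟨b, w⟩`. -/
def IsRankOne (S : Ops M) : Prop :=
  ∃ a b : M, ∀ (w : M) (x : X),
    (S w).1.op x = (a.1.op x).comp (innerProd b w x)

variable (M) in
/-- `𝓚(M)`: the norm closure of the linear span of the rank one operators. -/
def compactOps : Submodule ℂ (Ops M) :=
  (Submodule.span ℂ {S : Ops M | IsRankOne S}).topologicalClosure

/-- A linear relation in `M × M` is the graph of an operator. -/
def IsOperatorGraph (T : Submodule ℂ (M × M)) : Prop :=
  ∀ v : M, ((0 : M), v) ∈ T → v = 0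

/-- `A` is a two-sided inverse of `T² + 1`, where `T` is the operator with the given graph and
`T² + 1` has its natural domain `{u ∈ dom T | T u ∈ dom T}`. -/
def IsInverseOfSqAddOne (T : Submodule ℂ (M × M)) (A : Ops M) : Prop :=
  (∀ e : M, ∃ v : M, (A e, v) ∈ T ∧ (v, e - A e) ∈ T) ∧
  ∀ u v w : M, (u, v) ∈ T → (v, w) ∈ T → A (w + u) = u

/-- `σ = T (T² + 1)^{-1/2}`: the operator `T² + 1` has an inverse in `𝓛(M)`, this inverse has a
positive square root `Q` in `𝓛(M)`, the range of `Q` is in the domain of `T`, and `σ = T Q`. -/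
def IsBoundedTransform (T : Submodule ℂ (M × M)) (σ : Ops M) : Prop :=
  ∃ Q : Ops M, IsAdjointable Q ∧ IsPositiveOp Q ∧ IsInverseOfSqAddOne T (Q.comp Q) ∧
    ∀ e : M, (Q e, σ e) ∈ T

end HilbertModule

/-! ### Spaces of square integrable functions -/

section L2

variable {α : Type u} [MeasurableSpace α] (F : Type v) [NormedAddCommGroup F]

/-- The Hilbert space `L²(α; F)`. -/
def L2 (ν : Measure α) : Type (max u v) := Lp F 2 ν

variable {F} in
/-- A function representing an element of `L²(α; F)`. -/
def L2.toFun {ν : Measure α} (φ : L2 F ν) : α → F :=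
  ((show Lp F 2 ν from φ : Lp F 2 ν) : α → F)

variable (ν : Measure α)

instance : NormedAddCommGroup (L2 F ν) := inferInstanceAs (NormedAddCommGroup (Lp F 2 ν))

instance [InnerProductSpace ℂ F] : InnerProductSpace ℂ (L2 F ν) :=
  inferInstanceAs (InnerProductSpace ℂ (Lp F 2 ν))

instance [CompleteSpace F] : CompleteSpace (L2 F ν) :=
  inferInstanceAs (CompleteSpace (Lp F 2 ν))

end L2

/-! ### Tangent Lie structures -/

/-- A tangent Lie structure on a smooth manifold `X` of dimension `n`: a smooth bundle of simply
connected Lie groups `G x` of dimension `d` (its total space is a manifold that submerses onto `X`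
with the Lie groups `G x` as embedded fibres, and the group operations are smooth on the total
space), a smooth subbundle of maximal compact subgroups `K x`, and an isomorphism of the bundle
of vector spaces `Lie (G x) / Lie (K x)` with the tangent bundle of `X`. -/
structure TangentLieStructure (n d : ℕ) (X : Type u) [TopologicalSpace X]
    [ChartedSpace (EuclideanSpace ℝ (Fin n)) X] [IsManifold (𝓡 n) ∞ X] where
  G : X → Type v
  [group : ∀ x, Group (G x)]
  [topG : ∀ x, TopologicalSpace (G x)]
  [chartedG : ∀ x, ChartedSpace (EuclideanSpace ℝ (Fin d)) (G x)]
  [lieG : ∀ x, LieGroup (𝓡 d) ∞ (G x)]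
  [simplyConnectedG : ∀ x, SimplyConnectedSpace (G x)]
  [topTot : TopologicalSpace (Bundle.TotalSpace Unit G)]
  [chartedTot : ChartedSpace (EuclideanSpace ℝ (Fin (n + d))) (Bundle.TotalSpace Unit G)]
  [manifoldTot : IsManifold (𝓡 (n + d)) ∞ (Bundle.TotalSpace Unit G)]
  [t2Tot : T2Space (Bundle.TotalSpace Unit G)]
  [secondCountableTot : SecondCountableTopology (Bundle.TotalSpace Unit G)]
  submersion_proj : Manifold.IsSubmersion (𝓡 (n + d)) (𝓡 n) ∞
    (fun p : Bundle.TotalSpace Unit G => p.proj)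
  embedding_fibre : ∀ x, Manifold.IsSmoothEmbedding (𝓡 d) (𝓡 (n + d)) ∞
    (fun g : G x => (⟨x, g⟩ : Bundle.TotalSpace Unit G))
  smooth_one : ContMDiff (𝓡 n) (𝓡 (n + d)) ∞
    (fun x : X => (⟨x, 1⟩ : Bundle.TotalSpace Unit G))
  smooth_inv : ContMDiff (𝓡 (n + d)) (𝓡 (n + d)) ∞
    (fun p : Bundle.TotalSpace Unit G => (⟨p.proj, p.snd⁻¹⟩ : Bundle.TotalSpace Unit G))
  /-- multiplication is smooth on the fibre product, a submanifold of the square -/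
  smooth_mul : ∃ m : Bundle.TotalSpace Unit G × Bundle.TotalSpace Unit G →
      Bundle.TotalSpace Unit G,
    ContMDiffOn ((𝓡 (n + d)).prod (𝓡 (n + d))) (𝓡 (n + d)) ∞ m {p | p.1.proj = p.2.proj} ∧
    ∀ (x : X) (a b : G x), m (⟨x, a⟩, ⟨x, b⟩) = ⟨x, a * b⟩
  K : ∀ x, Subgroup (G x)
  isCompact_K : ∀ x, IsCompact (K x : Set (G x))
  maximal_K : ∀ (x : X) (L : Subgroup (G x)), IsCompact (L : Set (G x)) → K x ≤ L → L = K x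
  /-- the union of the `K x` is locally cut out of the total space by `n` equations with
  independent differentials along the fibres -/
  smooth_K : ∀ (x₀ : X) (k₀ : G x₀), k₀ ∈ K x₀ →
    ∃ W : Set (Bundle.TotalSpace Unit G), IsOpen W ∧ (⟨x₀, k₀⟩ : Bundle.TotalSpace Unit G) ∈ W ∧
    ∃ F : Bundle.TotalSpace Unit G → EuclideanSpace ℝ (Fin n),
      ContMDiffOn (𝓡 (n + d)) (𝓡 n) ∞ F W ∧
      ∀ (x : X) (g : G x), (⟨x, g⟩ : Bundle.TotalSpace Unit G) ∈ W →
        (g ∈ K x ↔ F ⟨x, g⟩ = 0) ∧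
        Function.Surjective (mfderiv (𝓡 d) (𝓡 n) (fun h : G x => F ⟨x, h⟩) g)
  /-- the bundle of the compact groups `K x` is proper over `X` -/
  proper_K : ∀ L : Set X, IsCompact L →
    IsCompact {p : Bundle.TotalSpace Unit G | p.proj ∈ L ∧ p.snd ∈ K p.proj}
  /-- the map `Lie (G x) → T_x X` that induces the isomorphism `Lie (G x) / Lie (K x) ≃ T_x X` -/
  toTangent : ∀ x, GroupLieAlgebra (𝓡 d) (G x) →ₗ[ℝ] TangentSpace (𝓡 n) x
  toTangent_surjective : ∀ x, Function.Surjective (toTangent x)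
  /-- its kernel is `Lie (K x)`, the space of velocities at `1` of smooth curves in `K x` -/
  toTangent_ker : ∀ (x : X) (ξ : GroupLieAlgebra (𝓡 d) (G x)),
    toTangent x ξ = 0 ↔ ∃ γ : ℝ → G x, ContMDiff 𝓘(ℝ, ℝ) (𝓡 d) ∞ γ ∧ (∀ t, γ t ∈ K x) ∧
      γ 0 = 1 ∧ (mfderiv 𝓘(ℝ, ℝ) (𝓡 d) γ 0 (1 : ℝ) : EuclideanSpace ℝ (Fin d)) = ξ
  /-- it maps smooth sections of the bundle of Lie algebras to smooth vector fields -/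
  smooth_toTangent : ∀ ξ : ∀ x, GroupLieAlgebra (𝓡 d) (G x),
    ContMDiff (𝓡 n) (𝓡 (n + d)).tangent ∞
      (fun x : X => (⟨⟨x, 1⟩, mfderiv (𝓡 d) (𝓡 (n + d))
          (fun g : G x => (⟨x, g⟩ : Bundle.TotalSpace Unit G)) 1 (ξ x)⟩ :
        TangentBundle (𝓡 (n + d)) (Bundle.TotalSpace Unit G))) →
    ContMDiff (𝓡 n) (𝓡 n).tangent ∞
      (fun x : X => (⟨x, toTangent x (ξ x)⟩ : TangentBundle (𝓡 n) X))

attribute [instance] TangentLieStructure.group TangentLieStructure.topG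
  TangentLieStructure.chartedG TangentLieStructure.lieG TangentLieStructure.simplyConnectedG
  TangentLieStructure.topTot TangentLieStructure.chartedTot TangentLieStructure.manifoldTot
  TangentLieStructure.t2Tot TangentLieStructure.secondCountableTot

variable {n d r : ℕ} {X : Type u} [TopologicalSpace X]
  [ChartedSpace (EuclideanSpace ℝ (Fin n)) X] [IsManifold (𝓡 n) ∞ X]

namespace TangentLieStructure

variable (T : TangentLieStructure.{u, v} n d X)

/-- The total space of the bundle of groups. -/
abbrev Tot : Type _ := Bundle.TotalSpace Unit T.G

instance (x : X) : MeasurableSpace (T.G x) := borel (T.G x)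

instance (x : X) : BorelSpace (T.G x) := ⟨rfl⟩

/-- The modular function `μ` of `G x`, normalized by `|A g| = μ(g) |A|` for the left Haar measure
`|·|`, so that `d(g⁻¹) = μ(g)⁻¹ dg`. (Mathlib's `modularCharacterFun g` is the ratio
`|A g⁻¹| / |A|`.) -/
def modular (x : X) (g : T.G x) : ℝ :=
  haveI : IsTopologicalGroup (T.G x) := topologicalGroup_of_lieGroup (𝓡 d) ∞
  haveI : LocallyCompactSpace (T.G x) :=
    ChartedSpace.locallyCompactSpace (EuclideanSpace ℝ (Fin d)) (T.G x)
  ((Measure.modularCharacterFun g : NNReal) : ℝ)⁻¹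

end TangentLieStructure

/-- Left Haar measures on the groups `G x`, varying smoothly with `x`. The measure on the
homogeneous space `G x / K x` is the image of the Haar measure of `G x`. -/
structure SmoothHaarSystem (T : TangentLieStructure.{u, v} n d X) where
  measure : ∀ x, Measure (T.G x)
  isHaar : ∀ x, (measure x).IsHaarMeasure
  smooth : ∀ f : T.Tot → ℝ, ContMDiff (𝓡 (n + d)) 𝓘(ℝ, ℝ) ∞ f → HasCompactSupport f →
    ContMDiff (𝓡 n) 𝓘(ℝ, ℝ) ∞ (fun x : X => ∫ g, f ⟨x, g⟩ ∂(measure x))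

/-- A smooth Hermitian vector bundle `Z` of rank `r` over `X`, given by its fibres and by smoothly
compatible local orthonormal frames (the frame with index `i` is used over the neighbourhood `U i`
of `i`), with a smooth fibrewise unitary action of the bundle of groups `K x`. -/
structure HermitianBundle (T : TangentLieStructure.{u, v} n d X) (r : ℕ) where
  Z : X → Type w
  [normedZ : ∀ x, NormedAddCommGroup (Z x)]
  [innerZ : ∀ x, InnerProductSpace ℂ (Z x)]
  U : X → Set X
  isOpen_U : ∀ i, IsOpen (U i)
  mem_U : ∀ i, i ∈ U i
  frame : ∀ _i x : X, EuclideanSpace ℂ (Fin r) ≃ₗᵢ[ℂ] Z x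
  smooth_frame : ∀ (i j : X) (z : EuclideanSpace ℂ (Fin r)),
    ContMDiffOn (𝓡 n) 𝓘(ℝ, EuclideanSpace ℂ (Fin r)) ∞
      (fun x => (frame j x).symm (frame i x z)) (U i ∩ U j)
  act : ∀ x, T.K x →* (Z x ≃ₗᵢ[ℂ] Z x)
  /-- in the local frames, the action is smooth on the union of the `K x`, a submanifold -/
  smooth_act : ∀ (i : X) (z : EuclideanSpace ℂ (Fin r)),
    ∃ f : T.Tot → EuclideanSpace ℂ (Fin r),
      ContMDiffOn (𝓡 (n + d)) 𝓘(ℝ, EuclideanSpace ℂ (Fin r)) ∞ f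
        {p | p.proj ∈ U i ∧ p.snd ∈ T.K p.proj} ∧
      ∀ x ∈ U i, ∀ k : T.K x, f ⟨x, k⟩ = (frame i x).symm (act x k (frame i x z))

attribute [instance] HermitianBundle.normedZ HermitianBundle.innerZ

section Bundle

variable {T : TangentLieStructure.{u, v} n d X}

instance (V : HermitianBundle.{u, v, w} T r) (x : X) : CompleteSpace (V.Z x) :=
  (completeSpace_congr (e := (V.frame x x).toLinearEquiv.toEquiv)
    (V.frame x x).isometry.isUniformEmbedding).1 inferInstance

variable (V : HermitianBundle.{u, v, w} T r)

/-- `C_c^∞(E_x)`, for the vector bundle `E_x = G x ×_{K x} Z x` over `G x / K x`: its sections are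
the functions `e : G x → Z x` such that `e (g k) = k⁻¹ e (g)` for `k ∈ K x`. -/
def FibreSections (x : X) : Submodule ℂ (T.G x → V.Z x) where
  carrier := {e | ContMDiff (𝓡 d) 𝓘(ℝ, V.Z x) ∞ e ∧ HasCompactSupport e ∧
    ∀ (g : T.G x) (k : T.K x), e (g * k) = (V.act x k)⁻¹ (e g)}
  zero_mem' := ⟨contMDiff_const, HasCompactSupport.zero, fun _ _ => by simp⟩
  add_mem' := by
    rintro a b ⟨ha, ha', ha''⟩ ⟨hb, hb', hb''⟩
    exact ⟨ha.add hb, ha'.add hb', fun g k => by simp [ha'', hb'']⟩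
  smul_mem' := by
    rintro c a ⟨ha, ha', ha''⟩
    refine ⟨?_, ?_, fun g k => by simp [ha'']⟩
    · exact ((c • ContinuousLinearMap.id ℂ (V.Z x)).restrictScalars ℝ).contMDiff.comp ha
    · exact ha'.smul_left (f := fun _ => c)

/-- The family `(e x)` is a smooth compactly supported section of the field of bundles `E_x`: it is
smooth and compactly supported on the total space. -/
def IsSmoothSection (e : ∀ x, FibreSections V x) : Prop :=
  (∀ i : X, ContMDiffOn (𝓡 (n + d)) 𝓘(ℝ, EuclideanSpace ℂ (Fin r)) ∞
    (fun p : T.Tot => (V.frame i p.proj).symm ((e p.proj : T.G p.proj → V.Z p.proj) p.snd))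
    {p | p.proj ∈ V.U i}) ∧
  IsCompact (closure {p : T.Tot | (e p.proj : T.G p.proj → V.Z p.proj) p.snd ≠ 0})

/-! ### The Hilbert module -/

variable (μ : SmoothHaarSystem T)

/-- The field of operators `u` with `u x : L²(G x) → L²(G x; Z x)` is given by the action of the
section `e`, that is, `u x φ = e · φ`, where `·` is the right action of functions on sections
`(e · φ)(h) = ∫ e(g⁻¹ h) φ(g⁻¹) μ(g)^{-1/2} dg`. It takes its values in the space `L²(E_x)` of
equivariant functions. -/
def Represents (e : ∀ x, FibreSections V x)
    (u : OperatorFields (fun x => L2 ℂ (μ.measure x)) (fun x => L2 (V.Z x) (μ.measure x))) :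
    Prop :=
  ∀ (x : X) (φ : L2 ℂ (μ.measure x)),
    (u.op x φ).toFun =ᵐ[μ.measure x] fun h =>
      ∫ g, (φ.toFun g⁻¹ * (((T.modular x g) ^ (-(1 / 2 : ℝ)) : ℝ) : ℂ)) •
        (e x : T.G x → V.Z x) (g⁻¹ * h) ∂(μ.measure x)

/-- The Hilbert module `𝓔` over `C_r^*(𝔊(X))`: the completion of the compactly supported smooth
sections `e` of the field `(E_x)`, for the inner product
`⟨e, f⟩(g) = μ(g)^{-1/2} ∫ ⟨e(h), f(g⁻¹ h)⟩ dh`, where a compactly supported function `b` on the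
total space is an element of `C_r^*(𝔊(X))` as the field of convolution operators
`φ ↦ ∫ b(h) φ(h⁻¹ ·) dh` on the spaces `L²(G x)`. If `u` and `v` are the fields of operators
`φ ↦ e · φ` and `φ ↦ f · φ`, then `u* v` is the convolution operator with `⟨e, f⟩`. So `𝓔` is
the closure, in the supremum norm over `x` of the operator norms, of the space of these fields.
(The smooth sections are dense in the compactly supported continuous ones in the inductive limit
topology, so that the latter have the same completion.) -/
def hilbertModule : Submodule ℂ
    (OperatorFields (fun x => L2 ℂ (μ.measure x)) (fun x => L2 (V.Z x) (μ.measure x))) :=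
  (Submodule.span ℂ {u | ∃ e : ∀ x, FibreSections V x,
    IsSmoothSection V e ∧ Represents V μ e u}).topologicalClosure

/-! ### Families of operators, cosymbols and parametrices -/

/-- A family of operators on the spaces `C_c^∞(E_x)`. -/
abbrev OperatorFamily : Type _ := ∀ x, FibreSections V x →ₗ[ℂ] FibreSections V x

variable {V}

/-- The operators `F x` depend smoothly on `x`. -/
def IsSmoothFamily (F : OperatorFamily V) : Prop :=
  ∀ e : ∀ x, FibreSections V x, IsSmoothSection V e → IsSmoothSection V (fun x => F x (e x))

/-- The operators `F x` commute with the left translations by elements of `G x`. -/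
def IsLeftInvariant (F : OperatorFamily V) : Prop :=
  ∀ (x : X) (a : T.G x) (e e' : FibreSections V x),
    (∀ g, (e' : T.G x → V.Z x) g = (e : T.G x → V.Z x) (a⁻¹ * g)) →
    ∀ g, (F x e' : T.G x → V.Z x) g = (F x e : T.G x → V.Z x) (a⁻¹ * g)

/-- `F x` and `F' x` are formally adjoint to each other, in `L²(E_x)`, for all `x`. -/
def AreFormallyAdjoint (F F' : OperatorFamily V) : Prop :=
  ∀ (x : X) (e f : FibreSections V x),
    ∫ g, inner ℂ ((F x e : T.G x → V.Z x) g) ((f : T.G x → V.Z x) g) ∂(μ.measure x) =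
      ∫ g, inner ℂ ((e : T.G x → V.Z x) g) ((F' x f : T.G x → V.Z x) g) ∂(μ.measure x)

/-- The operators `F x` are properly supported. -/
def IsProperlySupported (F : OperatorFamily V) : Prop :=
  ∀ (x : X) (C : Set (T.G x)), IsCompact C → ∃ C' : Set (T.G x), IsCompact C' ∧
    ∀ e : FibreSections V x,
      ((∀ g ∉ C, (e : T.G x → V.Z x) g = 0) → ∀ g ∉ C', (F x e : T.G x → V.Z x) g = 0) ∧
      ((∀ g ∈ C', (e : T.G x → V.Z x) g = 0) → ∀ g ∈ C, (F x e : T.G x → V.Z x) g = 0)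

variable (T) in
/-- Smooth functions on `G x / K x`. -/
def QuotientFunctions (x : X) : Type _ :=
  {f : T.G x → ℂ // ContMDiff (𝓡 d) 𝓘(ℝ, ℂ) ∞ f ∧ ∀ (g : T.G x) (k : T.K x), f (g * k) = f g}

variable (V) in
/-- Multiplication by a smooth function on `G x / K x`. -/
def mulBy {x : X} (f : QuotientFunctions T x) : FibreSections V x →ₗ[ℂ] FibreSections V x where
  toFun e := ⟨fun g => f.1 g • (e : T.G x → V.Z x) g, by
    obtain ⟨h1, h2, h3⟩ := e.2
    refine ⟨?_, ?_, fun g k => by simp [h3, f.2.2]⟩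
    · exact (ContinuousLinearMap.lsmul ℝ ℂ : ℂ →L[ℝ] V.Z x →L[ℝ] V.Z x).isBoundedBilinearMap.contDiff.contMDiff.comp
        (f.2.1.prodMk_space h1)
    · exact h2.smul_left (f := f.1)⟩
  map_add' a b := Subtype.ext (funext fun g => smul_add (f.1 g) (a.1 g) (b.1 g))
  map_smul' c a := Subtype.ext (funext fun g => smul_comm (f.1 g) c (a.1 g))

/-- `A` is a differential operator of order at most `m` on the sections of `E_x`: all iterated
commutators of `A` with `m + 1` smooth functions on `G x / K x` vanish. -/
def IsDiffOp {x : X} : ℕ → (FibreSections V x →ₗ[ℂ] FibreSections V x) → Prop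
  | 0, A => ∀ f : QuotientFunctions T x, A ∘ₗ mulBy V f - mulBy V f ∘ₗ A = 0
  | m + 1, A => ∀ f : QuotientFunctions T x, IsDiffOp m (A ∘ₗ mulBy V f - mulBy V f ∘ₗ A)

/-- A cosymbol (of a differential operator): a smooth family of left-invariant differential
operators on the bundles `E_x`. -/
structure IsCosymbol (D : OperatorFamily V) : Prop where
  leftInvariant : IsLeftInvariant D
  differential : ∀ x, ∃ m, IsDiffOp m (D x)
  smooth : IsSmoothFamily D

/-- The operators `F x` are convolution operators `(F x e)(g) = ∫ κ(h) e(g h) dh` with a properly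
supported kernel `κ` that is smooth on the total space and `K x`-invariant in each variable. -/
def IsSmoothing (F : OperatorFamily V) : Prop :=
  ∃ κ : ∀ x, T.G x → (V.Z x →L[ℂ] V.Z x),
    (∀ (i : X) (z : EuclideanSpace ℂ (Fin r)),
      ContMDiffOn (𝓡 (n + d)) 𝓘(ℝ, EuclideanSpace ℂ (Fin r)) ∞
        (fun p : T.Tot => (V.frame i p.proj).symm (κ p.proj p.snd (V.frame i p.proj z)))
        {p | p.proj ∈ V.U i}) ∧
    (∀ L : Set X, IsCompact L →
      IsCompact (closure {p : T.Tot | p.proj ∈ L ∧ κ p.proj p.snd ≠ 0})) ∧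
    (∀ (x : X) (k k' : T.K x) (h : T.G x) (z : V.Z x),
      κ x (k * h * k') z = V.act x k (κ x h (V.act x k' z))) ∧
    ∀ (x : X) (e : FibreSections V x) (g : T.G x),
      (F x e : T.G x → V.Z x) g = ∫ h, κ x h ((e : T.G x → V.Z x) (g * h)) ∂(μ.measure x)

/-- The closure of the operator `F` on `𝓔` belongs to `𝓚(𝓔)`. -/
def ExtendsToCompact (F : OperatorFamily V) : Prop :=
  ∃ S ∈ compactOps (hilbertModule V μ), ∀ e : ∀ x, FibreSections V x, IsSmoothSection V e →
    ∀ u v : hilbertModule V μ, Represents V μ e u → Represents V μ (fun x => F x (e x)) v → S u = v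

/-- `P` is a cosymbol parametrix for `D`. As always for operators with a distributional kernel, `P`
has a formal adjoint of the same type. (That the closures of `P x`, `1 - P x D x`, `1 - D x P x` are
compact operators on the fibre of `𝓔` at `x` follows from the last three conditions, by
evaluation at `x`.) -/
structure IsCosymbolParametrix (D P : OperatorFamily V) : Prop where
  leftInvariant : IsLeftInvariant P
  properlySupported : IsProperlySupported P
  smooth : IsSmoothFamily P
  adjoint : ∃ P' : OperatorFamily V, IsSmoothFamily P' ∧ AreFormallyAdjoint μ P P'
  smoothing_left : IsSmoothing μ (fun x => LinearMap.id - P x ∘ₗ D x)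
  smoothing_right : IsSmoothing μ (fun x => LinearMap.id - D x ∘ₗ P x)
  compact : ExtendsToCompact μ P
  compact_left : ExtendsToCompact μ (fun x => LinearMap.id - P x ∘ₗ D x)
  compact_right : ExtendsToCompact μ (fun x => LinearMap.id - D x ∘ₗ P x)

/-- The graph of the closure of `D`, as an unbounded operator on `𝓔` with domain the compactly
supported smooth sections. -/
def closureGraph (D : OperatorFamily V) : Submodule ℂ (hilbertModule V μ × hilbertModule V μ) :=
  (Submodule.span ℂ {p | ∃ e : ∀ x, FibreSections V x, IsSmoothSection V e ∧
    Represents V μ e p.1 ∧ Represents V μ (fun x => D x (e x)) p.2}).topologicalClosure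

end Bundle

end CoarsePDO

end

set_option linter.unusedSectionVars false

noncomputable section

namespace CoarsePDO

universe u v w

/-! ### Hilbert modules seen through the scalar forms of their fibres -/

section HilbertModule

variable {X : Type u} {H : X → Type v} {H' : X → Type w}
  [∀ x, NormedAddCommGroup (H x)] [∀ x, InnerProductSpace ℂ (H x)] [∀ x, CompleteSpace (H x)]
  [∀ x, NormedAddCommGroup (H' x)] [∀ x, InnerProductSpace ℂ (H' x)] [∀ x, CompleteSpace (H' x)]

namespace OperatorFields

/-! The closure `T` of `D` is self-adjoint and regular: it is closed, symmetric and densely defined,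
and `T + i` and `T - i` are onto. Everything asserted follows from this by a functional calculus
that needs only the two resolvents and one square root.

A vector `φ` over the point `x` turns the operator valued inner product into the scalar form `⟨ev x
φ a, ev x φ b⟩`. Adjointness, positivity and norms can all be read off from these forms
(`areAdjoint_iff`, `isPositiveOp_of_ev`, `norm_le_of_ev`), so Hilbert space arguments apply in each
fibre; below, `|a|` stands for `‖ev x φ a‖`. The forms may be degenerate, so existence statements
come from Neumann series and norm limits in the Banach algebra of operators
(`surjective_of_bounded_below`, `exists_positive_sqrt`).

Regularity is proved in `exists_add_smul_eq_of_parametrix`. Let `ζ = ± i`, `R = 1 - P D`, and let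
`P'` and `R' = 1 - D P'` be the formal adjoints of `P` and `R`. Symmetry gives `|(D - ζ) y| ≥ |y|`.
With `z = (D - ζ) y` one has `(D - ζ)(y - P' z) = R' z + ζ P' z`, hence `|y| ≤ 2 |P' z| + |R' z|`.
Now `P' (D - ζ)` and `R' (D - ζ)` are the adjoints of `V₁ = (D + ζ) P` and `V₂ = (D + ζ) R`. If both
are bounded, then `V₁ V₁* + V₂ V₂*` is bounded below, thus onto, and its range lies in the range of
`T + ζ`. Here `V₁` is bounded because `D P = 1 - S`, whereas `D R` is bounded only over compact
subsets of `X`; therefore `V₂` is cut off by a function on `X`.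

The local bound on `D R` is `norm_actionOp_comp_le`: `R` is a convolution, and `D R` is the
convolution with the kernel obtained by applying `D` to that of `R`. This is again a smooth family,
and Schur's test bounds it by a weighted integral of the kernel, which is locally bounded in `x`
because the Haar measures and the modular functions are.

In `exists_boundedTransform`, `A = (T + i)⁻¹ (T - i)⁻¹` is the inverse of `T² + 1`, `Q` is its
positive square root, and `σ` is the extension of `Q e ↦ T A e`. Then `1 - σ² = A`, and `A` is
compact because the identity `u = P (T u) + R u` makes the resolvent `(T + i)⁻¹` compact. -/

@[simp] lemma op_zero (x : X) : (0 : OperatorFields H H').op x = 0 := rfl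

@[simp] lemma op_add (a b : OperatorFields H H') (x : X) : (a + b).op x = a.op x + b.op x := rfl

@[simp] lemma op_sub (a b : OperatorFields H H') (x : X) : (a - b).op x = a.op x - b.op x := rfl

@[simp] lemma op_neg (a : OperatorFields H H') (x : X) : (-a).op x = -a.op x := rfl

@[simp] lemma op_smul (c : ℂ) (a : OperatorFields H H') (x : X) : (c • a).op x = c • a.op x := rfl

lemma ext_op {a b : OperatorFields H H'} (h : ∀ x φ, a.op x φ = b.op x φ) : a = b := by
  refine Subtype.ext (funext fun x => ?_)
  exact ContinuousLinearMap.ext (h x)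

lemma norm_op_le (a : OperatorFields H H') (x : X) : ‖a.op x‖ ≤ ‖a‖ :=
  lp.norm_apply_le_norm ENNReal.top_ne_zero
    (show lp (fun x => H x →L[ℂ] H' x) ∞ from a) x

lemma norm_op_apply_le (a : OperatorFields H H') (x : X) (φ : H x) : ‖a.op x φ‖ ≤ ‖a‖ * ‖φ‖ :=
  (a.op x).le_of_opNorm_le (a.norm_op_le x) φ

lemma norm_le {a : OperatorFields H H'} {c : ℝ} (hc : 0 ≤ c)
    (h : ∀ x φ, ‖a.op x φ‖ ≤ c * ‖φ‖) : ‖a‖ ≤ c := by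
  refine lp.norm_le_of_forall_le (f := (show lp (fun x => H x →L[ℂ] H' x) ∞ from a)) hc
    fun x => ?_
  exact ContinuousLinearMap.opNorm_le_bound _ hc (h x)

/-- The field of operators given by a uniformly bounded family. -/
def ofBounded (f : ∀ x, H x →L[ℂ] H' x) (h : ∃ c : ℝ, ∀ x, ‖f x‖ ≤ c) : OperatorFields H H' :=
  ⟨f, memℓp_infty (by
    obtain ⟨c, hc⟩ := h
    exact ⟨c, by rintro _ ⟨x, rfl⟩; exact hc x⟩)⟩

@[simp] lemma op_ofBounded (f : ∀ x, H x →L[ℂ] H' x) (h : ∃ c : ℝ, ∀ x, ‖f x‖ ≤ c) (x : X) :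
    (ofBounded f h).op x = f x := rfl

instance : CompleteSpace (OperatorFields H H') :=
  inferInstanceAs (CompleteSpace (lp (fun x => H x →L[ℂ] H' x) (⊤ : ℝ≥0∞)))

/-- Evaluation of a field of operators at a vector of the fibre over `x`. -/
def evalCLM (x : X) (φ : H x) : OperatorFields H H' →L[ℂ] H' x :=
  LinearMap.mkContinuous
    { toFun := fun a => a.op x φ, map_add' := fun _ _ => rfl, map_smul' := fun _ _ => rfl } ‖φ‖
    (fun a => (a.norm_op_apply_le x φ).trans_eq (mul_comm _ _))

end OperatorFields

variable {M : Submodule ℂ (OperatorFields H H' : Type (max u v w))}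

/-- Evaluation of an element of the module at a vector of the fibre over `x`. -/
def ev (x : X) (φ : H x) : M →L[ℂ] H' x :=
  (OperatorFields.evalCLM x φ).comp M.subtypeL

lemma ev_apply (x : X) (φ : H x) (a : M) : ev x φ a = a.1.op x φ := rfl

lemma ext_ev {a b : M} (h : ∀ x (φ : H x), ev x φ a = ev x φ b) : a = b :=
  Subtype.ext (OperatorFields.ext_op h)

lemma norm_ev_le (x : X) (φ : H x) (a : M) : ‖ev x φ a‖ ≤ ‖a‖ * ‖φ‖ :=
  a.1.norm_op_apply_le x φ

lemma norm_le_of_ev {a : M} {c : ℝ} (hc : 0 ≤ c)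
    (h : ∀ x (φ : H x), ‖ev x φ a‖ ≤ c * ‖φ‖) : ‖a‖ ≤ c :=
  OperatorFields.norm_le hc h

/-- An operator on a complex Hilbert space is determined by its quadratic form, so the identity of
fields of operators can be tested with the same vector `φ` on both sides. No polarization in `φ` is
needed afterwards. -/
lemma areAdjoint_iff {S S' : Ops M} : AreAdjoint S S' ↔
    ∀ (a b : M) (x : X) (φ : H x), inner ℂ (ev x φ (S a)) (ev x φ b) =
      inner ℂ (ev x φ a) (ev x φ (S' b)) := by
  constructor
  · intro h a b x φ
    have := congrArg (fun A : H x →L[ℂ] H x => inner ℂ φ (A φ)) (congrFun (h a b) x)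
    simpa [innerProd, ContinuousLinearMap.adjoint_inner_right, ev_apply] using this
  · intro h a b
    funext x
    refine ContinuousLinearMap.coe_inj.1 ((ext_inner_map _ _).1 fun φ => ?_)
    simpa [innerProd, ContinuousLinearMap.adjoint_inner_left, ev_apply] using
      congrArg (starRingEnd ℂ) (h a b x φ)

lemma AreAdjoint.ev_inner {S S' : Ops M} (h : AreAdjoint S S') (a b : M) (x : X) (φ : H x) :
    inner ℂ (ev x φ (S a)) (ev x φ b) = inner ℂ (ev x φ a) (ev x φ (S' b)) :=
  areAdjoint_iff.1 h a b x φ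

lemma AreAdjoint.symm {S S' : Ops M} (h : AreAdjoint S S') : AreAdjoint S' S :=
  areAdjoint_iff.2 fun a b x φ => by
    rw [← inner_conj_symm, ← h.ev_inner, inner_conj_symm]

lemma AreAdjoint.comp {S S' R R' : Ops M} (h : AreAdjoint S S') (k : AreAdjoint R R') :
    AreAdjoint (S.comp R) (R'.comp S') :=
  areAdjoint_iff.2 fun a b x φ => by
    simp only [ContinuousLinearMap.comp_apply]
    rw [h.ev_inner, k.ev_inner]

lemma AreAdjoint.add {S S' R R' : Ops M} (h : AreAdjoint S S') (k : AreAdjoint R R') :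
    AreAdjoint (S + R) (S' + R') :=
  areAdjoint_iff.2 fun a b x φ => by
    simp only [add_apply, map_add, inner_add_left, inner_add_right]
    rw [h.ev_inner, k.ev_inner]

lemma AreAdjoint.smul {S S' : Ops M} (c : ℂ) (h : AreAdjoint S S') :
    AreAdjoint (c • S) ((starRingEnd ℂ c) • S') :=
  areAdjoint_iff.2 fun a b x φ => by
    simp only [smul_apply, map_smul, inner_smul_left, inner_smul_right]
    rw [h.ev_inner]

lemma AreAdjoint.sub {S S' R R' : Ops M} (h : AreAdjoint S S') (k : AreAdjoint R R') :
    AreAdjoint (S - R) (S' - R') :=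
  areAdjoint_iff.2 fun a b x φ => by
    simp only [sub_apply, map_sub, inner_sub_left, inner_sub_right]
    rw [h.ev_inner, k.ev_inner]

lemma areAdjoint_id : AreAdjoint (ContinuousLinearMap.id ℂ M) (ContinuousLinearMap.id ℂ M) :=
  fun _ _ => rfl

lemma areAdjoint_zero : AreAdjoint (0 : Ops M) 0 :=
  areAdjoint_iff.2 fun a b x φ => by simp

lemma AreAdjoint.of_tendsto {S S' : ℕ → Ops M} {R R' : Ops M} (h : ∀ k, AreAdjoint (S k) (S' k))
    (hS : Filter.Tendsto S Filter.atTop (𝓝 R)) (hS' : Filter.Tendsto S' Filter.atTop (𝓝 R')) :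
    AreAdjoint R R' :=
  areAdjoint_iff.2 fun a b x φ => by
    have h1 : Filter.Tendsto (fun k => ev x φ (S k a)) Filter.atTop (𝓝 (ev x φ (R a))) :=
      ((ev x φ).continuous.tendsto _).comp
        (((ContinuousLinearMap.apply ℂ M a).continuous.tendsto R).comp hS)
    have h2 : Filter.Tendsto (fun k => ev x φ (S' k b)) Filter.atTop (𝓝 (ev x φ (R' b))) :=
      ((ev x φ).continuous.tendsto _).comp
        (((ContinuousLinearMap.apply ℂ M b).continuous.tendsto R').comp hS')
    refine tendsto_nhds_unique (h1.inner tendsto_const_nhds) ?_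
    refine (tendsto_const_nhds.inner h2).congr fun k => ?_
    exact ((h k).ev_inner a b x φ).symm

lemma isPositiveOp_of_ev {S : Ops M} (hS : AreAdjoint S S)
    (h : ∀ (a : M) (x : X) (φ : H x), 0 ≤ (inner ℂ (ev x φ (S a)) (ev x φ a)).re) :
    IsPositiveOp S := by
  intro a x
  have h1 : ∀ φ, inner ℂ (innerProd (S a) a x φ) φ =
      inner ℂ (ev x φ a) (ev x φ (S a)) := fun φ => by
    simp [innerProd, ContinuousLinearMap.adjoint_inner_left, ev_apply]
  rw [ContinuousLinearMap.isPositive_iff_complex]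
  intro φ
  have h2 : inner ℂ (ev x φ a) (ev x φ (S a)) = inner ℂ (ev x φ (S a)) (ev x φ a) :=
    (hS.ev_inner a a x φ).symm
  have h3 : (starRingEnd ℂ) (inner ℂ (ev x φ (S a)) (ev x φ a)) =
      inner ℂ (ev x φ (S a)) (ev x φ a) := by rw [inner_conj_symm, h2]
  rw [h1, h2]
  exact ⟨Complex.conj_eq_iff_re.1 h3, h a x φ⟩

lemma IsPositiveOp.ev_inner {S : Ops M} (h : IsPositiveOp S) (a : M) (x : X) (φ : H x) :
    0 ≤ (inner ℂ (ev x φ (S a)) (ev x φ a)).re ∧ inner ℂ (ev x φ (S a)) (ev x φ a) =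
      inner ℂ (ev x φ a) (ev x φ (S a)) := by
  have h1 : inner ℂ (innerProd (S a) a x φ) φ =
      inner ℂ (ev x φ a) (ev x φ (S a)) := by
    simp [innerProd, ContinuousLinearMap.adjoint_inner_left, ev_apply]
  have h2 := (ContinuousLinearMap.isPositive_iff_complex _).1 (h a x) φ
  rw [h1] at h2
  have h3 : inner ℂ (ev x φ (S a)) (ev x φ a) = inner ℂ (ev x φ a) (ev x φ (S a)) := by
    rw [← inner_conj_symm, ← h2.1]
    simp
  exact ⟨by rw [h3]; exact h2.2, h3⟩

/-- A positive operator is self-adjoint. -/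
lemma IsPositiveOp.areAdjoint {S : Ops M} (h : IsPositiveOp S) : AreAdjoint S S := by
  refine areAdjoint_iff.2 fun a b x φ => ?_
  have h0 := fun a : M => (h.ev_inner a x φ).2
  -- Polarization in the module: `a + b` yields the sum of the two mixed terms and `a + i b` their
  -- difference.
  have h1 := h0 (a + b)
  have h2 := h0 (a + Complex.I • b)
  simp only [map_add, map_smul, inner_add_left, inner_add_right, inner_smul_left,
    inner_smul_right, h0 a, h0 b, Complex.conj_I] at h1 h2
  have h3 : inner ℂ (ev x φ (S b)) (ev x φ a) + inner ℂ (ev x φ (S a)) (ev x φ b) =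
      inner ℂ (ev x φ b) (ev x φ (S a)) + inner ℂ (ev x φ a) (ev x φ (S b)) := by
    linear_combination h1
  have h4 : -Complex.I * inner ℂ (ev x φ (S b)) (ev x φ a) +
      Complex.I * inner ℂ (ev x φ (S a)) (ev x φ b) =
      -Complex.I * inner ℂ (ev x φ b) (ev x φ (S a)) +
      Complex.I * inner ℂ (ev x φ a) (ev x φ (S b)) := by
    linear_combination h2
  have h5 : inner ℂ (ev x φ (S a)) (ev x φ b) - inner ℂ (ev x φ (S b)) (ev x φ a) =
      inner ℂ (ev x φ a) (ev x φ (S b)) - inner ℂ (ev x φ b) (ev x φ (S a)) :=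
    mul_left_cancel₀ Complex.I_ne_zero (by linear_combination h4)
  linear_combination (1 / 2) * h3 + (1 / 2) * h5

end HilbertModule

/-! ### Square roots in a Banach algebra -/

/-- The power series of `1 - √(1 - s)` converges, in operator norm, on the closed unit ball. -/
lemma exists_sqrt_one_sub {R : Type*} [NormedRing R] [NormedAlgebra ℂ R] [CompleteSpace R]
    (s : R) (hs : ‖s‖ ≤ 1) : ∃ (Y : ℕ → R) (L : R), Y 0 = 0 ∧
      (∀ k, Y (k + 1) = ((1 / 2 : ℝ) : ℂ) • (s + Y k * Y k)) ∧
      Filter.Tendsto Y Filter.atTop (𝓝 L) ∧ (1 - L) * (1 - L) = 1 - s ∧ ‖L‖ ≤ 1 ∧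
      ∀ b, Commute s b → Commute L b := by
  -- A fixed point of the iteration satisfies `2 L = s + L²`, that is, `(1 - L)² = 1 - s`. The
  -- scalar sequence `y` is the iteration for `s = 1`; it majorizes `Y` together with its
  -- increments. As `y` stays below `1`, the increments are summable, even in the borderline case
  -- `‖s‖ = 1`.
  let Y : ℕ → R := fun k => Nat.rec 0 (fun _ y => ((1 / 2 : ℝ) : ℂ) • (s + y * y)) k
  let y : ℕ → ℝ := fun k => Nat.rec 0 (fun _ t => (1 / 2 : ℝ) * (1 + t * t)) k
  have hY : ∀ k, Y (k + 1) = ((1 / 2 : ℝ) : ℂ) • (s + Y k * Y k) := fun _ => rfl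
  have hy : ∀ k, y (k + 1) = (1 / 2 : ℝ) * (1 + y k * y k) := fun _ => rfl
  have y01 : ∀ k, 0 ≤ y k ∧ y k ≤ 1 := by
    intro k
    induction k with
    | zero => exact ⟨le_rfl, zero_le_one⟩
    | succ k ih => rw [hy]; constructor <;> nlinarith [ih.1, ih.2]
  have hcomm : ∀ k, Commute (Y k) s := by
    intro k
    induction k with
    | zero => exact Commute.zero_left s
    | succ k ih => rw [hY]; exact (((Commute.refl s).add_left (ih.mul_left ih)).smul_left _)
  have hcomm' : ∀ k, Commute (Y k) (Y (k + 1)) := by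
    intro k
    rw [hY]
    exact ((hcomm k).add_right ((Commute.refl _).mul_right (Commute.refl _))).smul_right _
  have hnorm : ∀ k, ‖Y k‖ ≤ y k := by
    intro k
    induction k with
    | zero => simp [Y, y]
    | succ k ih =>
      rw [hY, hy, norm_smul]
      have h1 : ‖Y k * Y k‖ ≤ y k * y k :=
        (norm_mul_le _ _).trans (mul_le_mul ih ih (norm_nonneg _) (y01 k).1)
      have h2 := norm_add_le s (Y k * Y k)
      rw [Complex.norm_real, Real.norm_of_nonneg (by norm_num)]
      linarith
  have hdiff : ∀ k, ‖Y (k + 1) - Y k‖ ≤ y (k + 1) - y k := by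
    intro k
    induction k with
    | zero =>
      have h0 : Y (0 + 1) - Y 0 = ((1 / 2 : ℝ) : ℂ) • s := by simp [Y]
      have h1 : y (0 + 1) - y 0 = 1 / 2 := by simp [y]
      rw [h0, h1, norm_smul, Complex.norm_real, Real.norm_of_nonneg (by norm_num)]
      linarith
    | succ k ih =>
      have h0 : Y (k + 1 + 1) - Y (k + 1) =
          ((1 / 2 : ℝ) : ℂ) • ((Y (k + 1) + Y k) * (Y (k + 1) - Y k)) := by
        rw [hY (k + 1)]
        nth_rewrite 3 [hY k]
        rw [← smul_sub]
        congr 1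
        -- The iterates commute, so the difference of their squares factors.
        have := (hcomm' k).eq
        rw [mul_sub, add_mul, add_mul, this]
        abel
      have h1 : y (k + 1 + 1) - y (k + 1) =
          (1 / 2 : ℝ) * ((y (k + 1) + y k) * (y (k + 1) - y k)) := by
        rw [hy (k + 1)]
        nth_rewrite 3 [hy k]
        ring
      rw [h0, h1, norm_smul, Complex.norm_real, Real.norm_of_nonneg (by norm_num)]
      refine mul_le_mul_of_nonneg_left ((norm_mul_le _ _).trans (mul_le_mul ?_ ih
        (norm_nonneg _) (add_nonneg (y01 (k + 1)).1 (y01 k).1))) (by norm_num)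
      exact (norm_add_le _ _).trans (add_le_add (hnorm (k + 1)) (hnorm k))
  have hsum : Summable fun k => y (k + 1) - y k := by
    refine summable_of_sum_range_le (c := 1) (fun k => (norm_nonneg _).trans (hdiff k)) fun k => ?_
    rw [Finset.sum_range_sub]
    have : y 0 = 0 := rfl
    linarith [(y01 k).2]
  have hcau : CauchySeq Y :=
    cauchySeq_of_dist_le_of_summable _
      (fun k => by rw [dist_comm, dist_eq_norm]; exact hdiff k) hsum
  obtain ⟨L, hL⟩ := cauchySeq_tendsto_of_complete hcau
  refine ⟨Y, L, rfl, hY, hL, ?_, le_of_tendsto hL.norm (Filter.Eventually.of_forall fun k =>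
    (hnorm k).trans (y01 k).2), fun b hb => ?_⟩
  swap
  · have hYb : ∀ k, Commute (Y k) b := by
      intro k
      induction k with
      | zero => exact Commute.zero_left b
      | succ k ih => rw [hY]; exact ((hb.add_left (ih.mul_left ih)).smul_left _)
    refine tendsto_nhds_unique (hL.mul_const b) ((hL.const_mul b).congr fun k => ?_)
    exact (hYb k).eq.symm
  have hL' : L = ((1 / 2 : ℝ) : ℂ) • (s + L * L) := by
    refine tendsto_nhds_unique ((Filter.tendsto_add_atTop_iff_nat 1).2 hL) ?_
    simp only [hY]
    exact (tendsto_const_nhds.add (hL.mul hL)).const_smul _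
  have h2 : L + L = s + L * L := by
    rw [← two_smul ℂ L]
    nth_rewrite 1 [hL']
    rw [smul_smul]
    norm_num
  have h3 : s = L + L - L * L := by rw [h2]; abel
  rw [h3]
  noncomm_ring

/-! ### Fibrewise norm estimates, surjectivity and positive square roots -/

section HilbertModule

variable {X : Type u} {H : X → Type v} {H' : X → Type w}
  [∀ x, NormedAddCommGroup (H x)] [∀ x, InnerProductSpace ℂ (H x)] [∀ x, CompleteSpace (H x)]
  [∀ x, NormedAddCommGroup (H' x)] [∀ x, InnerProductSpace ℂ (H' x)] [∀ x, CompleteSpace (H' x)]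

variable {M : Submodule ℂ (OperatorFields H H' : Type (max u v w))}

/-- A self-adjoint operator is bounded by its norm in each fibre. -/
lemma norm_ev_le_of_selfAdjoint {S : Ops M} (hS : AreAdjoint S S) (a : M) (x : X) (φ : H x) :
    ‖ev x φ (S a)‖ ≤ ‖S‖ * ‖ev x φ a‖ := by
  -- Cauchy–Schwarz gives `|S^k a|² ≤ |S^(2k) a| |a|` in the seminorm of a fibre. Iterated along
  -- powers of two, this leaves the crude bound `‖a‖ ‖φ‖` of the seminorm outside the power `2^k`,
  -- so that it does not affect the growth rate.
  have hpow : ∀ k, AreAdjoint (S ^ k) (S ^ k) := by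
    intro k
    induction k with
    | zero => exact areAdjoint_id
    | succ k ih =>
      nth_rewrite 1 [pow_succ]
      rw [pow_succ']
      exact ih.comp hS
  have h1 : ∀ k, ‖ev x φ ((S ^ k) a)‖ ^ 2 ≤ ‖ev x φ ((S ^ (2 * k)) a)‖ * ‖ev x φ a‖ := by
    intro k
    rw [← @inner_self_eq_norm_sq ℂ, (hpow k).ev_inner, mul_comm]
    refine (Complex.re_le_norm _).trans ((norm_inner_le_norm _ _).trans_eq ?_)
    rw [two_mul, pow_add]
    rfl
  set t := ‖ev x φ a‖ with ht
  have ht0 : 0 ≤ t := norm_nonneg _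
  rcases ht0.eq_or_lt with h0 | h0
  · have := h1 1
    rw [← h0, mul_zero, pow_one] at this
    rw [← h0, mul_zero]
    exact le_of_eq (pow_eq_zero_iff two_ne_zero |>.1 (le_antisymm this (sq_nonneg _)))
  have h2 : ∀ k, ‖ev x φ (S a)‖ ^ (2 ^ k) * t ≤ ‖ev x φ ((S ^ (2 ^ k)) a)‖ * t ^ (2 ^ k) := by
    intro k
    induction k with
    | zero => simp
    | succ k ih =>
      have h3 := h1 (2 ^ k)
      have h4 : (‖ev x φ (S a)‖ ^ (2 ^ k) * t) ^ 2 ≤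
          (‖ev x φ ((S ^ (2 ^ k)) a)‖ * t ^ (2 ^ k)) ^ 2 :=
        pow_le_pow_left₀ (by positivity) ih 2
      have h5 : (‖ev x φ ((S ^ (2 ^ k)) a)‖ * t ^ (2 ^ k)) ^ 2 ≤
          (‖ev x φ ((S ^ (2 ^ (k + 1))) a)‖ * t) * t ^ (2 ^ (k + 1)) := by
        rw [mul_pow, ← pow_mul, ← pow_succ]
        refine mul_le_mul_of_nonneg_right ?_ (by positivity)
        rw [pow_succ' 2 k]
        exact h3
      have h6 : (‖ev x φ (S a)‖ ^ (2 ^ (k + 1)) * t) * t ≤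
          (‖ev x φ ((S ^ (2 ^ (k + 1))) a)‖ * t ^ (2 ^ (k + 1))) * t := by
        refine le_trans (le_of_eq ?_) ((h4.trans h5).trans (le_of_eq ?_))
        · rw [mul_pow, ← pow_mul, ← pow_succ]; ring
        · ring
      exact le_of_mul_le_mul_right h6 h0
  by_contra! hcon
  have hS0 : 0 < ‖S‖ := by
    rcases (norm_nonneg S).eq_or_lt with h | h
    · exfalso
      have h3 : S a = 0 := norm_le_zero_iff.1 ((S.le_opNorm a).trans_eq (by rw [← h, zero_mul]))
      rw [h3, map_zero, norm_zero, ← h, zero_mul] at hcon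
      exact lt_irrefl _ hcon
    · exact h
  -- If the estimate failed, then `q > 1`, although the powers `q ^ (2 ^ k)` are bounded.
  set q := ‖ev x φ (S a)‖ / (‖S‖ * t) with hq
  have hq1 : 1 < q := (one_lt_div (by positivity)).2 hcon
  have hbd : ∀ k, q ^ (2 ^ k) ≤ ‖a‖ * ‖φ‖ / t := by
    intro k
    have h3 : ‖ev x φ ((S ^ (2 ^ k)) a)‖ ≤ ‖S‖ ^ (2 ^ k) * (‖a‖ * ‖φ‖) := by
      refine (norm_ev_le _ _ _).trans ?_
      rw [← mul_assoc]
      refine mul_le_mul_of_nonneg_right ?_ (norm_nonneg _)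
      exact (ContinuousLinearMap.le_opNorm _ _).trans
        (mul_le_mul_of_nonneg_right (norm_pow_le' _ (by positivity)) (norm_nonneg _))
    have h4 := (h2 k).trans (mul_le_mul_of_nonneg_right h3 (by positivity))
    rw [hq, div_pow, mul_pow, div_le_div_iff₀ (by positivity) h0]
    linarith
  obtain ⟨k, hk⟩ := pow_unbounded_of_one_lt (‖a‖ * ‖φ‖ / t) hq1
  exact absurd (hbd k) (not_le.2 (hk.trans_le (pow_le_pow_right₀ hq1.le Nat.lt_two_pow_self.le)))

/-- A self-adjoint operator is bounded by its numerical radius in each fibre. -/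
lemma norm_ev_le_of_numericalRadius {S : Ops M} (hS : AreAdjoint S S) {c : ℝ} (hc : 0 < c)
    (h : ∀ (a : M) (x : X) (φ : H x),
      |(inner ℂ (ev x φ (S a)) (ev x φ a)).re| ≤ c * ‖ev x φ a‖ ^ 2)
    (a : M) (x : X) (φ : H x) : ‖ev x φ (S a)‖ ≤ c * ‖ev x φ a‖ := by
  -- With `b = S a / c`, the mixed terms of the form of `S` at `a ± b` equal `|S a|² / c`. The
  -- hypothesis at `a ± b` and the parallelogram law bound `4 |S a|² / c` by `2 c (|a|² + |S a|² /
  -- c²)`.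
  set b : M := ((1 / c : ℝ) : ℂ) • S a with hb
  have h1 := (abs_le.1 (h (a + b) x φ)).2
  have h2 := (abs_le.1 (h (a - b) x φ)).1
  have hp := parallelogram_law_with_norm ℂ (ev x φ a) (ev x φ b)
  rw [← map_add, ← map_sub] at hp
  have hsb : inner ℂ (ev x φ (S b)) (ev x φ a) = inner ℂ (ev x φ b) (ev x φ (S a)) :=
    hS.ev_inner _ _ _ _
  have h3 : (inner ℂ (ev x φ (S (a + b))) (ev x φ (a + b))).re -
      (inner ℂ (ev x φ (S (a - b))) (ev x φ (a - b))).re = 4 / c * ‖ev x φ (S a)‖ ^ 2 := by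
    simp only [map_add, map_sub, inner_add_left, inner_add_right, inner_sub_left, inner_sub_right,
      hsb, Complex.add_re, Complex.sub_re]
    have h4 : inner ℂ (ev x φ b) (ev x φ (S a)) =
        (((1 / c) * ‖ev x φ (S a)‖ ^ 2 : ℝ) : ℂ) := by
      rw [hb, map_smul, inner_smul_left, Complex.conj_ofReal, inner_self_eq_norm_sq_to_K]
      push_cast; rfl
    have h5 : inner ℂ (ev x φ (S a)) (ev x φ b) =
        (((1 / c) * ‖ev x φ (S a)‖ ^ 2 : ℝ) : ℂ) := by
      rw [← inner_conj_symm, h4, Complex.conj_ofReal]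
    rw [h4, h5, Complex.ofReal_re]
    ring
  have h6 : ‖ev x φ b‖ = (1 / c) * ‖ev x φ (S a)‖ := by
    rw [hb, map_smul, norm_smul, Complex.norm_real, Real.norm_of_nonneg (by positivity)]
  have h7 : 4 / c * ‖ev x φ (S a)‖ ^ 2 ≤
      c * (2 * (‖ev x φ a‖ ^ 2 + ((1 / c) * ‖ev x φ (S a)‖) ^ 2)) := by
    rw [← h6, ← h3]
    nlinarith
  have h8 : ‖ev x φ (S a)‖ ^ 2 ≤ (c * ‖ev x φ a‖) ^ 2 := by
    have : c * (2 * (‖ev x φ a‖ ^ 2 + ((1 / c) * ‖ev x φ (S a)‖) ^ 2)) =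
        2 * c * ‖ev x φ a‖ ^ 2 + 2 / c * ‖ev x φ (S a)‖ ^ 2 := by
      field_simp
    rw [this] at h7
    have h9 : 2 / c * ‖ev x φ (S a)‖ ^ 2 ≤ 2 * c * ‖ev x φ a‖ ^ 2 := by
      have : 4 / c * ‖ev x φ (S a)‖ ^ 2 = 2 * (2 / c * ‖ev x φ (S a)‖ ^ 2) := by ring
      linarith
    have h10 := mul_le_mul_of_nonneg_left h9 (by positivity : 0 ≤ c / 2)
    have h11 : c / 2 * (2 / c * ‖ev x φ (S a)‖ ^ 2) = ‖ev x φ (S a)‖ ^ 2 := by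
      field_simp
    nlinarith
  exact (pow_le_pow_iff_left₀ (norm_nonneg _) (by positivity) two_ne_zero).1 h8

lemma norm_le_of_norm_ev_le {S : Ops M} {c : ℝ} (hc : 0 ≤ c)
    (h : ∀ (a : M) (x : X) (φ : H x), ‖ev x φ (S a)‖ ≤ c * ‖ev x φ a‖) : ‖S‖ ≤ c :=
  S.opNorm_le_bound hc fun a => norm_le_of_ev (by positivity) fun x φ =>
    ((h a x φ).trans (mul_le_mul_of_nonneg_left (norm_ev_le x φ a) hc)).trans_eq (by ring)

/-- A self-adjoint operator that is bounded below in each fibre is surjective. -/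
lemma surjective_of_bounded_below [CompleteSpace M] {S : Ops M} (hS : AreAdjoint S S)
    {c : ℝ} (hc : 0 < c)
    (h : ∀ (a : M) (x : X) (φ : H x),
      c * ‖ev x φ a‖ ^ 2 ≤ (inner ℂ (ev x φ (S a)) (ev x φ a)).re) : Function.Surjective S := by
  -- As `K` exceeds `‖S‖` and `c`, the form of `R = 1 - S / K` lies between `0` and `1 - c / K < 1`.
  -- By the numerical radius `‖R‖ < 1`, and a Neumann series inverts `1 - R = S / K`.
  set K := ‖S‖ + c + 1 with hK
  have hK0 : 0 < K := by positivity
  have hcK : c / K < 1 := (div_lt_one hK0).2 (by have := norm_nonneg S; linarith)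
  set R : Ops M := ContinuousLinearMap.id ℂ M - ((1 / K : ℝ) : ℂ) • S with hR
  have hRadj : AreAdjoint R R := by
    have := (areAdjoint_id (M := M)).sub (hS.smul ((1 / K : ℝ) : ℂ))
    rwa [Complex.conj_ofReal] at this
  have hRn : ‖R‖ ≤ 1 - c / K := by
    refine norm_le_of_norm_ev_le (by linarith) (norm_ev_le_of_numericalRadius hRadj
      (by linarith) fun a x φ => ?_)
    have h1 : (inner ℂ (ev x φ (R a)) (ev x φ a)).re =
        ‖ev x φ a‖ ^ 2 - (1 / K) * (inner ℂ (ev x φ (S a)) (ev x φ a)).re := by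
      rw [hR]
      simp only [sub_apply, smul_apply, ContinuousLinearMap.id_apply, map_sub, map_smul,
        inner_sub_left, inner_smul_left, Complex.conj_ofReal, Complex.sub_re, Complex.re_ofReal_mul]
      rw [inner_self_eq_norm_sq_to_K]
      norm_cast
    have h2 : (inner ℂ (ev x φ (S a)) (ev x φ a)).re ≤ K * ‖ev x φ a‖ ^ 2 := by
      refine (Complex.re_le_norm _).trans ((norm_inner_le_norm _ _).trans ?_)
      have h3 := norm_ev_le_of_selfAdjoint hS a x φ
      have h4 := norm_nonneg (ev x φ a)
      nlinarith [mul_le_mul_of_nonneg_right h3 h4, sq_nonneg ‖ev x φ a‖]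
    have h5 : (1 / K) * (inner ℂ (ev x φ (S a)) (ev x φ a)).re ≤ ‖ev x φ a‖ ^ 2 := by
      rw [one_div, inv_mul_le_iff₀ hK0]; exact h2
    have h6 : c / K * ‖ev x φ a‖ ^ 2 ≤ (1 / K) * (inner ℂ (ev x φ (S a)) (ev x φ a)).re := by
      have := mul_le_mul_of_nonneg_left (h a x φ) (by positivity : 0 ≤ 1 / K)
      refine le_trans (le_of_eq (by ring)) this
    rw [h1, abs_of_nonneg (by linarith)]
    linarith
  have hlt : ‖R‖ < 1 := by
    have : 0 < c / K := by positivity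
    linarith
  have hu : IsUnit (1 - R) := isUnit_one_sub_of_norm_lt_one (R := Ops M) hlt
  obtain ⟨U, hU⟩ := hu
  intro e
  refine ⟨((1 / K : ℝ) : ℂ) • (U⁻¹).1 e, ?_⟩
  have h1 : (1 - R) ((U⁻¹).1 e) = e := by
    rw [← hU]
    exact congrArg (fun B : Ops M => B e) U.mul_inv
  have h2 : (1 - R) = ((1 / K : ℝ) : ℂ) • S := by
    rw [hR]; exact sub_sub_cancel _ _
  rw [h2] at h1
  rw [map_smul]
  exact h1

/-- A positive contraction has a positive square root, which commutes with every operator that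
commutes with it. -/
lemma exists_positive_sqrt [CompleteSpace M] {A : Ops M} (hA : AreAdjoint A A)
    (h0 : ∀ (a : M) (x : X) (φ : H x), 0 ≤ (inner ℂ (ev x φ (A a)) (ev x φ a)).re)
    (h1 : ∀ (a : M) (x : X) (φ : H x),
      (inner ℂ (ev x φ (A a)) (ev x φ a)).re ≤ ‖ev x φ a‖ ^ 2) :
    ∃ Q : Ops M, AreAdjoint Q Q ∧ IsPositiveOp Q ∧ Q.comp Q = A ∧
      ∀ B : Ops M, Commute A B → Commute Q B := by
  -- The form of `1 - A` has values between `0` and `|a|²`; the numerical radius estimate converts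
  -- this into the norm bound that the iteration requires.
  set S : Ops M := 1 - A with hSdef
  have hS : AreAdjoint S S := areAdjoint_id.sub hA
  have hSn : ‖S‖ ≤ 1 := by
    refine norm_le_of_norm_ev_le zero_le_one
      (norm_ev_le_of_numericalRadius hS one_pos fun a x φ => ?_)
    have h2 : (inner ℂ (ev x φ (S a)) (ev x φ a)).re =
        ‖ev x φ a‖ ^ 2 - (inner ℂ (ev x φ (A a)) (ev x φ a)).re := by
      rw [hSdef]
      simp only [sub_apply, one_apply_eq_self, map_sub, inner_sub_left, Complex.sub_re]
      rw [inner_self_eq_norm_sq_to_K]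
      norm_cast
    rw [h2, abs_of_nonneg (by linarith [h1 a x φ])]
    linarith [h0 a x φ]
  obtain ⟨Y, L, hY0, hY, hL, hsq, hLn, hLcomm⟩ := exists_sqrt_one_sub (R := Ops M) S hSn
  have hYadj : ∀ k, AreAdjoint (Y k) (Y k) := by
    intro k
    induction k with
    | zero => rw [hY0]; exact areAdjoint_zero
    | succ k ih =>
      have h3 := (hS.add (ih.comp ih)).smul ((1 / 2 : ℝ) : ℂ)
      rw [Complex.conj_ofReal] at h3
      rw [hY]
      exact h3
  have hLadj : AreAdjoint L L := AreAdjoint.of_tendsto hYadj hL hL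
  have hQ : AreAdjoint (1 - L) (1 - L) := areAdjoint_id.sub hLadj
  refine ⟨1 - L, hQ, isPositiveOp_of_ev hQ fun a x φ => ?_, ?_, fun B hB => ?_⟩
  · have h2 : (inner ℂ (ev x φ ((1 - L) a)) (ev x φ a)).re =
        ‖ev x φ a‖ ^ 2 - (inner ℂ (ev x φ (L a)) (ev x φ a)).re := by
      simp only [sub_apply, one_apply_eq_self, map_sub, inner_sub_left, Complex.sub_re]
      rw [inner_self_eq_norm_sq_to_K]
      norm_cast
    have h3 : (inner ℂ (ev x φ (L a)) (ev x φ a)).re ≤ ‖ev x φ a‖ ^ 2 := by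
      refine (Complex.re_le_norm _).trans ((norm_inner_le_norm _ _).trans ?_)
      have h3 := norm_ev_le_of_selfAdjoint hLadj a x φ
      have h4 := norm_nonneg (ev x φ a)
      nlinarith [mul_le_mul_of_nonneg_right h3 h4,
        mul_le_mul_of_nonneg_right hLn (sq_nonneg ‖ev x φ a‖)]
    rw [h2]
    linarith
  · have h3 : (1 - L) * (1 - L) = A := by rw [hsq, hSdef, sub_sub_cancel]
    exact h3
  · have hSB : Commute S B := (Commute.one_left B).sub_left hB
    have hLB : Commute L B := hLcomm B hSB
    exact (Commute.one_left B).sub_left hLB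

/-- Uniqueness of positive square roots of injective operators. -/
lemma positive_sqrt_unique {A Q Q' : Ops M} (hA : ∀ a, A a = 0 → a = 0)
    (hQ : IsPositiveOp Q) (hQ' : IsPositiveOp Q') (hQA : Q.comp Q = A) (hQA' : Q'.comp Q' = A)
    (hcomm : Commute Q Q') : Q' = Q := by
  refine ContinuousLinearMap.ext fun a => ?_
  -- `Q + Q'` is injective, and it annihilates `Q' a - Q a` because `Q` and `Q'` commute and have
  -- the same square.
  have key : ∀ b : M, Q b + Q' b = 0 → b = 0 := by
    intro b hb
    refine hA b ?_
    suffices Q b = 0 by rw [← hQA, ContinuousLinearMap.comp_apply, this, map_zero]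
    refine ext_ev fun x φ => ?_
    have h1 : (inner ℂ (ev x φ (Q b)) (ev x φ b)).re = 0 := by
      have h2 := (hQ.ev_inner b x φ).1
      have h3 := (hQ'.ev_inner b x φ).1
      have h4 : inner ℂ (ev x φ (Q b)) (ev x φ b) + inner ℂ (ev x φ (Q' b)) (ev x φ b) = 0 := by
        rw [← inner_add_left, ← map_add, hb, map_zero, inner_zero_left]
      have h5 := congrArg Complex.re h4
      rw [Complex.add_re, Complex.zero_re] at h5
      linarith
    -- The form of `Q` vanishes at `b`; to get `Q b = 0`, positivity is tested at `b - t Q b`. For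
    -- `t = 1 / K` the quadratic term is at most `t |Q b|²`, half of the negative linear term `2 t
    -- |Q b|²`.
    set K := ‖Q‖ + 1 with hK
    have hK0 : 0 < K := by positivity
    set t : ℝ := 1 / K with ht
    have h2 := (hQ.ev_inner (b - (t : ℂ) • Q b) x φ).1
    have h3 : (inner ℂ (ev x φ (Q (b - (t : ℂ) • Q b))) (ev x φ (b - (t : ℂ) • Q b))).re =
        (inner ℂ (ev x φ (Q b)) (ev x φ b)).re - 2 * t * ‖ev x φ (Q b)‖ ^ 2 +
          t ^ 2 * (inner ℂ (ev x φ (Q (Q b))) (ev x φ (Q b))).re := by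
      simp only [map_sub, map_smul, inner_sub_left, inner_sub_right, inner_smul_left,
        inner_smul_right, Complex.conj_ofReal, Complex.sub_re, Complex.re_ofReal_mul]
      rw [hQ.areAdjoint.ev_inner (Q b) b, ← @inner_self_eq_norm_sq ℂ]
      simp only [RCLike.re_eq_complex_re]
      ring
    have h4 : (inner ℂ (ev x φ (Q (Q b))) (ev x φ (Q b))).re ≤ K * ‖ev x φ (Q b)‖ ^ 2 := by
      refine (Complex.re_le_norm _).trans ((norm_inner_le_norm _ _).trans ?_)
      have h3 := norm_ev_le_of_selfAdjoint hQ.areAdjoint (Q b) x φ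
      have h4 := norm_nonneg (ev x φ (Q b))
      nlinarith [mul_le_mul_of_nonneg_right h3 h4, sq_nonneg ‖ev x φ (Q b)‖]
    rw [h3, h1] at h2
    have h5 : t ^ 2 * (K * ‖ev x φ (Q b)‖ ^ 2) = t * ‖ev x φ (Q b)‖ ^ 2 := by
      rw [ht]; field_simp
    have h6 := mul_le_mul_of_nonneg_left h4 (sq_nonneg t)
    have ht0 : 0 < t := by positivity
    have h7 : t * ‖ev x φ (Q b)‖ ^ 2 ≤ 0 := by linarith
    have h8 : ‖ev x φ (Q b)‖ ^ 2 ≤ 0 := by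
      by_contra! hlt
      exact absurd h7 (not_le.2 (mul_pos ht0 hlt))
    rw [map_zero]
    exact norm_eq_zero.1 (pow_eq_zero_iff two_ne_zero |>.1 (le_antisymm h8 (sq_nonneg _)))
  refine sub_eq_zero.1 (key _ ?_)
  have e1 := congrArg (fun B : Ops M => B a) hQA
  have e2 := congrArg (fun B : Ops M => B a) hQA'
  have e3 := congrArg (fun B : Ops M => B a) hcomm.eq
  simp only [ContinuousLinearMap.comp_apply] at e1 e2
  replace e3 : Q (Q' a) = Q' (Q a) := e3
  rw [map_sub, map_sub, e1, e2, e3]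
  abel

end HilbertModule

/-! ### Self-adjoint regular operators and their bounded transform -/

section HilbertModule

variable {X : Type u} {H : X → Type v} {H' : X → Type w}
  [∀ x, NormedAddCommGroup (H x)] [∀ x, InnerProductSpace ℂ (H x)] [∀ x, CompleteSpace (H x)]
  [∀ x, NormedAddCommGroup (H' x)] [∀ x, InnerProductSpace ℂ (H' x)] [∀ x, CompleteSpace (H' x)]

variable {M : Submodule ℂ (OperatorFields H H' : Type (max u v w))}

/-- `S ∘ B` is compact if `S` is compact and `B` is adjointable. -/
lemma compactOps_comp {S B B' : Ops M} (hS : S ∈ compactOps M) (hB : AreAdjoint B B') :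
    S.comp B ∈ compactOps M := by
  let L : Ops M →L[ℂ] Ops M := (ContinuousLinearMap.compL ℂ M M M).flip B
  have h1 : S ∈ closure (Submodule.span ℂ {S : Ops M | IsRankOne S} : Set (Ops M)) := hS
  have h2 : L S ∈ closure (Submodule.span ℂ {S : Ops M | IsRankOne S} : Set (Ops M)) := by
    refine map_mem_closure L.continuous h1 fun R hR => ?_
    have h3 : Submodule.span ℂ {S : Ops M | IsRankOne S} ≤
        (Submodule.span ℂ {S : Ops M | IsRankOne S}).comap L.toLinearMap := by
      refine Submodule.span_le.2 ?_
      rintro R ⟨a, b, h⟩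
      -- `a ⟨b, B w⟩ = a ⟨B' b, w⟩`, so composition with `B` preserves rank one.
      refine Submodule.subset_span ⟨a, B' b, fun w x => ?_⟩
      have h4 : innerProd (B' b) w x = innerProd b (B w) x :=
        congrFun (hB.symm b w) x
      rw [h4]
      exact h (B w) x
    exact h3 hR
  exact h2

/-- The graph of a self-adjoint regular operator. -/
structure IsSelfAdjointRegular (T : Submodule ℂ (M × M)) : Prop where
  isClosed : IsClosed (T : Set (M × M))
  symm : ∀ u v u' v' : M, (u, v) ∈ T → (u', v') ∈ T → ∀ (x : X) (φ : H x),
    inner ℂ (ev x φ v) (ev x φ u') = inner ℂ (ev x φ u) (ev x φ v')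
  dense : Dense {u : M | ∃ v, (u, v) ∈ T}
  surj : ∀ ζ : ℂ, starRingEnd ℂ ζ = -ζ → ‖ζ‖ = 1 → ∀ f : M, ∃ u v, (u, v) ∈ T ∧ v + ζ • u = f

/-- A symmetric densely defined relation is the graph of an operator. -/
lemma isOperatorGraph_of_symm {T : Submodule ℂ (M × M)}
    (symm : ∀ u v u' v' : M, (u, v) ∈ T → (u', v') ∈ T → ∀ (x : X) (φ : H x),
      inner ℂ (ev x φ v) (ev x φ u') = inner ℂ (ev x φ u) (ev x φ v'))
    (dense : Dense {u : M | ∃ v, (u, v) ∈ T}) : IsOperatorGraph T := by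
  intro v hv
  refine ext_ev fun x φ => ?_
  have h1 : ∀ w : M, inner ℂ (ev x φ v) (ev x φ w) = 0 := by
    intro w
    refine dense.induction (P := fun w => inner ℂ (ev x φ v) (ev x φ w) = 0) ?_
      (isClosed_eq (continuous_const.inner (ev x φ).continuous) continuous_const) w
    rintro u ⟨v', h⟩
    rw [symm 0 v u v' hv h, map_zero, inner_zero_left]
  rw [map_zero]
  exact inner_self_eq_zero.1 (h1 v)

/-- `|T u + ζ u|² = |T u|² + |u|²` for a symmetric operator `T` and `ζ = ± i`. -/
lemma norm_ev_add_smul_sq {T : Submodule ℂ (M × M)}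
    (symm : ∀ u v u' v' : M, (u, v) ∈ T → (u', v') ∈ T → ∀ (x : X) (φ : H x),
      inner ℂ (ev x φ v) (ev x φ u') = inner ℂ (ev x φ u) (ev x φ v'))
    {ζ : ℂ} (hζ : starRingEnd ℂ ζ = -ζ) (hζ1 : ‖ζ‖ = 1) {u v : M} (h : (u, v) ∈ T)
    (x : X) (φ : H x) :
    ‖ev x φ (v + ζ • u)‖ ^ 2 = ‖ev x φ v‖ ^ 2 + ‖ev x φ u‖ ^ 2 := by
  have h1 := symm u v u v h h x φ
  rw [map_add, @norm_add_sq ℂ, map_smul, norm_smul, hζ1, one_mul]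
  have h2 : RCLike.re (inner ℂ (ev x φ v) (ζ • ev x φ u)) = 0 := by
    rw [inner_smul_right]
    have h3 : starRingEnd ℂ (ζ * inner ℂ (ev x φ v) (ev x φ u)) =
        -(ζ * inner ℂ (ev x φ v) (ev x φ u)) := by
      rw [map_mul, hζ, inner_conj_symm, ← h1]
      ring
    have h4 := congrArg Complex.re h3
    rw [Complex.conj_re, Complex.neg_re] at h4
    show (ζ * inner ℂ (ev x φ v) (ev x φ u)).re = 0
    linarith
  rw [h2]
  ring

namespace IsSelfAdjointRegular

variable {T : Submodule ℂ (M × M)}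

lemma eq_of_mem (hT : IsSelfAdjointRegular T) {u v v' : M} (h : (u, v) ∈ T) (h' : (u, v') ∈ T) :
    v = v' := by
  refine sub_eq_zero.1 (isOperatorGraph_of_symm hT.symm hT.dense _ ?_)
  simpa using T.sub_mem h h'

/-- `|u| ≤ |T u + ζ u|` makes `T + ζ` injective, so the chosen preimages depend linearly on the
right side, and it makes the inverse a contraction in every fibre. -/
lemma exists_resolvent (hT : IsSelfAdjointRegular T) {ζ : ℂ} (hζ : starRingEnd ℂ ζ = -ζ)
    (hζ1 : ‖ζ‖ = 1) : ∃ a : Ops M, (∀ f, (a f, f - ζ • a f) ∈ T) ∧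
      (∀ u v, (u, v) ∈ T → a (v + ζ • u) = u) ∧
      ∀ f x (φ : H x), ‖ev x φ (a f)‖ ≤ ‖ev x φ f‖ := by
  have hn : ∀ {u v : M}, (u, v) ∈ T → ∀ x (φ : H x), ‖ev x φ u‖ ≤ ‖ev x φ (v + ζ • u)‖ := by
    intro u v h x φ
    have h1 := norm_ev_add_smul_sq hT.symm hζ hζ1 h x φ
    refine (pow_le_pow_iff_left₀ (norm_nonneg _) (norm_nonneg _) two_ne_zero).1 ?_
    rw [h1]
    linarith [sq_nonneg ‖ev x φ v‖]
  have huniq : ∀ {u v u' v' : M}, (u, v) ∈ T → (u', v') ∈ T → v + ζ • u = v' + ζ • u' →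
      u = u' := by
    intro u v u' v' h h' e
    refine sub_eq_zero.1 (ext_ev fun x φ => ?_)
    have h1 : ‖ev x φ (u - u')‖ ≤ ‖ev x φ ((v - v') + ζ • (u - u'))‖ :=
      hn (T.sub_mem h h') x φ
    have h2 : (v - v') + ζ • (u - u') = 0 := by
      rw [smul_sub, sub_add_sub_comm, e, sub_self]
    rw [h2, map_zero, norm_zero] at h1
    rw [map_zero]
    exact norm_le_zero_iff.1 h1
  choose u v huv hf using hT.surj ζ hζ hζ1
  let L : M →ₗ[ℂ] M :=
    { toFun := u
      map_add' := fun f g => huniq (v' := v f + v g) (huv _)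
        (T.add_mem (huv f) (huv g)) (by rw [hf, smul_add, add_add_add_comm, hf, hf])
      map_smul' := fun c f => huniq (v' := c • v f) (huv _)
        (T.smul_mem c (huv f)) (by rw [hf, RingHom.id_apply, smul_comm, ← smul_add, hf]) }
  have hbd : ∀ f x (φ : H x), ‖ev x φ (u f)‖ ≤ ‖ev x φ f‖ := by
    intro f x φ
    have := hn (huv f) x φ
    rwa [hf] at this
  refine ⟨L.mkContinuous 1 fun f => norm_le_of_ev (by positivity) fun x φ =>
    ((hbd f x φ).trans (norm_ev_le x φ f)).trans_eq (by rw [one_mul]), fun f => ?_,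
    fun u' v' h => ?_, hbd⟩
  · have h1 : v f = f - ζ • u f := eq_sub_of_add_eq (hf f)
    have h2 := huv f
    rw [h1] at h2
    exact h2
  · exact huniq (huv _) h (hf _)

/-- The bounded transform of a self-adjoint regular operator `T`, such that
`u = p (T u) + r u` for compact operators `p` and `r`. -/
theorem exists_boundedTransform [CompleteSpace M] (hT : IsSelfAdjointRegular T) {p r : Ops M}
    (hp : p ∈ compactOps M) (hr : r ∈ compactOps M)
    (hpr : ∀ u v, (u, v) ∈ T → u = p v + r u) :
    ∃ σ : Ops M, IsBoundedTransform T σ ∧ (∀ σ' : Ops M, IsBoundedTransform T σ' → σ' = σ) ∧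
      IsAdjointable σ ∧ ContinuousLinearMap.id ℂ M - σ.comp σ ∈ compactOps M := by
  have hI := Complex.conj_I
  -- In the notation below, `a = (T + i)⁻¹`, `b = (T - i)⁻¹ = a*`, `A = a b = (T² + 1)⁻¹` and `β = T
  -- A = b - i A`.
  obtain ⟨a, ha, ha', hab⟩ := hT.exists_resolvent hI Complex.norm_I
  obtain ⟨b, hb, hb', hbb⟩ := hT.exists_resolvent (ζ := -Complex.I) (by simp) (by simp)
  have hb1 : ∀ f, (b f, f + Complex.I • b f) ∈ T := fun f => by
    have := hb f
    rwa [neg_smul, sub_neg_eq_add] at this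
  have hb2 : ∀ u v, (u, v) ∈ T → b (v - Complex.I • u) = u := fun u v h => by
    have := hb' u v h
    rwa [neg_smul, ← sub_eq_add_neg] at this
  have hadj : AreAdjoint a b := by
    refine areAdjoint_iff.2 fun f g x φ => ?_
    have h1 := hT.symm _ _ _ _ (ha f) (hb1 g) x φ
    simp only [map_add, map_sub, map_smul, inner_add_right, inner_sub_left, inner_smul_left,
      inner_smul_right, Complex.conj_I] at h1
    linear_combination -h1
  set A : Ops M := a.comp b with hA
  have hAadj : AreAdjoint A A := hadj.comp hadj.symm
  set β : Ops M := b - Complex.I • A with hβ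
  have hAβ : ∀ e, (A e, β e) ∈ T := fun e => ha (b e)
  have hβA : ∀ e, (β e, e - A e) ∈ T := by
    intro e
    have h1 := T.sub_mem (hb1 e) (T.smul_mem Complex.I (hAβ e))
    have h2 : (b e, e + Complex.I • b e) - Complex.I • (A e, β e) = (β e, e - A e) := by
      refine Prod.ext rfl ?_
      show e + Complex.I • b e - Complex.I • (b e - Complex.I • A e) = e - A e
      rw [smul_sub, smul_smul, Complex.I_mul_I, neg_one_smul]
      abel
    rwa [h2] at h1
  have hAinv : ∀ u v w : M, (u, v) ∈ T → (v, w) ∈ T → A (w + u) = u := by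
    intro u v w h h'
    have h1 : b (w + u) = v + Complex.I • u := by
      rw [← hb2 (v + Complex.I • u) (w + Complex.I • v) (T.add_mem h' (T.smul_mem Complex.I h))]
      congr 1
      show w + u = w + Complex.I • v - Complex.I • (v + Complex.I • u)
      rw [smul_add, smul_smul, Complex.I_mul_I, neg_one_smul]
      abel
    rw [hA, ContinuousLinearMap.comp_apply, h1, ha' u v h]
  have hinner : ∀ e (x : X) (φ : H x),
      (inner ℂ (ev x φ (A e)) (ev x φ e)).re = ‖ev x φ (b e)‖ ^ 2 := by
    intro e x φ
    rw [hA, ContinuousLinearMap.comp_apply, hadj.ev_inner, ← @inner_self_eq_norm_sq ℂ]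
    rfl
  obtain ⟨Q, hQ, hQpos, hQQ, hQcomm⟩ := exists_positive_sqrt hAadj
    (fun e x φ => by rw [hinner]; positivity)
    (fun e x φ => by
      rw [hinner]
      exact pow_le_pow_left₀ (norm_nonneg _) (hbb e x φ) 2)
  have hQQ' : ∀ e, Q (Q e) = A e := fun e => congrArg (fun B : Ops M => B e) hQQ
  -- `β² = T² A²` and `T² A = 1 - A`. In terms of the graph: `A` and `β` commute, and `T` is
  -- single-valued at `β (A e)`.
  have hββ : ∀ e, β (β e) = A e - A (A e) := by
    intro e
    have h1 : A (β e) = β (A e) := by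
      have h2 := hAinv _ _ _ (hβA (A e)) (T.sub_mem (hAβ e) (hAβ (A e)))
      rwa [sub_add_cancel] at h2
    have h2 := hAβ (β e)
    rw [h1] at h2
    exact hT.eq_of_mem h2 (hβA (A e))
  have hβcomm : Commute A β := by
    refine ContinuousLinearMap.ext fun e => ?_
    have h2 := hAinv _ _ _ (hβA (A e)) (T.sub_mem (hAβ e) (hAβ (A e)))
    rwa [sub_add_cancel] at h2
  have hQβ : ∀ e, Q (β e) = β (Q e) := fun e =>
    congrArg (fun B : Ops M => B e) (hQcomm β hβcomm).eq
  have hβadj : AreAdjoint β β := by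
    refine areAdjoint_iff.2 fun e f x φ => ?_
    have h1 := hT.symm _ _ _ _ (hAβ e) (hAβ f) x φ
    have h2 := hT.symm _ _ _ _ (hβA e) (hβA f) x φ
    simp only [map_sub, inner_sub_left, inner_sub_right] at h2
    linear_combination h1 - h2
  -- The range of a resolvent contains the domain of `T`.
  have hdense : ∀ (ζ : ℂ) (c : Ops M), (∀ u v, (u, v) ∈ T → c (v + ζ • u) = u) →
      DenseRange c := fun ζ c hc =>
    hT.dense.mono (by
      rintro u ⟨v, h⟩
      exact ⟨v + ζ • u, hc u v h⟩)
  have hAdense : DenseRange A :=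
    (hdense _ a ha').comp (hdense _ b hb') a.continuous
  have hQdense : DenseRange Q := hAdense.mono (by
    rintro _ ⟨e, rfl⟩
    exact ⟨Q e, hQQ' e⟩)
  -- From `β² = A - A²` and `Q² = A` follows `|β e|² = |Q e|² - |A e|²`. So `Q e ↦ β e` is well
  -- defined and contractive on the range of `Q`, which is dense because it contains the range of
  -- `A`.
  have hβQ : ∀ e, ‖β e‖ ≤ 1 * ‖Q e‖ := by
    intro e
    refine norm_le_of_ev (by positivity) fun x φ => ?_
    rw [one_mul]
    refine le_trans ?_ (norm_ev_le x φ (Q e))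
    refine (pow_le_pow_iff_left₀ (norm_nonneg _) (norm_nonneg _) two_ne_zero).1 ?_
    rw [← @inner_self_eq_norm_sq ℂ, ← @inner_self_eq_norm_sq ℂ, ← hβadj.ev_inner, hββ,
      ← hQ.ev_inner, hQQ', map_sub, inner_sub_left, hAadj.ev_inner (A e) e, map_sub,
      inner_self_eq_norm_sq]
    linarith [sq_nonneg ‖ev x φ (A e)‖]
  set σ : Ops M := LinearMap.extendOfNorm β.toLinearMap Q.toLinearMap with hσ
  have hσQ : ∀ e, σ (Q e) = β e := fun e =>
    LinearMap.extendOfNorm_eq (f := β.toLinearMap) (e := Q.toLinearMap) hQdense ⟨1, hβQ⟩ e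
  have hQσ : ∀ e, (Q e, σ e) ∈ T := by
    intro e
    refine hQdense.induction_on (p := fun e => (Q e, σ e) ∈ T) e
      (hT.isClosed.preimage (Q.continuous.prodMk σ.continuous)) fun f => ?_
    rw [hQQ', hσQ]
    exact hAβ f
  have hσadj : AreAdjoint σ σ := by
    refine areAdjoint_iff.2 fun e f x φ => ?_
    refine hQdense.induction_on₂ (p := fun e f =>
      inner ℂ (ev x φ (σ e)) (ev x φ f) = inner ℂ (ev x φ e) (ev x φ (σ f))) ?_ (fun e f => ?_) e f
    · exact isClosed_eq
        (((ev x φ).continuous.comp (σ.continuous.comp continuous_fst)).inner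
          ((ev x φ).continuous.comp continuous_snd))
        (((ev x φ).continuous.comp continuous_fst).inner
          ((ev x φ).continuous.comp (σ.continuous.comp continuous_snd)))
    · rw [hσQ, hσQ, ← hQ.ev_inner, hQβ, hβadj.ev_inner, hQ.ev_inner]
  -- On the dense range of `A = Q²`, `σ Q = β` and `Q β = β Q` give `σ² A f = β² f = A f - A² f`.
  have hσσ : ContinuousLinearMap.id ℂ M - σ.comp σ = A := by
    refine ContinuousLinearMap.ext fun e => ?_
    refine hAdense.induction_on (p := fun e => (ContinuousLinearMap.id ℂ M - σ.comp σ) e = A e) e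
      (isClosed_eq (ContinuousLinearMap.continuous _) A.continuous) fun f => ?_
    show A f - σ (σ (A f)) = A (A f)
    rw [← hQQ' f, hσQ, ← hQβ, hσQ, hββ, hQQ' f, sub_sub_cancel]
  -- The hypothesis on `p` and `r` is applied to `u = a f`, where `T u = f - i a f`.
  have hacompact : a ∈ compactOps M := by
    have h1 : a = p + (r - Complex.I • p).comp a := by
      refine ContinuousLinearMap.ext fun f => ?_
      have h2 := hpr _ _ (ha f)
      rw [map_sub, map_smul] at h2
      show a f = p f + (r (a f) - Complex.I • p (a f))
      nth_rewrite 1 [h2]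
      abel
    rw [h1]
    exact Submodule.add_mem _ hp (compactOps_comp (Submodule.sub_mem _ hr
      (Submodule.smul_mem _ _ hp)) hadj)
  refine ⟨σ, ⟨Q, ⟨Q, hQ⟩, hQpos, ⟨fun e => ⟨β e, ?_, ?_⟩, ?_⟩, hQσ⟩, ?_, ⟨σ, hσadj⟩, ?_⟩
  · rw [hQQ]; exact hAβ e
  · rw [hQQ]; exact hβA e
  · rw [hQQ]; exact hAinv
  -- A second root `Q'` also squares to `A`, by uniqueness of the inverse of `T² + 1`. It therefore
  -- commutes with `A`, hence with `Q`, and uniqueness of positive roots applies since `A` is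
  -- injective.
  · rintro σ' ⟨Q', -, hQ'pos, ⟨hinv, hinv'⟩, hQ'σ⟩
    have hQA' : Q'.comp Q' = A := by
      refine ContinuousLinearMap.ext fun e => ?_
      have h1 := hinv' _ _ _ (hAβ e) (hβA e)
      rwa [sub_add_cancel] at h1
    have hcomm : Commute A Q' := by
      have h1 : A = Q' * Q' := hQA'.symm
      rw [h1]
      exact (Commute.refl Q').mul_left (Commute.refl Q')
    have hQ'Q : Q' = Q := by
      refine positive_sqrt_unique (A := A) (fun e he => ?_) hQpos hQ'pos hQQ hQA' (hQcomm Q' hcomm)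
      have h0 := isOperatorGraph_of_symm hT.symm hT.dense
      have h1 := hAβ e
      rw [he] at h1
      have h2 := hβA e
      rw [h0 _ h1, he, sub_zero] at h2
      exact h0 _ h2
    refine ContinuousLinearMap.ext fun e => ?_
    have h1 := hQ'σ e
    rw [hQ'Q] at h1
    exact hT.eq_of_mem h1 (hQσ e)
  · rw [hσσ]
    exact compactOps_comp hacompact hadj.symm

end IsSelfAdjointRegular

end HilbertModule

/-! ### Operators on a core, and regularity from a parametrix -/

section HilbertModule

variable {X : Type u} {H : X → Type v} {H' : X → Type w}
  [∀ x, NormedAddCommGroup (H x)] [∀ x, InnerProductSpace ℂ (H x)] [∀ x, CompleteSpace (H x)]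
  [∀ x, NormedAddCommGroup (H' x)] [∀ x, InnerProductSpace ℂ (H' x)] [∀ x, CompleteSpace (H' x)]

variable {M : Submodule ℂ (OperatorFields H H' : Type (max u v w))}

section Core

variable {C : Type*} [AddCommGroup C] [Module ℂ C] (ρ : C →ₗ[ℂ] M)

/-- The operators `F` and `F'` on `C` are adjoint to each other for the inner products of all
fibres. -/
def AreCoreAdjoint (F Fadj : C →ₗ[ℂ] C) : Prop :=
  ∀ e f x (φ : H x), inner ℂ (ev x φ (ρ (F e))) (ev x φ (ρ f)) =
    inner ℂ (ev x φ (ρ e)) (ev x φ (ρ (Fadj f)))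

/-- The operator `F` on `C` is bounded for the norm of the module. -/
def IsCoreBounded (F : C →ₗ[ℂ] C) : Prop := ∃ c : ℝ, ∀ e, ‖ρ (F e)‖ ≤ c * ‖ρ e‖

/-- The closure of the graph of an operator on `C`. -/
def coreGraph (D : C →ₗ[ℂ] C) : Submodule ℂ (M × M) :=
  (LinearMap.range (ρ.prod (ρ ∘ₗ D))).topologicalClosure

variable {ρ}

lemma AreCoreAdjoint.comp {F F' G G' : C →ₗ[ℂ] C} (h : AreCoreAdjoint ρ F F')
    (k : AreCoreAdjoint ρ G G') : AreCoreAdjoint ρ (F ∘ₗ G) (G' ∘ₗ F') := fun e f x φ => by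
  rw [LinearMap.comp_apply, LinearMap.comp_apply, h, k]

lemma AreCoreAdjoint.add {F F' G G' : C →ₗ[ℂ] C} (h : AreCoreAdjoint ρ F F')
    (k : AreCoreAdjoint ρ G G') : AreCoreAdjoint ρ (F + G) (F' + G') := fun e f x φ => by
  simp only [LinearMap.add_apply, map_add, inner_add_left, inner_add_right]
  rw [h, k]

lemma AreCoreAdjoint.sub {F F' G G' : C →ₗ[ℂ] C} (h : AreCoreAdjoint ρ F F')
    (k : AreCoreAdjoint ρ G G') : AreCoreAdjoint ρ (F - G) (F' - G') := fun e f x φ => by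
  simp only [LinearMap.sub_apply, map_sub, inner_sub_left, inner_sub_right]
  rw [h, k]

lemma areCoreAdjoint_smul_id (c : ℂ) :
    AreCoreAdjoint ρ (c • LinearMap.id) (starRingEnd ℂ c • LinearMap.id) := fun e f x φ => by
  simp [mul_comm]

lemma areCoreAdjoint_id : AreCoreAdjoint ρ LinearMap.id LinearMap.id := fun _ _ _ _ => rfl

lemma IsCoreBounded.add {F G : C →ₗ[ℂ] C} (hF : IsCoreBounded ρ F) (hG : IsCoreBounded ρ G) :
    IsCoreBounded ρ (F + G) := by
  obtain ⟨c, hc⟩ := hF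
  obtain ⟨c', hc'⟩ := hG
  refine ⟨c + c', fun e => ?_⟩
  rw [LinearMap.add_apply, map_add, add_mul]
  exact (norm_add_le _ _).trans (add_le_add (hc e) (hc' e))

lemma IsCoreBounded.smul {F : C →ₗ[ℂ] C} (z : ℂ) (hF : IsCoreBounded ρ F) :
    IsCoreBounded ρ (z • F) := by
  obtain ⟨c, hc⟩ := hF
  refine ⟨‖z‖ * c, fun e => ?_⟩
  rw [LinearMap.smul_apply, map_smul, norm_smul, mul_assoc]
  exact mul_le_mul_of_nonneg_left (hc e) (norm_nonneg _)

lemma isCoreBounded_id : IsCoreBounded ρ LinearMap.id := ⟨1, fun e => by simp⟩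

lemma IsCoreBounded.comp {F G : C →ₗ[ℂ] C} (hF : IsCoreBounded ρ F) (hG : IsCoreBounded ρ G) :
    IsCoreBounded ρ (F ∘ₗ G) := by
  obtain ⟨c, hc⟩ := hF
  obtain ⟨c', hc'⟩ := hG
  refine ⟨|c| * c', fun e => (hc (G e)).trans ?_⟩
  calc c * ‖ρ (G e)‖ ≤ |c| * ‖ρ (G e)‖ :=
        mul_le_mul_of_nonneg_right (le_abs_self c) (norm_nonneg _)
    _ ≤ |c| * (c' * ‖ρ e‖) := mul_le_mul_of_nonneg_left (hc' e) (abs_nonneg c)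
    _ = _ := by ring

/-- `|F' f|² = ⟨F F' f, f⟩` in each fibre. Since `F` is bounded only for the norm of the module, the
supremum over the fibres is taken first, giving `‖F' f‖² ≤ |c| ‖F' f‖ ‖f‖`; then one factor is
cancelled. -/
lemma AreCoreAdjoint.isCoreBounded {F F' : C →ₗ[ℂ] C} (h : AreCoreAdjoint ρ F F')
    (hF : IsCoreBounded ρ F) : IsCoreBounded ρ F' := by
  obtain ⟨c, hc⟩ := hF
  refine ⟨|c|, fun f => ?_⟩
  have h1 : ‖ρ (F' f)‖ ≤ Real.sqrt (|c| * ‖ρ (F' f)‖ * ‖ρ f‖) := by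
    refine norm_le_of_ev (Real.sqrt_nonneg _) fun x φ => ?_
    refine (pow_le_pow_iff_left₀ (norm_nonneg _) (by positivity) two_ne_zero).1 ?_
    rw [mul_pow, Real.sq_sqrt (by positivity), ← @inner_self_eq_norm_sq ℂ, ← h]
    refine (Complex.re_le_norm _).trans ((norm_inner_le_norm _ _).trans ?_)
    calc _ ≤ (‖ρ (F (F' f))‖ * ‖φ‖) * (‖ρ f‖ * ‖φ‖) :=
          mul_le_mul (norm_ev_le _ _ _) (norm_ev_le _ _ _) (norm_nonneg _) (by positivity)
      _ ≤ ((|c| * ‖ρ (F' f)‖) * ‖φ‖) * (‖ρ f‖ * ‖φ‖) := by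
          refine mul_le_mul_of_nonneg_right (mul_le_mul_of_nonneg_right ((hc _).trans ?_)
            (norm_nonneg _)) (by positivity)
          exact mul_le_mul_of_nonneg_right (le_abs_self c) (norm_nonneg _)
      _ = _ := by ring
  rcases (norm_nonneg (ρ (F' f))).eq_or_lt with h0 | h0
  · rw [← h0]; positivity
  · have h2 := pow_le_pow_left₀ (norm_nonneg _) h1 2
    rw [Real.sq_sqrt (by positivity), sq] at h2
    refine le_of_mul_le_mul_left (h2.trans_eq ?_) h0
    ring

lemma IsCoreBounded.exists_extension [CompleteSpace M] (hρ : DenseRange ρ) {F : C →ₗ[ℂ] C}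
    (hF : IsCoreBounded ρ F) : ∃ S : Ops M, ∀ e, S (ρ e) = ρ (F e) :=
  ⟨LinearMap.extendOfNorm (ρ ∘ₗ F) ρ, LinearMap.extendOfNorm_eq hρ hF⟩

/-- Bounded operators on `C` that are adjoint to each other extend to adjointable operators. -/
lemma AreCoreAdjoint.exists_extension [CompleteSpace M] (hρ : DenseRange ρ) {F F' : C →ₗ[ℂ] C}
    (h : AreCoreAdjoint ρ F F') (hF : IsCoreBounded ρ F) :
    ∃ S S' : Ops M, (∀ e, S (ρ e) = ρ (F e)) ∧ (∀ e, S' (ρ e) = ρ (F' e)) ∧ AreAdjoint S S' := by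
  obtain ⟨S, hS⟩ := hF.exists_extension hρ
  obtain ⟨S', hS'⟩ := (h.isCoreBounded hF).exists_extension hρ
  refine ⟨S, S', hS, hS', areAdjoint_iff.2 fun a b x φ => ?_⟩
  refine hρ.induction_on₂ (p := fun a b =>
    inner ℂ (ev x φ (S a)) (ev x φ b) = inner ℂ (ev x φ a) (ev x φ (S' b))) ?_ (fun e f => ?_) a b
  · exact isClosed_eq
      (((ev x φ).continuous.comp (S.continuous.comp continuous_fst)).inner
        ((ev x φ).continuous.comp continuous_snd))
      (((ev x φ).continuous.comp continuous_fst).inner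
        ((ev x φ).continuous.comp (S'.continuous.comp continuous_snd)))
  · rw [hS, hS']
    exact h e f x φ

lemma mem_coreGraph (D : C →ₗ[ℂ] C) (e : C) : (ρ e, ρ (D e)) ∈ coreGraph ρ D :=
  Submodule.le_topologicalClosure _ ⟨e, rfl⟩

lemma coreGraph_induction {D : C →ₗ[ℂ] C} {P : M → M → Prop}
    (hP : IsClosed {q : M × M | P q.1 q.2}) (h : ∀ e, P (ρ e) (ρ (D e))) {u v : M}
    (huv : (u, v) ∈ coreGraph ρ D) : P u v := by
  have h1 : closure (LinearMap.range (ρ.prod (ρ ∘ₗ D)) : Set (M × M)) ⊆ {q | P q.1 q.2} :=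
    closure_minimal (by rintro _ ⟨e, rfl⟩; exact h e) hP
  exact h1 huv

/-- The closure of a symmetric operator is symmetric. -/
lemma coreGraph_symm {D : C →ₗ[ℂ] C} (hD : AreCoreAdjoint ρ D D) (u v u' v' : M)
    (h : (u, v) ∈ coreGraph ρ D) (h' : (u', v') ∈ coreGraph ρ D) (x : X) (φ : H x) :
    inner ℂ (ev x φ v) (ev x φ u') = inner ℂ (ev x φ u) (ev x φ v') := by
  refine coreGraph_induction (P := fun u v =>
    inner ℂ (ev x φ v) (ev x φ u') = inner ℂ (ev x φ u) (ev x φ v')) (isClosed_eq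
      (((ev x φ).continuous.comp continuous_snd).inner continuous_const)
      (((ev x φ).continuous.comp continuous_fst).inner continuous_const)) (fun e => ?_) h
  refine coreGraph_induction (P := fun u' v' =>
    inner ℂ (ev x φ (ρ (D e))) (ev x φ u') = inner ℂ (ev x φ (ρ e)) (ev x φ v')) (isClosed_eq
      (continuous_const.inner ((ev x φ).continuous.comp continuous_fst))
      (continuous_const.inner ((ev x φ).continuous.comp continuous_snd))) (fun f => ?_) h'
  exact hD e f x φ

lemma dense_dom_coreGraph (hρ : DenseRange ρ) (D : C →ₗ[ℂ] C) :
    Dense {u : M | ∃ v, (u, v) ∈ coreGraph ρ D} :=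
  hρ.mono (by rintro _ ⟨e, rfl⟩; exact ⟨_, mem_coreGraph D e⟩)

/-- The closure `T` of a symmetric operator on `C` is self-adjoint and regular if the ranges of
`T ± i` contain `C`. -/
lemma isSelfAdjointRegular_coreGraph [CompleteSpace M] (hρ : DenseRange ρ) {D : C →ₗ[ℂ] C}
    (hD : AreCoreAdjoint ρ D D)
    (h : ∀ ζ : ℂ, starRingEnd ℂ ζ = -ζ → ‖ζ‖ = 1 → ∀ e, ∃ u v, (u, v) ∈ coreGraph ρ D ∧
      v + ζ • u = ρ e) : IsSelfAdjointRegular (coreGraph ρ D) where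
  isClosed := Submodule.isClosed_topologicalClosure _
  symm := coreGraph_symm hD
  dense := dense_dom_coreGraph hρ D
  surj := by
    intro ζ hζ hζ1 f
    obtain ⟨e, he⟩ := mem_closure_iff_seq_limit.1 (hρ f)
    have he1 : ∀ k, ∃ u v, (u, v) ∈ coreGraph ρ D ∧ v + ζ • u = e k := fun k => by
      obtain ⟨c, hc⟩ := he.1 k
      rw [← hc]
      exact h ζ hζ hζ1 c
    choose u v huv hf using he1
    -- `|u| ≤ |T u + ζ u|` makes the solutions for a convergent sequence of right sides Cauchy;
    -- closedness of the graph passes to the limit.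
    have hle : ∀ j k, ‖u j - u k‖ ≤ ‖e j - e k‖ := by
      intro j k
      refine norm_le_of_ev (norm_nonneg _) fun x φ => le_trans ?_ (norm_ev_le x φ _)
      have h2 : (u j - u k, v j - v k) ∈ coreGraph ρ D :=
        (coreGraph ρ D).sub_mem (huv j) (huv k)
      have h1 := norm_ev_add_smul_sq (coreGraph_symm hD) hζ hζ1 h2 x φ
      have h3 : (v j - v k) + ζ • (u j - u k) = e j - e k := by
        rw [← hf, ← hf, smul_sub]; abel
      rw [h3] at h1
      refine (pow_le_pow_iff_left₀ (norm_nonneg _) (norm_nonneg _) two_ne_zero).1 ?_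
      rw [h1]
      linarith [sq_nonneg ‖ev x φ (v j - v k)‖]
    have hcau : CauchySeq u := by
      refine Metric.cauchySeq_iff.2 fun ε hε => ?_
      obtain ⟨N, hN⟩ := Metric.cauchySeq_iff.1 he.2.cauchySeq ε hε
      refine ⟨N, fun j hj k hk => lt_of_le_of_lt ?_ (hN j hj k hk)⟩
      rw [dist_eq_norm, dist_eq_norm]
      exact hle j k
    obtain ⟨u₀, hu₀⟩ := cauchySeq_tendsto_of_complete hcau
    refine ⟨u₀, f - ζ • u₀, ?_, sub_add_cancel _ _⟩
    have h4 : Filter.Tendsto (fun k => (u k, v k)) Filter.atTop (𝓝 (u₀, f - ζ • u₀)) := by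
      refine hu₀.prodMk_nhds ?_
      refine (he.2.sub (hu₀.const_smul ζ)).congr fun k => ?_
      rw [← hf, add_sub_cancel_right]
    exact (Submodule.isClosed_topologicalClosure _).mem_of_tendsto h4
      (Filter.Eventually.of_forall huv)

/-- If the symmetric operator `D` has a parametrix `P`, whose remainder is bounded as an operator
to the domain of `D` locally over `X`, then the ranges of `D ± i` contain `C`. -/
lemma exists_add_smul_eq_of_parametrix [CompleteSpace M] (hρ : DenseRange ρ)
    {D P P' : C →ₗ[ℂ] C} (hD : AreCoreAdjoint ρ D D) (hP : AreCoreAdjoint ρ P P')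
    (bP : IsCoreBounded ρ P) (bR : IsCoreBounded ρ (LinearMap.id - P ∘ₗ D))
    (bS : IsCoreBounded ρ (LinearMap.id - D ∘ₗ P)) {e : C} {m : C →ₗ[ℂ] C} {χ : X → ℝ}
    (hm : ∀ f x (φ : H x), ev x φ (ρ (m f)) = (χ x : ℂ) • ev x φ (ρ f))
    (hχ : ∀ x, 0 ≤ χ x ∧ χ x ≤ 1)
    (he : ∀ x, χ x ≠ 1 → ∀ φ : H x, ev x φ (ρ e) = 0)
    (mD : ∀ f, D (m f) = m (D f)) (mP' : ∀ f, P' (m f) = m (P' f))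
    (bDR : IsCoreBounded ρ (m ∘ₗ D ∘ₗ (LinearMap.id - P ∘ₗ D)))
    {ζ : ℂ} (hζ : starRingEnd ℂ ζ = -ζ) (hζ1 : ‖ζ‖ = 1) :
    ∃ u v, (u, v) ∈ coreGraph ρ D ∧ v + ζ • u = ρ e := by
  have hmadj : AreCoreAdjoint ρ m m := by
    intro f g x φ
    rw [hm, hm, inner_smul_left, inner_smul_right, Complex.conj_ofReal]
  have bm : IsCoreBounded ρ m := by
    refine ⟨1, fun f => norm_le_of_ev (by positivity) fun x φ => ?_⟩
    rw [hm, norm_smul, Complex.norm_real, Real.norm_of_nonneg (hχ x).1, one_mul]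
    calc χ x * ‖ev x φ (ρ f)‖ ≤ 1 * ‖ev x φ (ρ f)‖ :=
          mul_le_mul_of_nonneg_right (hχ x).2 (norm_nonneg _)
      _ ≤ _ := by rw [one_mul]; exact norm_ev_le x φ _
  have hDζ : AreCoreAdjoint ρ (D + ζ • LinearMap.id) (D - ζ • LinearMap.id) := by
    have := hD.add (areCoreAdjoint_smul_id (ρ := ρ) ζ)
    rwa [hζ, neg_smul, ← sub_eq_add_neg] at this
  set R : C →ₗ[ℂ] C := LinearMap.id - P ∘ₗ D with hR
  set R' : C →ₗ[ℂ] C := LinearMap.id - D ∘ₗ P' with hR'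
  have hRadj : AreCoreAdjoint ρ R R' := areCoreAdjoint_id.sub (hP.comp hD)
  -- `(D + ζ) P = 1 - S + ζ P`, where `S = 1 - D P`.
  have bV₁ : IsCoreBounded ρ ((D + ζ • LinearMap.id) ∘ₗ P) := by
    obtain ⟨c, hc⟩ := (isCoreBounded_id.add (bS.smul (-1))).add (bP.smul ζ)
    refine ⟨c, fun f => ?_⟩
    have := hc f
    have h1 : ((LinearMap.id + (-1 : ℂ) • (LinearMap.id - D ∘ₗ P)) + ζ • P : C →ₗ[ℂ] C) f =
        ((D + ζ • LinearMap.id) ∘ₗ P) f := by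
      simp
    rwa [h1] at this
  have bV₂ : IsCoreBounded ρ (m ∘ₗ (D + ζ • LinearMap.id) ∘ₗ R) := by
    obtain ⟨c, hc⟩ := bDR.add ((bm.comp bR).smul ζ)
    refine ⟨c, fun f => ?_⟩
    have := hc f
    have h1 : (m ∘ₗ D ∘ₗ R + ζ • m ∘ₗ R) f = (m ∘ₗ (D + ζ • LinearMap.id) ∘ₗ R) f := by
      simp
    rwa [h1] at this
  obtain ⟨V₁, V₁', hV₁, hV₁', hV₁adj⟩ := (hDζ.comp hP).exists_extension hρ bV₁
  obtain ⟨V₂, V₂', hV₂, hV₂', hV₂adj⟩ := (hmadj.comp (hDζ.comp hRadj)).exists_extension hρ bV₂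
  obtain ⟨N, N', hN, hN', hNadj'⟩ := hmadj.exists_extension hρ bm
  obtain ⟨p, hp⟩ := bP.exists_extension hρ
  obtain ⟨r, hr⟩ := bR.exists_extension hρ
  have hNev : ∀ a x (φ : H x), ev x φ (N a) = (χ x : ℂ) • ev x φ a := by
    intro a x φ
    refine hρ.induction_on (p := fun a => ev x φ (N a) = (χ x : ℂ) • ev x φ a) a
      (isClosed_eq ((ev x φ).continuous.comp N.continuous) ((ev x φ).continuous.const_smul _))
      fun f => ?_
    rw [hN, hm]
  have hNadj : AreAdjoint N N := areAdjoint_iff.2 fun a b x φ => by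
    rw [hNev, hNev, inner_smul_left, inner_smul_right, Complex.conj_ofReal]
  -- The last term compensates for the factor `χ` in `V₂'`, so that `B` is bounded below also where
  -- `χ < 1`. It drops out at the solution of `B g = ρ e`.
  set B : Ops M := V₁.comp V₁' + V₂.comp V₂' +
    ((1 / 8 : ℝ) : ℂ) • (ContinuousLinearMap.id ℂ M - N.comp N) with hB
  have hBadj : AreAdjoint B B := by
    have h1 := (areAdjoint_id.sub (hNadj.comp hNadj)).smul ((1 / 8 : ℝ) : ℂ)
    rw [Complex.conj_ofReal] at h1
    exact ((hV₁adj.comp hV₁adj.symm).add (hV₂adj.comp hV₂adj.symm)).add h1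
  have hBinner : ∀ a x (φ : H x), (inner ℂ (ev x φ (B a)) (ev x φ a)).re =
      ‖ev x φ (V₁' a)‖ ^ 2 + ‖ev x φ (V₂' a)‖ ^ 2 + (1 / 8) * (1 - χ x ^ 2) * ‖ev x φ a‖ ^ 2 := by
    intro a x φ
    have h1 : ev x φ (B a) = ev x φ (V₁ (V₁' a)) + ev x φ (V₂ (V₂' a)) +
        ((1 / 8 * (1 - χ x ^ 2) : ℝ) : ℂ) • ev x φ a := by
      have h2 : B a = V₁ (V₁' a) + V₂ (V₂' a) + ((1 / 8 : ℝ) : ℂ) • (a - N (N a)) := rfl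
      rw [h2, map_add, map_add, map_smul, map_sub, hNev, hNev, smul_smul]
      congr 1
      rw [smul_sub, smul_smul, ← sub_smul]
      congr 1
      push_cast
      ring
    rw [h1, inner_add_left, inner_add_left, hV₁adj.ev_inner, hV₂adj.ev_inner, inner_smul_left,
      Complex.conj_ofReal, Complex.add_re, Complex.add_re, Complex.re_ofReal_mul]
    congr 1
    · congr 1
      · rw [← @inner_self_eq_norm_sq ℂ]; rfl
      · rw [← @inner_self_eq_norm_sq ℂ]; rfl
    · rw [← @inner_self_eq_norm_sq ℂ (E := H' x)]; rfl
  have hlow : ∀ a x (φ : H x), 1 / 8 * ‖ev x φ a‖ ^ 2 ≤ (inner ℂ (ev x φ (B a)) (ev x φ a)).re := by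
    intro a x φ
    refine hρ.induction_on (p := fun a => 1 / 8 * ‖ev x φ a‖ ^ 2 ≤
      (inner ℂ (ev x φ (B a)) (ev x φ a)).re) a (isClosed_le
        (continuous_const.mul ((ev x φ).continuous.norm.pow 2)) (Complex.continuous_re.comp
          (((ev x φ).continuous.comp B.continuous).inner (ev x φ).continuous))) fun y => ?_
    rw [hBinner]
    set z : C := (D - ζ • LinearMap.id : C →ₗ[ℂ] C) y with hz
    have h1 : V₁' (ρ y) = ρ (P' z) := hV₁' y
    have h2 : ev x φ (V₂' (ρ y)) = (χ x : ℂ) • ev x φ (ρ (R' z)) := by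
      have h3 : R' ((D - ζ • LinearMap.id : C →ₗ[ℂ] C) (m y)) = m (R' z) := by
        have h4 : (D - ζ • LinearMap.id : C →ₗ[ℂ] C) (m y) = m z := by
          simp [hz, mD]
        rw [h4]
        simp [hR', mP', mD]
      have h5 := hV₂' y
      rw [h5, ← hm, ← h3]
      rfl
    -- `(D - ζ)(y - P' z) = R' z + ζ P' z`, and `D - ζ` does not decrease the seminorm, so `|y - P'
    -- z| ≤ |R' z| + |P' z|`.
    have h3 : ‖ev x φ (ρ y)‖ ≤ 2 * ‖ev x φ (ρ (P' z))‖ + ‖ev x φ (ρ (R' z))‖ := by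
      have h4 := norm_ev_add_smul_sq (coreGraph_symm hD) (ζ := -ζ) (by rw [map_neg, hζ])
        (by rwa [norm_neg]) (mem_coreGraph D (y - P' z)) x φ
      have h5 : ρ (D (y - P' z)) + -ζ • ρ (y - P' z) = ρ (R' z) + ζ • ρ (P' z) := by
        rw [← map_smul, ← map_smul, ← map_add, ← map_add]
        congr 1
        have h6 : D y = z + ζ • y := by simp [hz]
        simp only [hR', map_sub, h6, LinearMap.sub_apply, LinearMap.id_apply,
          LinearMap.comp_apply, smul_sub, neg_smul]
        abel
      rw [h5] at h4
      have h6 : ‖ev x φ (ρ (y - P' z))‖ ≤ ‖ev x φ (ρ (R' z) + ζ • ρ (P' z))‖ := by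
        refine (pow_le_pow_iff_left₀ (norm_nonneg _) (norm_nonneg _) two_ne_zero).1 ?_
        rw [h4]
        linarith [sq_nonneg ‖ev x φ (ρ (D (y - P' z)))‖]
      have h7 : ‖ev x φ (ρ (R' z) + ζ • ρ (P' z))‖ ≤
          ‖ev x φ (ρ (R' z))‖ + ‖ev x φ (ρ (P' z))‖ := by
        rw [map_add, map_smul]
        refine (norm_add_le _ _).trans_eq ?_
        rw [norm_smul, hζ1, one_mul]
      have h8 : ‖ev x φ (ρ y)‖ ≤ ‖ev x φ (ρ (y - P' z))‖ + ‖ev x φ (ρ (P' z))‖ := by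
        rw [map_sub, map_sub]
        exact norm_le_norm_sub_add _ _
      linarith
    -- `(2 s + t)² ≤ 8 s² + 2 t²`; this is the origin of the constant `1 / 8`.
    have h4 : ‖ev x φ (ρ y)‖ ^ 2 ≤
        8 * ‖ev x φ (ρ (P' z))‖ ^ 2 + 8 * ‖ev x φ (ρ (R' z))‖ ^ 2 := by
      have h5 := pow_le_pow_left₀ (norm_nonneg _) h3 2
      nlinarith [sq_nonneg (2 * ‖ev x φ (ρ (P' z))‖ - ‖ev x φ (ρ (R' z))‖),
        sq_nonneg ‖ev x φ (ρ (R' z))‖]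
    rw [h1, h2, norm_smul, Complex.norm_real, Real.norm_of_nonneg (hχ x).1, mul_pow]
    have h5 : χ x ^ 2 ≤ 1 := pow_le_one₀ (hχ x).1 (hχ x).2
    have h6 := mul_le_mul_of_nonneg_left h4 (sq_nonneg (χ x))
    have h7 := mul_le_mul_of_nonneg_right h5 (sq_nonneg ‖ev x φ (ρ (P' z))‖)
    linarith
  obtain ⟨g, hg⟩ := surjective_of_bounded_below hBadj (by norm_num : (0 : ℝ) < 1 / 8) hlow (ρ e)
  -- Where `χ = 1`, `N` acts as the identity. Elsewhere `e` vanishes, so the form of `B` at `g` is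
  -- `⟨ρ e, g⟩ = 0`, and the lower bound forces `g` to vanish.
  have hNg : g - N (N g) = 0 := by
    refine ext_ev fun x φ => ?_
    rw [map_sub, hNev, hNev, smul_smul, map_zero]
    by_cases hx : χ x = 1
    · rw [hx, Complex.ofReal_one, one_mul, one_smul, sub_self]
    · have h1 := hlow g x φ
      rw [hg, he x hx φ, inner_zero_left, Complex.zero_re] at h1
      have h2 : ‖ev x φ g‖ ^ 2 = 0 := le_antisymm (by linarith) (sq_nonneg _)
      rw [norm_eq_zero.1 (pow_eq_zero_iff two_ne_zero |>.1 h2), smul_zero, sub_zero]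
  have hsum : V₁ (V₁' g) + V₂ (V₂' g) = ρ e := by
    rw [← hg]
    show _ = V₁ (V₁' g) + V₂ (V₂' g) + ((1 / 8 : ℝ) : ℂ) • (g - N (N g))
    rw [hNg, smul_zero, add_zero]
  -- `(T + ζ) p = V₁` and `(T + ζ) N r = V₂` hold on the core by construction, as `m` commutes with
  -- `D`, and extend since the graph is closed.
  have hT₁ : ∀ a, (p a, V₁ a - ζ • p a) ∈ coreGraph ρ D := by
    intro a
    refine hρ.induction_on (p := fun a => (p a, V₁ a - ζ • p a) ∈ coreGraph ρ D) a
      ((Submodule.isClosed_topologicalClosure _).preimage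
        (p.continuous.prodMk (V₁.continuous.sub (p.continuous.const_smul ζ)))) fun f => ?_
    rw [hp, hV₁]
    convert mem_coreGraph (ρ := ρ) D (P f) using 2
    simp
  have hT₂ : ∀ a, (N (r a), V₂ a - ζ • N (r a)) ∈ coreGraph ρ D := by
    intro a
    refine hρ.induction_on (p := fun a => (N (r a), V₂ a - ζ • N (r a)) ∈ coreGraph ρ D) a
      ((Submodule.isClosed_topologicalClosure _).preimage
        ((N.continuous.comp r.continuous).prodMk
          (V₂.continuous.sub ((N.continuous.comp r.continuous).const_smul ζ)))) fun f => ?_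
    rw [hr, hN, hV₂]
    convert mem_coreGraph (ρ := ρ) D (m (R f)) using 2
    rw [mD]
    simp
  refine ⟨_, _, (coreGraph ρ D).add_mem (hT₁ (V₁' g)) (hT₂ (V₂' g)), ?_⟩
  show V₁ (V₁' g) - ζ • p (V₁' g) + (V₂ (V₂' g) - ζ • N (r (V₂' g))) +
    ζ • (p (V₁' g) + N (r (V₂' g))) = ρ e
  rw [← hsum, smul_add]
  abel

end Core

end HilbertModule

/-! ### Schur's test with weights -/

section Schur

variable {α : Type*} [MeasurableSpace α] {ν : Measure α}

lemma eLpNorm_two_sq {F : Type*} [NormedAddCommGroup F] (f : α → F) :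
    eLpNorm f 2 ν ^ 2 = ∫⁻ x, ‖f x‖ₑ ^ 2 ∂ν := by
  rw [eLpNorm_eq_lintegral_rpow_enorm_toReal two_ne_zero ENNReal.ofNat_ne_top]
  rw [← ENNReal.rpow_natCast, ← ENNReal.rpow_mul]
  simp

lemma lintegral_mul_sq_le (f g : α → ℝ≥0∞) (hf : AEMeasurable f ν) (hg : AEMeasurable g ν) :
    (∫⁻ x, f x * g x ∂ν) ^ 2 ≤ (∫⁻ x, f x ^ 2 ∂ν) * ∫⁻ x, g x ^ 2 ∂ν := by
  have h := ENNReal.lintegral_mul_le_Lp_mul_Lq ν Real.HolderConjugate.two_two hf hg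
  have h2 := pow_le_pow_left₀ (zero_le) h 2
  refine h2.trans_eq ?_
  rw [mul_pow, ← ENNReal.rpow_natCast, ← ENNReal.rpow_natCast, ← ENNReal.rpow_mul,
    ← ENNReal.rpow_mul]
  simp

/-- Schur's test, with weights. -/
lemma lintegral_schur [SFinite ν] {K : α → α → ℝ≥0∞} (hK : Measurable (Function.uncurry K))
    {N : ℝ≥0∞} {p q : α → NNReal} (hp : Measurable p) (hp0 : ∀ x, p x ≠ 0)
    (h₁ : ∀ y, ∫⁻ x, K y x * p x ∂ν ≤ N * q y) (h₂ : ∀ x, ∫⁻ y, K y x * q y ∂ν ≤ N * p x)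
    (hq : Measurable q) {f : α → ℝ≥0∞} (hf : Measurable f) :
    ∫⁻ y, (∫⁻ x, K y x * f x ∂ν) ^ 2 ∂ν ≤ N ^ 2 * ∫⁻ x, f x ^ 2 ∂ν := by
  have hKy : ∀ y, Measurable (K y) := fun y => hK.comp measurable_prodMk_left
  have hp' : Measurable fun x => (p x : ℝ≥0∞) := hp.coe_nnreal_ennreal
  have hq' : Measurable fun x => (q x : ℝ≥0∞) := hq.coe_nnreal_ennreal
  have hpt : ∀ x, (p x : ℝ≥0∞) ≠ ⊤ := fun x => ENNReal.coe_ne_top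
  have hpz : ∀ x, (p x : ℝ≥0∞) ≠ 0 := fun x => by simpa using hp0 x
  -- Cauchy–Schwarz for the factorization `K f = (K p)^(1/2) · (K p⁻¹)^(1/2) f`; `h₁` bounds the
  -- first factor. Integration over `y`, Tonelli and `h₂` then remove the weights.
  have hstep : ∀ y, (∫⁻ x, K y x * f x ∂ν) ^ 2 ≤
      N * q y * ∫⁻ x, K y x * ((p x : ℝ≥0∞)⁻¹ * f x ^ 2) ∂ν := by
    intro y
    have h := lintegral_mul_sq_le (ν := ν) (fun x => (K y x * p x) ^ (1 / 2 : ℝ))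
      (fun x => (K y x * (p x : ℝ≥0∞)⁻¹) ^ (1 / 2 : ℝ) * f x)
      (((hKy y).mul hp').pow_const _).aemeasurable
      ((((hKy y).mul hp'.inv).pow_const _).mul hf).aemeasurable
    have e1 : ∀ x, (K y x * p x) ^ (1 / 2 : ℝ) *
        ((K y x * (p x : ℝ≥0∞)⁻¹) ^ (1 / 2 : ℝ) * f x) = K y x * f x := by
      intro x
      rw [← mul_assoc, ← ENNReal.mul_rpow_of_nonneg _ _ (by norm_num)]
      congr 1
      rw [mul_mul_mul_comm, ENNReal.mul_inv_cancel (hpz x) (hpt x), mul_one, ← sq,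
        ← ENNReal.rpow_natCast, ← ENNReal.rpow_mul]
      simp
    have e2 : ∀ a : ℝ≥0∞, (a ^ (1 / 2 : ℝ)) ^ 2 = a := by
      intro a
      rw [← ENNReal.rpow_natCast, ← ENNReal.rpow_mul]
      simp
    simp only [e1, mul_pow, e2] at h
    refine h.trans ?_
    simp only [mul_assoc]
    rw [← mul_assoc N]
    exact mul_le_mul_left (h₁ y) _
  refine (lintegral_mono hstep).trans ?_
  have hmeas : Measurable (Function.uncurry fun y x => (q y : ℝ≥0∞) *
      (K y x * ((p x : ℝ≥0∞)⁻¹ * f x ^ 2))) :=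
    (hq'.comp measurable_fst).mul (hK.mul (((hp'.inv).mul (hf.pow_const 2)).comp measurable_snd))
  calc ∫⁻ y, N * q y * ∫⁻ x, K y x * ((p x : ℝ≥0∞)⁻¹ * f x ^ 2) ∂ν ∂ν
      = N * ∫⁻ y, ∫⁻ x, q y * (K y x * ((p x : ℝ≥0∞)⁻¹ * f x ^ 2)) ∂ν ∂ν := by
        rw [← lintegral_const_mul _ hmeas.lintegral_prod_right]
        refine lintegral_congr fun y => ?_
        have hm : Measurable fun x => K y x * ((p x : ℝ≥0∞)⁻¹ * f x ^ 2) :=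
          (hKy y).mul ((hp'.inv).mul (hf.pow_const 2))
        rw [lintegral_const_mul _ hm, mul_assoc]
    _ = N * ∫⁻ x, ∫⁻ y, q y * (K y x * ((p x : ℝ≥0∞)⁻¹ * f x ^ 2)) ∂ν ∂ν := by
        rw [lintegral_lintegral_swap hmeas.aemeasurable]
    _ = N * ∫⁻ x, (∫⁻ y, K y x * q y ∂ν) * ((p x : ℝ≥0∞)⁻¹ * f x ^ 2) ∂ν := by
        congr 1
        refine lintegral_congr fun x => ?_
        have hm : Measurable fun y => K y x * q y := (hK.comp measurable_prodMk_right).mul hq'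
        rw [← lintegral_mul_const _ hm]
        refine lintegral_congr fun y => ?_
        ring
    _ ≤ N * ∫⁻ x, N * f x ^ 2 ∂ν := by
        refine mul_le_mul_right (lintegral_mono fun x => ?_) _
        refine (mul_le_mul_left (h₂ x) _).trans_eq ?_
        rw [mul_assoc, ← mul_assoc (p x : ℝ≥0∞), ENNReal.mul_inv_cancel (hpz x) (hpt x), one_mul]
    _ = N ^ 2 * ∫⁻ x, f x ^ 2 ∂ν := by
        rw [lintegral_const_mul _ (hf.pow_const 2), ← mul_assoc, sq]

variable {F F' : Type*} [NormedAddCommGroup F] [InnerProductSpace ℂ F]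
  [NormedAddCommGroup F'] [InnerProductSpace ℂ F'] [CompleteSpace F']

variable (ν) in
/-- An operator valued kernel that satisfies the conditions of Schur's test, with weights `p` and
`q` and the constant `N`. -/
structure IsSchurKernel (k : α → α → F →L[ℂ] F') (N : NNReal) (p q : α → NNReal) : Prop where
  stronglyMeasurable : StronglyMeasurable (Function.uncurry k)
  measurable_left : Measurable p
  measurable_right : Measurable q
  ne_zero : ∀ x, p x ≠ 0
  le_left : ∀ y, ∫⁻ x, ‖k y x‖ₑ * p x ∂ν ≤ N * q y
  le_right : ∀ x, ∫⁻ y, ‖k y x‖ₑ * q y ∂ν ≤ N * p x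

namespace IsSchurKernel

variable [SFinite ν] {k : α → α → F →L[ℂ] F'} {N : NNReal} {p q : α → NNReal}

lemma lintegral_le (h : IsSchurKernel ν k N p q) {f : α → ℝ≥0∞} (hf : Measurable f) :
    ∫⁻ y, (∫⁻ x, ‖k y x‖ₑ * f x ∂ν) ^ 2 ∂ν ≤ N ^ 2 * ∫⁻ x, f x ^ 2 ∂ν :=
  lintegral_schur h.stronglyMeasurable.enorm h.measurable_left h.ne_zero h.le_left h.le_right
    h.measurable_right hf

lemma lintegral_lt_top (h : IsSchurKernel ν k N p q) (ψ : Lp F 2 ν) :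
    ∫⁻ y, (∫⁻ x, ‖k y x‖ₑ * ‖ψ x‖ₑ ∂ν) ^ 2 ∂ν < ⊤ := by
  refine (h.lintegral_le (Lp.stronglyMeasurable ψ).enorm).trans_lt ?_
  rw [← eLpNorm_two_sq]
  exact ENNReal.mul_lt_top (by finiteness) (by have := Lp.eLpNorm_lt_top ψ; finiteness)

lemma measurable_lintegral (h : IsSchurKernel ν k N p q) (ψ : Lp F 2 ν) :
    Measurable fun y => ∫⁻ x, ‖k y x‖ₑ * ‖ψ x‖ₑ ∂ν := by
  have h1 : Measurable (Function.uncurry fun y x => ‖k y x‖ₑ * ‖ψ x‖ₑ) :=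
    (h.stronglyMeasurable.enorm).mul ((Lp.stronglyMeasurable ψ).enorm.comp measurable_snd)
  exact h1.lintegral_prod_right

lemma stronglyMeasurable_apply (h : IsSchurKernel ν k N p q) (ψ : Lp F 2 ν) :
    StronglyMeasurable (Function.uncurry fun y x => k y x (ψ x)) := by
  have h1 : StronglyMeasurable fun z : α × α => (Function.uncurry k z, ψ z.2) :=
    h.stronglyMeasurable.prodMk ((Lp.stronglyMeasurable ψ).comp_measurable measurable_snd)
  exact (isBoundedBilinearMap_apply (𝕜 := ℂ) (E := F) (F := F')).continuous.comp_stronglyMeasurable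
    h1

lemma ae_integrable (h : IsSchurKernel ν k N p q) (ψ : Lp F 2 ν) :
    ∀ᵐ y ∂ν, Integrable (fun x => k y x (ψ x)) ν := by
  have h1 := ae_lt_top ((h.measurable_lintegral ψ).pow_const 2) (h.lintegral_lt_top ψ).ne
  filter_upwards [h1] with y hy
  refine ⟨((h.stronglyMeasurable_apply ψ).comp_measurable
    measurable_prodMk_left).aestronglyMeasurable, ?_⟩
  refine lt_of_le_of_lt (lintegral_mono fun x => ?_)
    (ENNReal.pow_lt_top_iff.1 hy |>.resolve_right two_ne_zero)
  exact (k y x).le_opENorm _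

lemma eLpNorm_le (h : IsSchurKernel ν k N p q) (ψ : Lp F 2 ν) :
    eLpNorm (fun y => ∫ x, k y x (ψ x) ∂ν) 2 ν ≤ N * eLpNorm ψ 2 ν := by
  refine (ENNReal.pow_le_pow_left_iff two_ne_zero).1 ?_
  rw [mul_pow, eLpNorm_two_sq, eLpNorm_two_sq]
  refine le_trans (lintegral_mono fun y => ?_) (h.lintegral_le (Lp.stronglyMeasurable ψ).enorm)
  refine pow_le_pow_left₀ zero_le ((enorm_integral_le_lintegral_enorm _).trans
    (lintegral_mono fun x => (k y x).le_opENorm _)) 2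

lemma memLp (h : IsSchurKernel ν k N p q) (ψ : Lp F 2 ν) :
    MemLp (fun y => ∫ x, k y x (ψ x) ∂ν) 2 ν :=
  ⟨(h.stronglyMeasurable_apply ψ).integral_prod_right.aestronglyMeasurable,
    (h.eLpNorm_le ψ).trans_lt (ENNReal.mul_lt_top ENNReal.coe_lt_top (Lp.eLpNorm_lt_top ψ))⟩

/-- The bounded operator with a kernel that satisfies Schur's test. -/
def toCLM (h : IsSchurKernel ν k N p q) : Lp F 2 ν →L[ℂ] Lp F' 2 ν :=
  LinearMap.mkContinuous
    { toFun := fun ψ => (h.memLp ψ).toLp _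
      map_add' := fun ψ ψ' => by
        rw [← MemLp.toLp_add]
        refine MemLp.toLp_congr _ _ ?_
        filter_upwards [h.ae_integrable ψ, h.ae_integrable ψ'] with y h1 h2
        rw [Pi.add_apply, ← integral_add h1 h2]
        refine integral_congr_ae ?_
        filter_upwards [Lp.coeFn_add ψ ψ'] with x hx
        rw [hx, Pi.add_apply, map_add]
      map_smul' := fun c ψ => by
        rw [RingHom.id_apply, ← MemLp.toLp_const_smul]
        refine MemLp.toLp_congr _ _ (Filter.Eventually.of_forall fun y => ?_)
        rw [Pi.smul_apply, ← integral_smul]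
        refine integral_congr_ae ?_
        filter_upwards [Lp.coeFn_smul c ψ] with x hx
        rw [hx, Pi.smul_apply, map_smul] } N (fun ψ => by
      show ‖(h.memLp ψ).toLp _‖ ≤ N * ‖ψ‖
      rw [Lp.norm_toLp, Lp.norm_def]
      refine (ENNReal.toReal_mono (ENNReal.mul_lt_top ENNReal.coe_lt_top
        (Lp.eLpNorm_lt_top ψ)).ne (h.eLpNorm_le ψ)).trans_eq ?_
      rw [ENNReal.toReal_mul, ENNReal.coe_toReal])

lemma coeFn_toCLM (h : IsSchurKernel ν k N p q) (ψ : Lp F 2 ν) :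
    h.toCLM ψ =ᵐ[ν] fun y => ∫ x, k y x (ψ x) ∂ν := (h.memLp ψ).coeFn_toLp

lemma norm_toCLM_le (h : IsSchurKernel ν k N p q) : ‖h.toCLM‖ ≤ N :=
  LinearMap.mkContinuous_norm_le _ N.2 _

/-- Fubini's theorem for the pairing of `k ψ` with a square integrable function. -/
lemma inner_toCLM [CompleteSpace F] (h : IsSchurKernel ν k N p q) (ψ : Lp F 2 ν) {f : α → F'}
    (hf : StronglyMeasurable f) (hf2 : MemLp f 2 ν) :
    ∫ y, inner ℂ (f y) (h.toCLM ψ y) ∂ν = ∫ x, ∫ y, inner ℂ (f y) (k y x (ψ x)) ∂ν ∂ν := by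
  have hm : StronglyMeasurable (Function.uncurry fun y x => inner ℂ (f y) (k y x (ψ x))) :=
    (hf.comp_measurable measurable_fst).inner (h.stronglyMeasurable_apply ψ)
  have hint : Integrable (Function.uncurry fun y x => inner ℂ (f y) (k y x (ψ x))) (ν.prod ν) := by
    refine ⟨hm.aestronglyMeasurable, ?_⟩
    show ∫⁻ _, _ ∂_ < ⊤
    rw [lintegral_prod _ hm.enorm.aemeasurable]
    have h1 : ∀ y, ∫⁻ x, ‖Function.uncurry (fun y x => inner ℂ (f y) (k y x (ψ x))) (y, x)‖ₑ ∂ν ≤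
        ‖f y‖ₑ * ∫⁻ x, ‖k y x‖ₑ * ‖ψ x‖ₑ ∂ν := by
      intro y
      have hm' : Measurable fun x => ‖k y x‖ₑ * ‖ψ x‖ₑ :=
        ((h.stronglyMeasurable.comp_measurable measurable_prodMk_left).enorm).mul
          (Lp.stronglyMeasurable ψ).enorm
      rw [← lintegral_const_mul _ hm']
      refine lintegral_mono fun x => ?_
      have h2 : ‖inner ℂ (f y) (k y x (ψ x))‖ₑ ≤ ‖f y‖ₑ * ‖k y x (ψ x)‖ₑ := by
        have := norm_inner_le_norm (𝕜 := ℂ) (f y) (k y x (ψ x))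
        rw [← ofReal_norm, ← ofReal_norm, ← ofReal_norm,
          ← ENNReal.ofReal_mul (norm_nonneg _)]
        exact ENNReal.ofReal_le_ofReal this
      exact h2.trans (mul_le_mul_right ((k y x).le_opENorm _) _)
    refine lt_of_le_of_lt (lintegral_mono h1) ?_
    have h3 := lintegral_mul_sq_le (ν := ν) (fun y => ‖f y‖ₑ)
      (fun y => ∫⁻ x, ‖k y x‖ₑ * ‖ψ x‖ₑ ∂ν) hf.enorm.aemeasurable
      (h.measurable_lintegral ψ).aemeasurable
    rw [← eLpNorm_two_sq] at h3
    have h4 := h3.trans_lt (ENNReal.mul_lt_top (by have := hf2.2; finiteness)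
      (h.lintegral_lt_top ψ))
    exact (ENNReal.pow_lt_top_iff.1 h4).resolve_right two_ne_zero
  rw [← integral_integral_swap hint]
  refine integral_congr_ae ?_
  filter_upwards [h.coeFn_toCLM ψ, h.ae_integrable ψ] with y hy hy'
  rw [hy, integral_inner hy']

/-- Composition of kernels: if the convolution of `k'` and `k` is `k''`, almost everywhere, then
the operators are composed. -/
lemma toCLM_comp_apply {F'' : Type*} [NormedAddCommGroup F''] [InnerProductSpace ℂ F'']
    [CompleteSpace F''] [CompleteSpace F] {k' : α → α → F' →L[ℂ] F''} {k'' : α → α → F →L[ℂ] F''}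
    {N' N'' : NNReal} {p' q' p'' q'' : α → NNReal} (h : IsSchurKernel ν k N p q)
    (h' : IsSchurKernel ν k' N' p' q') (h'' : IsSchurKernel ν k'' N'' p'' q'')
    (hk : ∀ y x z, k'' y x z = ∫ t, k' y t (k t x z) ∂ν) (ψ : Lp F 2 ν) :
    h'.toCLM (h.toCLM ψ) = h''.toCLM ψ := by
  refine Lp.ext ?_
  set m : α → ℝ≥0∞ := fun t => ∫⁻ x, ‖k t x‖ₑ * ‖ψ x‖ₑ ∂ν with hm
  have hmm : Measurable m := h.measurable_lintegral ψ
  -- Schur's test for `k'`, applied to the square integrable majorant `m` of `k ψ`, makes the double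
  -- integral absolutely convergent for almost every `y`, as Fubini requires.
  have h1 : ∫⁻ y, (∫⁻ t, ‖k' y t‖ₑ * m t ∂ν) ^ 2 ∂ν < ⊤ :=
    (h'.lintegral_le hmm).trans_lt (ENNReal.mul_lt_top (by finiteness) (h.lintegral_lt_top ψ))
  have hmeas : Measurable fun y => ∫⁻ t, ‖k' y t‖ₑ * m t ∂ν := by
    have h2 : Measurable (Function.uncurry fun y t => ‖k' y t‖ₑ * m t) :=
      h'.stronglyMeasurable.enorm.mul (hmm.comp measurable_snd)
    exact h2.lintegral_prod_right
  filter_upwards [h'.coeFn_toCLM (h.toCLM ψ), h''.coeFn_toCLM ψ,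
    ae_lt_top (hmeas.pow_const 2) h1.ne] with y e1 e2 hy
  rw [e1, e2]
  have hsm : StronglyMeasurable (Function.uncurry fun t x => k' y t (k t x (ψ x))) :=
    (isBoundedBilinearMap_apply (𝕜 := ℂ) (E := F') (F := F'')).continuous.comp_stronglyMeasurable
      (((h'.stronglyMeasurable.comp_measurable measurable_prodMk_left).comp_measurable
        measurable_fst).prodMk (h.stronglyMeasurable_apply ψ))
  have hint : Integrable (Function.uncurry fun t x => k' y t (k t x (ψ x))) (ν.prod ν) := by
    refine ⟨hsm.aestronglyMeasurable, ?_⟩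
    show ∫⁻ _, _ ∂_ < ⊤
    rw [lintegral_prod _ hsm.enorm.aemeasurable]
    refine lt_of_le_of_lt (lintegral_mono fun t => ?_)
      ((ENNReal.pow_lt_top_iff.1 hy).resolve_right two_ne_zero)
    have hm' : Measurable fun x => ‖k t x‖ₑ * ‖ψ x‖ₑ :=
      ((h.stronglyMeasurable.comp_measurable measurable_prodMk_left).enorm).mul
        (Lp.stronglyMeasurable ψ).enorm
    rw [hm, ← lintegral_const_mul _ hm']
    refine lintegral_mono fun x => ?_
    exact ((k' y t).le_opENorm _).trans (mul_le_mul_right ((k t x).le_opENorm _) _)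
  calc ∫ t, k' y t (h.toCLM ψ t) ∂ν = ∫ t, ∫ x, k' y t (k t x (ψ x)) ∂ν ∂ν := by
        refine integral_congr_ae ?_
        filter_upwards [h.coeFn_toCLM ψ, h.ae_integrable ψ] with t e3 e4
        rw [e3, ContinuousLinearMap.integral_comp_comm _ e4]
    _ = ∫ x, ∫ t, k' y t (k t x (ψ x)) ∂ν ∂ν := integral_integral_swap hint
    _ = ∫ x, k'' y x (ψ x) ∂ν := integral_congr_ae (Filter.Eventually.of_forall fun x =>
        (hk y x (ψ x)).symm)

end IsSchurKernel

end Schur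

/-! ### Modular functions and convolution kernels on one group -/

section Haar

variable {G : Type*} [Group G] [TopologicalSpace G] [IsTopologicalGroup G] [LocallyCompactSpace G]
  [SecondCountableTopology G] [T2Space G] [MeasurableSpace G] [BorelSpace G]

/-- The square root of Mathlib's modular character. -/
def modularWeight (g : G) : NNReal := NNReal.sqrt (Measure.modularCharacterFun g)

lemma modularWeight_mul (g h : G) :
    modularWeight (g * h) = modularWeight g * modularWeight h := by
  rw [modularWeight, Measure.modularCharacterFun_map_mul, NNReal.sqrt_mul]
  rfl

lemma modularWeight_one : modularWeight (1 : G) = 1 := by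
  rw [modularWeight, Measure.modularCharacterFun_map_one, NNReal.sqrt_one]

lemma modularWeight_ne_zero (g : G) : modularWeight g ≠ 0 := by
  rw [modularWeight, Ne, NNReal.sqrt_eq_zero]
  exact (Measure.modularCharacterFun_pos g).ne'

lemma modularWeight_inv (g : G) : modularWeight g⁻¹ = (modularWeight g)⁻¹ := by
  refine eq_inv_of_mul_eq_one_left ?_
  rw [← modularWeight_mul, inv_mul_cancel, modularWeight_one]

lemma modularWeight_sq (g : G) : modularWeight g ^ 2 = Measure.modularCharacterFun g :=
  NNReal.sq_sqrt _

variable (ν : Measure G) [ν.IsHaarMeasure]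

lemma lintegral_mul_right (f : G → ℝ≥0∞) (g : G) :
    ∫⁻ h, f (h * g) ∂ν = modularWeight g ^ 2 * ∫⁻ h, f h ∂ν := by
  have h1 : ∫⁻ h, f h ∂(Measure.map (· * g) ν) = ∫⁻ h, f (h * g) ∂ν :=
    lintegral_map_equiv f (MeasurableEquiv.mulRight g)
  rw [← h1, Measure.map_right_mul_eq_modularCharacterFun_smul, lintegral_smul_measure,
    ← modularWeight_sq]
  simp [ENNReal.smul_def]

/-- The character is a quotient of two integrals: that of a right translate of the indicator of a
compact neighbourhood by that of the indicator itself. The former is measurable in the translation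
by Tonelli. -/
lemma measurable_modularWeight : Measurable (modularWeight : G → NNReal) := by
  let ν : Measure G := Measure.haar
  obtain ⟨K, hK, hK1⟩ := exists_compact_mem_nhds (1 : G)
  have hpos : ν K ≠ 0 := (Measure.measure_pos_of_mem_nhds ν hK1).ne'
  have htop : ν K ≠ ⊤ := hK.measure_lt_top.ne
  have hf : Measurable (K.indicator (1 : G → ℝ≥0∞)) := measurable_one.indicator hK.measurableSet
  have h1 : Measurable fun g : G => ∫⁻ h, K.indicator (1 : G → ℝ≥0∞) (h * g) ∂ν := by
    have : Measurable (Function.uncurry fun g h : G => K.indicator (1 : G → ℝ≥0∞) (h * g)) :=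
      hf.comp (measurable_snd.mul measurable_fst)
    exact this.lintegral_prod_right
  have h2 : ∀ g : G, (∫⁻ h, K.indicator (1 : G → ℝ≥0∞) (h * g) ∂ν) / ν K =
      ((Measure.modularCharacterFun g : NNReal) : ℝ≥0∞) := by
    intro g
    rw [lintegral_mul_right, lintegral_indicator_one hK.measurableSet,
      ENNReal.mul_div_cancel_right hpos htop, ← ENNReal.coe_pow, modularWeight_sq]
  have h3 : Measurable fun g : G => ((Measure.modularCharacterFun g : NNReal) : ℝ≥0∞) := by
    simp only [← h2]
    exact h1.div_const _
  exact NNReal.continuous_sqrt.measurable.comp (measurable_coe_nnreal_ennreal_iff.1 h3)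

/-- For a test function `k` with finite nonzero integral, the double integral of `k(x) f(y⁻¹ x)` is
evaluated in both orders. One order produces `∫ k · ∫ f(y⁻¹)`, the other moves the translation onto
`k` from the right and produces the modular factor; `∫ k` is then cancelled. -/
lemma lintegral_inv_eq {f : G → ℝ≥0∞} (hf : Measurable f) :
    ∫⁻ g, f g⁻¹ ∂ν = ∫⁻ g, f g * modularWeight g ^ 2 ∂ν := by
  obtain ⟨K, hK, hK1⟩ := exists_compact_mem_nhds (1 : G)
  have hpos : ν K ≠ 0 := (Measure.measure_pos_of_mem_nhds ν hK1).ne'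
  have htop : ν K ≠ ⊤ := hK.measure_lt_top.ne
  set k : G → ℝ≥0∞ := K.indicator 1 with hk
  have hkm : Measurable k := measurable_one.indicator hK.measurableSet
  have hkK : ∫⁻ g, k g ∂ν = ν K := lintegral_indicator_one hK.measurableSet
  have hw : Measurable fun g : G => (modularWeight g : ℝ≥0∞) :=
    measurable_modularWeight.coe_nnreal_ennreal
  have key : (∫⁻ x, k x ∂ν) * ∫⁻ y, f y⁻¹ ∂ν = (∫⁻ x, f x * modularWeight x ^ 2 ∂ν) *
      ∫⁻ y, k y ∂ν := by
    calc (∫⁻ x, k x ∂ν) * ∫⁻ y, f y⁻¹ ∂ν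
        = ∫⁻ x, ∫⁻ y, k x * f (y⁻¹ * x) ∂ν ∂ν := by
          rw [← lintegral_mul_const _ hkm]
          refine lintegral_congr fun x => ?_
          have hm : Measurable fun y => f (y⁻¹ * x) := hf.comp (measurable_inv.mul_const x)
          rw [lintegral_const_mul _ hm]
          congr 1
          rw [← lintegral_mul_left_eq_self (fun y => f (y⁻¹ * x)) x]
          simp [mul_assoc]
      _ = ∫⁻ y, ∫⁻ x, k x * f (y⁻¹ * x) ∂ν ∂ν := by
          refine lintegral_lintegral_swap ?_
          exact ((hkm.comp measurable_fst).mul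
            (hf.comp (measurable_snd.inv.mul measurable_fst))).aemeasurable
      _ = ∫⁻ y, ∫⁻ x, k (y * x) * f x ∂ν ∂ν := by
          refine lintegral_congr fun y => ?_
          rw [← lintegral_mul_left_eq_self (fun x => k x * f (y⁻¹ * x)) y]
          simp
      _ = ∫⁻ x, ∫⁻ y, k (y * x) * f x ∂ν ∂ν := by
          refine lintegral_lintegral_swap ?_
          exact ((hkm.comp (measurable_fst.mul measurable_snd)).mul
            (hf.comp measurable_snd)).aemeasurable
      _ = ∫⁻ x, (f x * modularWeight x ^ 2) * ∫⁻ y, k y ∂ν ∂ν := by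
          refine lintegral_congr fun x => ?_
          have hm : Measurable fun y => k (y * x) := hkm.comp (measurable_id.mul_const x)
          rw [lintegral_mul_const _ hm, lintegral_mul_right]
          ring
      _ = _ := lintegral_mul_const _ (hf.mul (hw.pow_const 2))
  rw [hkK, mul_comm] at key
  exact (ENNReal.mul_left_inj hpos htop).1 key

lemma integral_inv_eq {E : Type*} [NormedAddCommGroup E] [NormedSpace ℝ E] (f : G → E) :
    ∫ g, f g⁻¹ ∂ν = ∫ g, (modularWeight g ^ 2) • f g ∂ν := by
  have hw : Measurable fun g : G => modularWeight g ^ 2 := measurable_modularWeight.pow_const 2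
  have h1 : ν.map (MeasurableEquiv.inv G) =
      ν.withDensity fun g => ((modularWeight g ^ 2 : NNReal) : ℝ≥0∞) := by
    refine Measure.ext fun s hs => ?_
    rw [withDensity_apply _ hs, ← lintegral_indicator_one hs, lintegral_map_equiv]
    have h2 := lintegral_inv_eq ν (f := s.indicator 1) (measurable_one.indicator hs)
    refine h2.trans ?_
    rw [← lintegral_indicator hs]
    refine lintegral_congr fun g => ?_
    by_cases hg : g ∈ s <;> simp [hg]
  rw [← integral_withDensity_eq_integral_smul hw, ← h1, integral_map_equiv]
  rfl

/-- Inversion contributes the factor `w²`, with `w = modularWeight`, and turns `w` into `w⁻¹`, so `w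
dg` is invariant under inversion. For this reason the single quantity `∫ ‖κ‖ w` controls a kernel in
both variables. -/
lemma lintegral_inv_mul_modularWeight {f : G → ℝ≥0∞} (hf : Measurable f) :
    ∫⁻ g, f g⁻¹ * modularWeight g ∂ν = ∫⁻ g, f g * modularWeight g ∂ν := by
  have hw : Measurable fun g : G => (modularWeight g : ℝ≥0∞) :=
    measurable_modularWeight.coe_nnreal_ennreal
  have h1 := lintegral_inv_eq ν (f := fun g => f g * modularWeight g⁻¹)
    (hf.mul (hw.comp measurable_inv))
  simp only [inv_inv] at h1
  rw [h1]
  refine lintegral_congr fun g => ?_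
  rw [modularWeight_inv, mul_assoc, ← ENNReal.coe_pow, ← ENNReal.coe_mul, sq,
    inv_mul_cancel_left₀ (modularWeight_ne_zero g)]

variable {F F' : Type*} [NormedAddCommGroup F'] [InnerProductSpace ℂ F'] [CompleteSpace F']
  [NormedAddCommGroup F] [InnerProductSpace ℂ F]

/-- The kernel of the right action of functions on `e`. -/
def actionKernel (e : G → F) (h g : G) : ℂ →L[ℂ] F :=
  ContinuousLinearMap.toSpanSingleton ℂ (((modularWeight g : ℝ) : ℂ) • e (g * h))

lemma enorm_actionKernel (e : G → F) (h g : G) :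
    ‖actionKernel e h g‖ₑ = ‖e (g * h)‖ₑ * modularWeight g := by
  rw [← ofReal_norm, actionKernel, ContinuousLinearMap.norm_toSpanSingleton, norm_smul,
    Complex.norm_real, Real.norm_of_nonneg (NNReal.coe_nonneg _), mul_comm,
    ENNReal.ofReal_mul (norm_nonneg _), ofReal_norm, ENNReal.ofReal_coe_nnreal]

/-- The weights absorb the modular factors. In the first condition, right translation by `h` scales
by `w(h)²` and the weight gives back `w(h)⁻¹`; the second is left invariance together with `w(g)
w(h) = w(g h)`. -/
lemma isSchurKernel_action {e : G → F} (he : Continuous e) {N : NNReal}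
    (hN : ∫⁻ g, ‖e g‖ₑ * modularWeight g ∂ν ≤ N) :
    IsSchurKernel ν (actionKernel e) N (fun _ => 1) modularWeight where
  stronglyMeasurable := by
    have h1 : StronglyMeasurable fun p : G × G =>
        ((modularWeight p.2 : ℝ) : ℂ) • e (p.2 * p.1) :=
      (Complex.measurable_ofReal.comp (measurable_coe_nnreal_real.comp
        (measurable_modularWeight.comp measurable_snd))).stronglyMeasurable.smul
        (he.comp (continuous_snd.mul continuous_fst)).stronglyMeasurable
    have h2 := (ContinuousLinearMap.toSpanSingletonCLE (𝕜 := ℂ) (E := F)).continuous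
    exact h2.comp_stronglyMeasurable h1
  measurable_left := measurable_const
  measurable_right := measurable_modularWeight
  ne_zero := fun _ => one_ne_zero
  le_left := fun h => by
    simp only [enorm_actionKernel, ENNReal.coe_one, mul_one]
    have h1 := lintegral_mul_right ν (fun g => ‖e g‖ₑ * modularWeight (g * h⁻¹)) h
    simp only [mul_inv_cancel_right] at h1
    rw [h1]
    have h2 : ∀ g, ‖e g‖ₑ * (modularWeight (g * h⁻¹) : ℝ≥0∞) =
        (‖e g‖ₑ * modularWeight g) * ((modularWeight h)⁻¹ : NNReal) := fun g => by
      rw [modularWeight_mul, modularWeight_inv, ENNReal.coe_mul, mul_assoc]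
    simp only [h2]
    rw [lintegral_mul_const' _ _ ENNReal.coe_ne_top, mul_comm (∫⁻ _, _ ∂_), ← mul_assoc,
      ← ENNReal.coe_pow, ← ENNReal.coe_mul, sq, mul_inv_cancel_right₀ (modularWeight_ne_zero h),
      mul_comm]
    exact mul_le_mul_left hN _
  le_right := fun g => by
    simp only [enorm_actionKernel, ENNReal.coe_one, mul_one]
    refine le_trans (le_of_eq ?_) hN
    rw [← lintegral_mul_left_eq_self (fun h => ‖e h‖ₑ * (modularWeight h : ℝ≥0∞)) g]
    refine lintegral_congr fun h => ?_
    rw [modularWeight_mul, ENNReal.coe_mul, mul_assoc]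

/-- The kernel of the right convolution with `κ`. -/
def convKernel (κ : G → F →L[ℂ] F') (g h : G) : F →L[ℂ] F' := κ (g⁻¹ * h)

/-- Multiplicativity of `w` and left invariance reduce both conditions to `∫ ‖κ‖ w`; the second one
meets `κ` at inverses, which inversion invariance of `w dg` permits. -/
lemma isSchurKernel_conv {κ : G → F →L[ℂ] F'} (hκ : Continuous κ) {N : NNReal}
    (hN : ∫⁻ g, ‖κ g‖ₑ * modularWeight g ∂ν ≤ N) :
    IsSchurKernel ν (convKernel κ) N modularWeight modularWeight where
  stronglyMeasurable :=
    (hκ.comp (continuous_fst.inv.mul continuous_snd)).stronglyMeasurable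
  measurable_left := measurable_modularWeight
  measurable_right := measurable_modularWeight
  ne_zero := modularWeight_ne_zero
  le_left := fun g => by
    have h1 : ∀ h, ‖convKernel κ g h‖ₑ * (modularWeight h : ℝ≥0∞) =
        (‖κ (g⁻¹ * h)‖ₑ * modularWeight (g⁻¹ * h)) * modularWeight g := fun h => by
      rw [mul_assoc, ← ENNReal.coe_mul, mul_comm (modularWeight (_ * _)), ← modularWeight_mul,
        mul_inv_cancel_left]
      rfl
    simp only [h1]
    rw [lintegral_mul_const' _ _ ENNReal.coe_ne_top,
      lintegral_mul_left_eq_self (fun h => ‖κ h‖ₑ * (modularWeight h : ℝ≥0∞)) g⁻¹]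
    exact mul_le_mul_left hN _
  le_right := fun h => by
    have h1 : ∀ g, ‖convKernel κ g h‖ₑ * (modularWeight g : ℝ≥0∞) =
        (‖κ ((h⁻¹ * g)⁻¹)‖ₑ * modularWeight (h⁻¹ * g)) * modularWeight h := fun g => by
      rw [mul_assoc, ← ENNReal.coe_mul, mul_comm (modularWeight (_ * _)), ← modularWeight_mul,
        mul_inv_cancel_left]
      simp [convKernel]
    simp only [h1]
    rw [lintegral_mul_const' _ _ ENNReal.coe_ne_top,
      lintegral_mul_left_eq_self (fun g => ‖κ g⁻¹‖ₑ * (modularWeight g : ℝ≥0∞)) h⁻¹,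
      lintegral_inv_mul_modularWeight ν (f := fun g => ‖κ g‖ₑ) hκ.enorm.measurable]
    exact mul_le_mul_left hN _

end Haar

/-! ### Cutoff functions and the topology of the bundle of groups -/

variable {n d r : ℕ} {X : Type u} [TopologicalSpace X]
  [ChartedSpace (EuclideanSpace ℝ (Fin n)) X] [IsManifold (𝓡 n) ∞ X]

/-- Smooth bump functions with compact support that are equal to `1` on a compact set. -/
lemma exists_smooth_cutoff {k : ℕ} {Y : Type*} [TopologicalSpace Y]
    [ChartedSpace (EuclideanSpace ℝ (Fin k)) Y] [IsManifold (𝓡 k) ∞ Y] [T2Space Y]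
    [SecondCountableTopology Y] {L W : Set Y} (hL : IsCompact L) (hW : IsOpen W) (hLW : L ⊆ W) :
    ∃ f : Y → ℝ, ContMDiff (𝓡 k) 𝓘(ℝ, ℝ) ∞ f ∧ HasCompactSupport f ∧ tsupport f ⊆ W ∧
      (∀ y, 0 ≤ f y ∧ f y ≤ 1) ∧ (∀ᶠ y in 𝓝ˢ L, f y = 1) := by
  have : LocallyCompactSpace Y :=
    ChartedSpace.locallyCompactSpace (EuclideanSpace ℝ (Fin k)) Y
  obtain ⟨L₁, hL₁, hLL₁, hL₁W⟩ := exists_compact_between hL hW hLW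
  obtain ⟨L₂, hL₂, hLL₂, hL₂₁⟩ := exists_compact_between hL isOpen_interior hLL₁
  obtain ⟨f, hf0, hf1, hf⟩ := exists_contMDiffMap_zero_one_of_isClosed (𝓡 k) (n := (⊤ : ℕ∞))
    (s := (interior L₁)ᶜ) (t := L₂) isOpen_interior.isClosed_compl hL₂.isClosed
    (Set.disjoint_compl_left_iff_subset.2 hL₂₁)
  have hsub : Function.support f ⊆ L₁ := fun y hy => by
    by_contra h
    exact hy (hf0 (fun h' => h (interior_subset h')))
  have hts : tsupport f ⊆ L₁ := closure_minimal hsub hL₁.isClosed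
  refine ⟨f, f.contMDiff, hL₁.of_isClosed_subset (isClosed_tsupport _) hts, hts.trans hL₁W, hf, ?_⟩
  refine Filter.mem_of_superset (isOpen_interior.mem_nhdsSet.2 hLL₂) fun y hy => ?_
  exact hf1 (interior_subset hy)

namespace TangentLieStructure

variable (T : TangentLieStructure.{u, v} n d X)

lemma continuous_proj : Continuous (fun p : T.Tot => p.proj) :=
  T.submersion_proj.contMDiff.continuous

/-- The inclusion of the fibre. -/
def incl (x : X) (g : T.G x) : T.Tot := ⟨x, g⟩

lemma contMDiff_incl (x : X) : ContMDiff (𝓡 d) (𝓡 (n + d)) ∞ (T.incl x) :=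
  (T.embedding_fibre x).isImmersion.contMDiff

lemma isClosedEmbedding_incl [T2Space X] (x : X) : Topology.IsClosedEmbedding (T.incl x) := by
  refine ⟨(T.embedding_fibre x).isEmbedding, ?_⟩
  have : Set.range (T.incl x) = (fun p : T.Tot => p.proj) ⁻¹' {x} := by
    ext ⟨y, g⟩
    constructor
    · rintro ⟨g', h⟩
      exact (congrArg (fun p : T.Tot => p.proj) h).symm
    · rintro (rfl : y = x)
      exact ⟨g, rfl⟩
  rw [this]
  exact isClosed_singleton.preimage T.continuous_proj

instance (x : X) : IsTopologicalGroup (T.G x) := topologicalGroup_of_lieGroup (𝓡 d) ∞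

instance (x : X) : LocallyCompactSpace (T.G x) :=
  ChartedSpace.locallyCompactSpace (EuclideanSpace ℝ (Fin d)) (T.G x)

instance (x : X) : T2Space (T.G x) := (T.embedding_fibre x).isEmbedding.t2Space

instance (x : X) : SecondCountableTopology (T.G x) :=
  (T.embedding_fibre x).isEmbedding.secondCountableTopology

/-- The two conventions for the modular function are inverse to each other, so the power `-1/2` is
the positive square root of Mathlib's character. -/
lemma modular_rpow (x : X) (g : T.G x) : (T.modular x g) ^ (-(1 / 2 : ℝ)) = modularWeight g := by
  have h1 : T.modular x g = ((Measure.modularCharacterFun g : NNReal) : ℝ)⁻¹ := rfl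
  rw [h1, Real.inv_rpow (NNReal.coe_nonneg _), Real.rpow_neg (NNReal.coe_nonneg _), inv_inv,
    ← Real.sqrt_eq_rpow, modularWeight, Real.coe_sqrt]

end TangentLieStructure

instance {T : TangentLieStructure.{u, v} n d X} (μ : SmoothHaarSystem T) (x : X) :
    (μ.measure x).IsHaarMeasure := μ.isHaar x

instance {T : TangentLieStructure.{u, v} n d X} (V : HermitianBundle.{u, v, w} T r) (x : X) :
    FiniteDimensional ℂ (V.Z x) :=
  (V.frame x x).toLinearEquiv.finiteDimensional

/-! ### Local uniformity of Haar measures and modular functions -/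

section Bounds

variable [T2Space X] {T : TangentLieStructure.{u, v} n d X} (μ : SmoothHaarSystem T)

lemma SmoothHaarSystem.integrable {f : T.Tot → ℝ} (hf : Continuous f) (hc : HasCompactSupport f)
    (x : X) : Integrable (fun g => f (T.incl x g)) (μ.measure x) :=
  (hf.comp (T.isClosedEmbedding_incl x).continuous).integrable_of_hasCompactSupport
    (hc.comp_isClosedEmbedding (T.isClosedEmbedding_incl x))

/-- The Haar measures are locally uniformly bounded. -/
lemma SmoothHaarSystem.exists_measure_le {L : Set T.Tot} (hL : IsCompact L) :
    ∃ c : NNReal, ∀ x, μ.measure x (T.incl x ⁻¹' L) ≤ c := by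
  -- A smooth function that dominates the indicator of `L` has a continuous fibre integral, which
  -- vanishes off the compact projection of its support.
  obtain ⟨f, hf, hfc, -, hf01, hf1⟩ := exists_smooth_cutoff (k := n + d) (Y := T.Tot)
    hL isOpen_univ (Set.subset_univ L)
  have hcont := (μ.smooth f hf hfc).continuous
  obtain ⟨c, hc⟩ := (hfc.image T.continuous_proj).exists_bound_of_continuousOn hcont.continuousOn
  have hbd : ∀ x, ∫ g, f ⟨x, g⟩ ∂(μ.measure x) ≤ max c 0 := by
    intro x
    by_cases hx : x ∈ (fun p : T.Tot => p.proj) '' tsupport f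
    · exact (le_abs_self _).trans ((hc x hx).trans (le_max_left _ _))
    · have : ∀ g : T.G x, f ⟨x, g⟩ = 0 := fun g => by
        by_contra h
        exact hx ⟨⟨x, g⟩, subset_tsupport _ h, rfl⟩
      simp only [this, integral_zero]
      exact le_max_right _ _
  refine ⟨(max c 0).toNNReal, fun x => ?_⟩
  have hmeas : MeasurableSet (T.incl x ⁻¹' L) :=
    (hL.isClosed.preimage (T.isClosedEmbedding_incl x).continuous).measurableSet
  rw [← lintegral_indicator_one hmeas]
  calc ∫⁻ g, (T.incl x ⁻¹' L).indicator 1 g ∂(μ.measure x)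
      ≤ ∫⁻ g, ENNReal.ofReal (f (T.incl x g)) ∂(μ.measure x) := by
        refine lintegral_mono fun g => ?_
        by_cases hg : g ∈ T.incl x ⁻¹' L
        · simp [hg, hf1.self_of_nhdsSet _ hg]
        · simp [hg]
    _ = ENNReal.ofReal (∫ g, f (T.incl x g) ∂(μ.measure x)) :=
        (ofReal_integral_eq_lintegral_ofReal (μ.integrable hf.continuous hfc x)
          (Filter.Eventually.of_forall fun g => (hf01 _).1)).symm
    _ ≤ _ := ENNReal.ofReal_le_ofReal (hbd x)

/-- Multiplication is continuous only on the fibre product; this is closed in the square because `X`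
is Hausdorff, so it cuts compact sets out of compact products. -/
lemma exists_isCompact_mul_inv {L L' : Set T.Tot} (hL : IsCompact L) (hL' : IsCompact L') :
    ∃ L'' : Set T.Tot, IsCompact L'' ∧ ∀ (x : X) (g h : T.G x), T.incl x g ∈ L →
      T.incl x h ∈ L' → T.incl x (g * h⁻¹) ∈ L'' := by
  obtain ⟨m, hm, hm'⟩ := T.smooth_mul
  set J : Set T.Tot := (fun p : T.Tot => (⟨p.proj, p.snd⁻¹⟩ : T.Tot)) '' L' with hJ
  have hJc : IsCompact J := hL'.image T.smooth_inv.continuous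
  have hcl : IsClosed {p : T.Tot × T.Tot | p.1.proj = p.2.proj} :=
    isClosed_eq (T.continuous_proj.comp continuous_fst) (T.continuous_proj.comp continuous_snd)
  refine ⟨m '' ((L ×ˢ J) ∩ {p | p.1.proj = p.2.proj}), ?_, fun x g h hg hh => ?_⟩
  · exact ((hL.prod hJc).inter_right hcl).image_of_continuousOn
      (hm.continuousOn.mono Set.inter_subset_right)
  · refine ⟨(⟨x, g⟩, ⟨x, h⁻¹⟩), ⟨⟨hg, ⟨⟨x, h⟩, hh, rfl⟩⟩, rfl⟩, ?_⟩
    exact hm' x g h⁻¹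

/-- The modular functions are locally uniformly bounded. -/
lemma SmoothHaarSystem.exists_modularWeight_le (μ : SmoothHaarSystem T)
    {L : Set T.Tot} (hL : IsCompact L) :
    ∃ c : NNReal, ∀ x (g : T.G x), T.incl x g ∈ L → modularWeight g ≤ c := by
  set B : Set X := (fun p : T.Tot => p.proj) '' L with hB
  have hBc : IsCompact B := hL.image T.continuous_proj
  obtain ⟨f, hf, hfc, -, hf01, hf1⟩ := exists_smooth_cutoff (k := n + d) (Y := T.Tot)
    (hBc.image T.smooth_one.continuous) isOpen_univ (Set.subset_univ _)
  have hcont := (μ.smooth f hf hfc).continuous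
  have hpos : ∀ x ∈ B, 0 < ∫ g, f ⟨x, g⟩ ∂(μ.measure x) := by
    intro x hx
    have hfx : Continuous fun g : T.G x => f (T.incl x g) :=
      hf.continuous.comp (T.isClosedEmbedding_incl x).continuous
    refine hfx.integral_pos_of_hasCompactSupport_nonneg_nonzero
      (hfc.comp_isClosedEmbedding (T.isClosedEmbedding_incl x)) (fun g => (hf01 _).1) (x := 1) ?_
    have : f (T.incl x 1) = 1 := hf1.self_of_nhdsSet _ ⟨x, hx, rfl⟩
    exact this.trans_ne one_ne_zero
  obtain ⟨δ, hδ, hδB⟩ : ∃ δ : ℝ, 0 < δ ∧ ∀ x ∈ B, δ ≤ ∫ g, f ⟨x, g⟩ ∂(μ.measure x) := by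
    rcases B.eq_empty_or_nonempty with h | h
    · exact ⟨1, one_pos, by simp [h]⟩
    · obtain ⟨x₀, hx₀, hmin⟩ := hBc.exists_isMinOn h hcont.continuousOn
      exact ⟨_, hpos x₀ hx₀, fun x hx => hmin hx⟩
  -- For `g` in `L`, `w(g)² ∫ f = ∫ f(h g) dh`. The integrand is at most `1` and vanishes off `supp
  -- f · g⁻¹ ⊆ L'`, while `∫ f ≥ δ` because `f = 1` at the units over `B`.
  obtain ⟨L', hL', hmul⟩ := exists_isCompact_mul_inv (T := T) hfc hL
  obtain ⟨c, hc⟩ := μ.exists_measure_le hL'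
  refine ⟨NNReal.sqrt (c / δ.toNNReal), fun x g hg => ?_⟩
  rw [NNReal.le_sqrt_iff_sq_le, le_div_iff₀ (Real.toNNReal_pos.2 hδ)]
  have hmeas : MeasurableSet (T.incl x ⁻¹' L') :=
    (hL'.isClosed.preimage (T.isClosedEmbedding_incl x).continuous).measurableSet
  have h1 : ENNReal.ofReal δ ≤ ∫⁻ h, ENNReal.ofReal (f (T.incl x h)) ∂(μ.measure x) := by
    rw [← ofReal_integral_eq_lintegral_ofReal (μ.integrable hf.continuous hfc x)
          (Filter.Eventually.of_forall fun g => (hf01 _).1)]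
    exact ENNReal.ofReal_le_ofReal (hδB x ⟨_, hg, rfl⟩)
  have h2 := lintegral_mul_right (μ.measure x) (fun h => ENNReal.ofReal (f (T.incl x h))) g
  have h3 : ∫⁻ h, ENNReal.ofReal (f (T.incl x (h * g))) ∂(μ.measure x) ≤ c := by
    refine le_trans ?_ (hc x)
    rw [← lintegral_indicator_one hmeas]
    refine lintegral_mono fun h => ?_
    by_cases hh : f (T.incl x (h * g)) = 0
    · simp [hh]
    · have h4 := hmul x (h * g) g (subset_tsupport _ hh) hg
      rw [mul_inv_cancel_right] at h4
      have h5 : h ∈ T.incl x ⁻¹' L' := h4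
      simp [h5, (hf01 _).2]
  have h4 : (modularWeight g : ℝ≥0∞) ^ 2 * ENNReal.ofReal δ ≤ c :=
    (mul_le_mul_right h1 _).trans (h2.symm.le.trans h3)
  rw [← ENNReal.coe_pow, ENNReal.ofReal, ← ENNReal.coe_mul] at h4
  exact ENNReal.coe_le_coe.1 h4

/-- The weighted Haar measures are locally uniformly bounded. -/
lemma SmoothHaarSystem.exists_lintegral_le {L : Set T.Tot} (hL : IsCompact L) :
    ∃ c : NNReal, ∀ x (f : T.G x → ℝ≥0∞) (b : NNReal), (∀ g, f g ≤ b) →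
      (∀ g, f g ≠ 0 → T.incl x g ∈ L) →
      ∫⁻ g, f g * modularWeight g ∂(μ.measure x) ≤ b * c := by
  obtain ⟨c, hc⟩ := μ.exists_measure_le hL
  obtain ⟨c', hc'⟩ := μ.exists_modularWeight_le hL
  refine ⟨c' * c, fun x f b hb hf => ?_⟩
  have hmeas : MeasurableSet (T.incl x ⁻¹' L) :=
    (hL.isClosed.preimage (T.isClosedEmbedding_incl x).continuous).measurableSet
  calc ∫⁻ g, f g * modularWeight g ∂(μ.measure x)
      ≤ ∫⁻ g, (b * c') * (T.incl x ⁻¹' L).indicator 1 g ∂(μ.measure x) := by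
        refine lintegral_mono fun g => ?_
        by_cases hg : f g = 0
        · simp [hg]
        · have h1 : g ∈ T.incl x ⁻¹' L := hf g hg
          have h2 := hc' x g h1
          simp only [h1, Set.indicator_of_mem, Pi.one_apply, mul_one]
          exact mul_le_mul' (hb g) (by exact_mod_cast h2)
    _ = (b * c') * μ.measure x (T.incl x ⁻¹' L) := by
        rw [lintegral_const_mul _ (measurable_one.indicator hmeas), lintegral_indicator_one hmeas]
    _ ≤ (b * c') * c := mul_le_mul_right (hc x) _
    _ = _ := by rw [ENNReal.coe_mul, mul_assoc]

end Bounds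

/-! ### Sections as operators on square integrable functions -/

section Action

variable [T2Space X] {T : TangentLieStructure.{u, v} n d X} (μ : SmoothHaarSystem T)
  {V : HermitianBundle.{u, v, w} T r}

namespace FibreSections

variable {x : X}

lemma continuous (e : FibreSections V x) : Continuous (e : T.G x → V.Z x) := e.2.1.continuous

lemma hasCompactSupport (e : FibreSections V x) : HasCompactSupport (e : T.G x → V.Z x) := e.2.2.1

lemma exists_lintegral_le (e : FibreSections V x) :
    ∃ N : NNReal, ∫⁻ g, ‖(e : T.G x → V.Z x) g‖ₑ * modularWeight g ∂(μ.measure x) ≤ N := by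
  obtain ⟨c, hc⟩ := μ.exists_lintegral_le
    ((hasCompactSupport e).image (T.isClosedEmbedding_incl x).continuous)
  obtain ⟨b, hb⟩ := (hasCompactSupport e).exists_bound_of_continuous (continuous e)
  refine ⟨b.toNNReal * c, (hc x _ b.toNNReal (fun g => ?_) (fun g hg => ?_)).trans_eq (by simp)⟩
  · rw [← ofReal_norm]
    exact ENNReal.ofReal_le_ofReal (hb g)
  · exact ⟨g, subset_tsupport _ (by simpa using hg), rfl⟩

lemma memLp (e : FibreSections V x) : MemLp (e : T.G x → V.Z x) 2 (μ.measure x) :=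
  (continuous e).memLp_of_hasCompactSupport (hasCompactSupport e)

/-- Left translation of a section. -/
def translate (a : T.G x) (e : FibreSections V x) : FibreSections V x :=
  ⟨fun g => (e : T.G x → V.Z x) (a * g), e.2.1.comp (contMDiff_mul_left (I := 𝓡 d)),
    (hasCompactSupport e).comp_homeomorph (Homeomorph.mulLeft a), fun g k => by
      simp only [← mul_assoc]
      exact e.2.2.2 _ _⟩

lemma translate_apply (a : T.G x) (e : FibreSections V x) (g : T.G x) :
    (translate a e : T.G x → V.Z x) g = (e : T.G x → V.Z x) (a * g) := rfl

lemma isSchurKernel (e : FibreSections V x) :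
    IsSchurKernel (μ.measure x) (actionKernel (e : T.G x → V.Z x))
      (exists_lintegral_le μ e).choose (fun _ => 1) modularWeight :=
  isSchurKernel_action _ (continuous e) (exists_lintegral_le μ e).choose_spec

/-- The operator `φ ↦ e · φ`. -/
def actionOp (e : FibreSections V x) : L2 ℂ (μ.measure x) →L[ℂ] L2 (V.Z x) (μ.measure x) :=
  (isSchurKernel μ e).toCLM

lemma coeFn_actionOp (e : FibreSections V x) (φ : L2 ℂ (μ.measure x)) :
    (actionOp μ e φ).toFun =ᵐ[μ.measure x] fun h =>
      ∫ g, (φ.toFun g * ((modularWeight g : ℝ) : ℂ)) • (e : T.G x → V.Z x) (g * h)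
        ∂(μ.measure x) := by
  refine ((isSchurKernel μ e).coeFn_toCLM φ).trans (Filter.Eventually.of_forall fun h => ?_)
  refine integral_congr_ae (Filter.Eventually.of_forall fun g => ?_)
  simp only [actionKernel, ContinuousLinearMap.toSpanSingleton_apply, smul_smul]
  rfl

/-- Substitution of `g⁻¹` for `g`: the Jacobian is `w(g)²` and the weight becomes `w(g)⁻¹`. This
identifies the right action of functions with the operator of the kernel `actionKernel`. -/
lemma integral_inv_eq_action (e : FibreSections V x) (φ : L2 ℂ (μ.measure x)) (h : T.G x) :
    ∫ g, (φ.toFun g⁻¹ * (((T.modular x g) ^ (-(1 / 2 : ℝ)) : ℝ) : ℂ)) •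
        (e : T.G x → V.Z x) (g⁻¹ * h) ∂(μ.measure x) =
      ∫ g, (φ.toFun g * ((modularWeight g : ℝ) : ℂ)) • (e : T.G x → V.Z x) (g * h)
        ∂(μ.measure x) := by
  have h1 := integral_inv_eq (μ.measure x)
    (fun g => (φ.toFun g * ((modularWeight g⁻¹ : ℝ) : ℂ)) • (e : T.G x → V.Z x) (g * h))
  simp only [inv_inv] at h1
  simp only [T.modular_rpow]
  rw [h1]
  refine integral_congr_ae (Filter.Eventually.of_forall fun g => ?_)
  have h2 : ((modularWeight g : ℝ) : ℂ) ≠ 0 := by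
    exact_mod_cast modularWeight_ne_zero g
  simp only [modularWeight_inv, NNReal.smul_def, ← Complex.coe_smul, smul_smul]
  congr 1
  push_cast
  field_simp

lemma actionOp_unique {e : FibreSections V x} {φ : L2 ℂ (μ.measure x)}
    {ψ : L2 (V.Z x) (μ.measure x)}
    (h : ψ.toFun =ᵐ[μ.measure x] fun h =>
      ∫ g, (φ.toFun g * ((modularWeight g : ℝ) : ℂ)) • (e : T.G x → V.Z x) (g * h)
        ∂(μ.measure x)) : ψ = actionOp μ e φ :=
  Lp.ext (h.trans (coeFn_actionOp μ e φ).symm)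

/-- The operator is built from some chosen Schur constant but does not depend on it, so every
admissible constant bounds its norm. -/
lemma norm_actionOp_le (e : FibreSections V x) {N : NNReal}
    (hN : ∫⁻ g, ‖(e : T.G x → V.Z x) g‖ₑ * modularWeight g ∂(μ.measure x) ≤ N) :
    ‖actionOp μ e‖ ≤ N := by
  have h := isSchurKernel_action (μ.measure x) (continuous e) hN
  have h1 : actionOp μ e = h.toCLM := by
    ext1 φ
    exact Lp.ext (((isSchurKernel μ e).coeFn_toCLM φ).trans (h.coeFn_toCLM φ).symm)
  rw [h1]
  exact h.norm_toCLM_le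

lemma actionOp_add (e f : FibreSections V x) :
    actionOp μ (e + f) = actionOp μ e + actionOp μ f := by
  ext1 φ
  refine Lp.ext ?_
  filter_upwards [(isSchurKernel μ (e + f)).coeFn_toCLM φ, (isSchurKernel μ e).coeFn_toCLM φ,
    (isSchurKernel μ f).coeFn_toCLM φ, (isSchurKernel μ e).ae_integrable φ,
    (isSchurKernel μ f).ae_integrable φ,
    Lp.coeFn_add ((isSchurKernel μ e).toCLM φ) ((isSchurKernel μ f).toCLM φ)]
    with h h1 h2 h3 h4 h5 h6
  refine h1.trans (Eq.trans ?_ h6.symm)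
  rw [Pi.add_apply, h2, h3, ← integral_add h4 h5]
  refine integral_congr_ae (Filter.Eventually.of_forall fun g => ?_)
  simp [actionKernel]

lemma actionOp_smul (c : ℂ) (e : FibreSections V x) :
    actionOp μ (c • e) = c • actionOp μ e := by
  ext1 φ
  refine Lp.ext ?_
  filter_upwards [(isSchurKernel μ (c • e)).coeFn_toCLM φ, (isSchurKernel μ e).coeFn_toCLM φ,
    Lp.coeFn_smul c ((isSchurKernel μ e).toCLM φ)] with h h1 h2 h3
  refine h1.trans (Eq.trans ?_ h3.symm)
  rw [Pi.smul_apply, h2, ← integral_smul]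
  refine integral_congr_ae (Filter.Eventually.of_forall fun g => ?_)
  simp only [actionKernel, ContinuousLinearMap.toSpanSingleton_apply, Submodule.coe_smul,
    Pi.smul_apply, smul_smul]
  congr 1
  ring

end FibreSections

variable (V) in
/-- The smooth compactly supported sections of the field of bundles `E_x`, as a subspace of the
space of all families of sections. -/
def smoothSections : Submodule ℂ (∀ x, FibreSections V x) where
  carrier := {e | IsSmoothSection V e}
  zero_mem' := by
    refine ⟨fun i => ?_, ?_⟩
    · refine (contMDiffOn_const (c := (0 : EuclideanSpace ℂ (Fin r)))).congr fun p _ => ?_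
      simp
    · simp
  add_mem' := by
    rintro a b ⟨ha, ha'⟩ ⟨hb, hb'⟩
    refine ⟨fun i => ((ha i).add (hb i)).congr fun p _ => ?_, ?_⟩
    · simp
    · refine (ha'.union hb').of_isClosed_subset isClosed_closure ?_
      rw [← closure_union]
      refine closure_mono fun p hp => ?_
      by_contra h
      simp only [Set.mem_union, Set.mem_ofPred_eq, not_or, not_not] at h
      exact hp (by simp [h.1, h.2])
  smul_mem' := by
    rintro c a ⟨ha, ha'⟩
    refine ⟨fun i => ?_, ?_⟩
    · refine (((c • ContinuousLinearMap.id ℂ (EuclideanSpace ℂ (Fin r))).restrictScalars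
        ℝ).contMDiff.comp_contMDiffOn (ha i)).congr fun p _ => ?_
      simp
    · refine ha'.of_isClosed_subset isClosed_closure (closure_mono fun p hp => ?_)
      intro h
      exact hp (by simp [h])

variable (V) in
/-- The space of smooth compactly supported sections of the field of bundles `E_x`. -/
def SmoothSections : Type (max u v w) := smoothSections V

instance : AddCommGroup (SmoothSections V) := inferInstanceAs (AddCommGroup (smoothSections V))

instance : Module ℂ (SmoothSections V) := inferInstanceAs (Module ℂ (smoothSections V))

namespace SmoothSections

/-- A smooth family of sections. -/
def mk (e : ∀ x, FibreSections V x) (he : IsSmoothSection V e) : SmoothSections V :=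
  Subtype.mk e he

lemma ext_family {e f : SmoothSections V} (h : ∀ x, e.1 x = f.1 x) : e = f :=
  Subtype.ext (funext h)

@[simp] lemma add_val (e f : SmoothSections V) (x : X) : (e + f).1 x = e.1 x + f.1 x := rfl

@[simp] lemma smul_val (c : ℂ) (e : SmoothSections V) (x : X) : (c • e).1 x = c • e.1 x := rfl

end SmoothSections

lemma IsSmoothSection.continuous_norm {e : ∀ x, FibreSections V x} (he : IsSmoothSection V e) :
    Continuous fun p : T.Tot => ‖(e p.proj : T.G p.proj → V.Z p.proj) p.snd‖ := by
  refine continuous_iff_continuousAt.2 fun p => ?_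
  have h1 : {q : T.Tot | q.proj ∈ V.U p.proj} ∈ 𝓝 p :=
    ((V.isOpen_U p.proj).preimage T.continuous_proj).mem_nhds (V.mem_U p.proj)
  have h2 := ((he.1 p.proj).continuousOn.continuousAt h1).norm
  simpa using h2

/-- Sections bounded by a smooth one have uniformly bounded weighted integrals. -/
lemma IsSmoothSection.exists_lintegral_le {e : ∀ x, FibreSections V x}
    (he : IsSmoothSection V e) :
    ∃ N : NNReal, ∀ x,
      ∫⁻ g, ‖(e x : T.G x → V.Z x) g‖ₑ * modularWeight g ∂(μ.measure x) ≤ N := by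
  obtain ⟨c, hc⟩ := μ.exists_lintegral_le he.2
  obtain ⟨b, hb⟩ := he.2.exists_bound_of_continuousOn he.continuous_norm.continuousOn
  refine ⟨b.toNNReal * c, fun x => (hc x _ b.toNNReal (fun g => ?_) (fun g hg => ?_)).trans_eq
    (by simp)⟩
  · by_cases hg : (e x : T.G x → V.Z x) g = 0
    · simp [hg]
    · rw [← ofReal_norm]
      refine ENNReal.ofReal_le_ofReal ?_
      have := hb ⟨x, g⟩ (subset_closure hg)
      rwa [norm_norm] at this
  · exact subset_closure (show (e x : T.G x → V.Z x) g ≠ 0 by simpa using hg)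

lemma IsSmoothSection.exists_norm_actionOp_le {e : ∀ x, FibreSections V x}
    (he : IsSmoothSection V e) : ∃ c, ∀ x, ‖FibreSections.actionOp μ (e x)‖ ≤ c := by
  obtain ⟨N, hN⟩ := he.exists_lintegral_le μ
  exact ⟨N, fun x => FibreSections.norm_actionOp_le μ (e x) (hN x)⟩

lemma represents_iff {e : ∀ x, FibreSections V x}
    {u : OperatorFields (fun x => L2 ℂ (μ.measure x)) (fun x => L2 (V.Z x) (μ.measure x))} :
    Represents V μ e u ↔ ∀ x, u.op x = FibreSections.actionOp μ (e x) := by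
  simp only [Represents, FibreSections.integral_inv_eq_action]
  constructor
  · intro h x
    ext1 φ
    exact FibreSections.actionOp_unique μ (h x φ)
  · intro h x φ
    rw [h x]
    exact FibreSections.coeFn_actionOp μ (e x) φ

variable (V) in
/-- Smooth compactly supported sections as elements of the Hilbert module. -/
def toHilbertModule : SmoothSections V →ₗ[ℂ] hilbertModule V μ where
  toFun e := ⟨OperatorFields.ofBounded (fun x => (FibreSections.actionOp μ (e.1 x)))
      (IsSmoothSection.exists_norm_actionOp_le μ e.2),
    Submodule.le_topologicalClosure _ (Submodule.subset_span ⟨e.1, e.2,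
      (represents_iff μ).2 fun x => OperatorFields.op_ofBounded _ _ _⟩)⟩
  map_add' a b := Subtype.ext (OperatorFields.ext_op fun x => by
    simp [OperatorFields.op_ofBounded, FibreSections.actionOp_add])
  map_smul' c a := Subtype.ext (OperatorFields.ext_op fun x => by
    simp [OperatorFields.op_ofBounded, FibreSections.actionOp_smul])

lemma op_toHilbertModule (e : SmoothSections V) (x : X) :
    (toHilbertModule μ V e).1.op x = FibreSections.actionOp μ (e.1 x) :=
  rfl

lemma represents_toHilbertModule (e : SmoothSections V) :
    Represents V μ e.1 (toHilbertModule μ V e).1 :=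
  (represents_iff μ).2 (op_toHilbertModule μ e)

lemma eq_toHilbertModule {e : SmoothSections V} {u : hilbertModule V μ}
    (h : Represents V μ e.1 u.1) : u = toHilbertModule μ V e :=
  Subtype.ext (OperatorFields.ext_op fun x => by
    intro φ
    rw [op_toHilbertModule, (represents_iff μ).1 h])

instance : CompleteSpace (hilbertModule V μ) :=
  (Submodule.isClosed_topologicalClosure _).completeSpace_coe

lemma denseRange_toHilbertModule : DenseRange (toHilbertModule μ V) := by
  intro u
  have h1 : (Submodule.span ℂ {u | ∃ e : ∀ x, FibreSections V x,
      IsSmoothSection V e ∧ Represents V μ e u}) ≤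
      (LinearMap.range (toHilbertModule μ V)).map (hilbertModule V μ).subtype := by
    refine Submodule.span_le.2 ?_
    rintro u ⟨e, he, hu⟩
    have hmem : u ∈ hilbertModule V μ :=
      Submodule.le_topologicalClosure _ (Submodule.subset_span ⟨e, he, hu⟩)
    exact ⟨⟨u, hmem⟩, ⟨.mk e he, (eq_toHilbertModule μ (e := .mk e he) (u := ⟨u, hmem⟩) hu).symm⟩,
      rfl⟩
  rw [closure_subtype]
  refine closure_mono ?_ u.2
  refine Set.Subset.trans (SetLike.coe_subset_coe.2 h1) ?_
  rintro _ ⟨v, ⟨e, rfl⟩, rfl⟩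
  exact ⟨_, ⟨e, rfl⟩, rfl⟩

/-- A smooth family of operators as an operator on the smooth sections. -/
def onSections (F : OperatorFamily V) (hF : IsSmoothFamily F) :
    SmoothSections V →ₗ[ℂ] SmoothSections V where
  toFun e := .mk (fun x => F x (e.1 x)) (hF e.1 e.2)
  map_add' a b := SmoothSections.ext_family fun x => map_add (F x) (a.1 x) (b.1 x)
  map_smul' c a := SmoothSections.ext_family fun x => map_smul (F x) c (a.1 x)

/-- The represented pairs already form a linear space, the image of the smooth sections. This places
`D` in the setting of operators on a core. -/
lemma closureGraph_eq (D : OperatorFamily V) (hD : IsSmoothFamily D) :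
    closureGraph μ D = coreGraph (toHilbertModule μ V) (onSections D hD) := by
  rw [closureGraph, coreGraph]
  congr 1
  refine le_antisymm (Submodule.span_le.2 ?_) ?_
  · rintro ⟨u, v⟩ ⟨e, he, hu, hv⟩
    refine ⟨.mk e he, Prod.ext ?_ ?_⟩
    · exact (eq_toHilbertModule μ (e := .mk e he) hu).symm
    · exact (eq_toHilbertModule μ (e := .mk _ (hD e he)) hv).symm
  · rintro _ ⟨e, rfl⟩
    exact Submodule.subset_span ⟨e.1, e.2, represents_toHilbertModule μ e,
      represents_toHilbertModule μ (onSections D hD e)⟩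

end Action

/-! ### Left-invariant operators, formal adjoints and convolutions -/

section Fibre

variable [T2Space X] {T : TangentLieStructure.{u, v} n d X} (μ : SmoothHaarSystem T)
  {V : HermitianBundle.{u, v, w} T r} {x : X}

namespace FibreSections

/-- Fubini's theorem for the pairing of `e · φ` with a square integrable function. -/
lemma integral_inner_actionOp (e : FibreSections V x) (φ : L2 ℂ (μ.measure x)) {f : T.G x → V.Z x}
    (hf : StronglyMeasurable f) (hf2 : MemLp f 2 (μ.measure x)) :
    ∫ y, inner ℂ (f y) ((actionOp μ e φ).toFun y) ∂(μ.measure x) =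
      ∫ g, (φ.toFun g * ((modularWeight g : ℝ) : ℂ)) *
        ∫ y, inner ℂ (f y) ((translate g e : T.G x → V.Z x) y) ∂(μ.measure x) ∂(μ.measure x) := by
  refine ((isSchurKernel μ e).inner_toCLM φ hf hf2).trans ?_
  refine integral_congr_ae (Filter.Eventually.of_forall fun g => ?_)
  simp only [actionKernel, ContinuousLinearMap.toSpanSingleton_apply, inner_smul_right,
    translate_apply]
  rw [integral_const_mul, integral_const_mul, mul_assoc]
  rfl

/-- After two applications of Fubini, `e` and `f` enter only through the `L²` pairings of their
translates. Operators that commute with translations and are formally adjoint can be moved across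
these pairings, and so become adjoint for the module. -/
lemma inner_actionOp (e f : FibreSections V x) (φ φ' : L2 ℂ (μ.measure x)) :
    inner ℂ (actionOp μ e φ) (actionOp μ f φ') =
      ∫ g, (φ'.toFun g * ((modularWeight g : ℝ) : ℂ)) * starRingEnd ℂ
        (∫ g', (φ.toFun g' * ((modularWeight g' : ℝ) : ℂ)) *
          ∫ y, inner ℂ ((translate g f : T.G x → V.Z x) y) ((translate g' e : T.G x → V.Z x) y)
            ∂(μ.measure x) ∂(μ.measure x)) ∂(μ.measure x) := by
  have h1 : inner ℂ (actionOp μ e φ) (actionOp μ f φ') =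
      ∫ y, inner ℂ ((actionOp μ e φ).toFun y) ((actionOp μ f φ').toFun y) ∂(μ.measure x) := rfl
  refine h1.trans ((integral_inner_actionOp μ f φ' (f := (actionOp μ e φ).toFun)
    (Lp.stronglyMeasurable _) (Lp.memLp _)).trans ?_)
  refine integral_congr_ae (Filter.Eventually.of_forall fun g => ?_)
  simp only
  rw [← integral_inner_actionOp μ e φ (continuous _).stronglyMeasurable (memLp μ _),
    ← integral_conj]
  simp only [inner_conj_symm]

lemma integral_translate (a : T.G x) (e f : FibreSections V x) :
    ∫ y, inner ℂ ((translate a e : T.G x → V.Z x) y) ((translate a f : T.G x → V.Z x) y)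
        ∂(μ.measure x) =
      ∫ y, inner ℂ ((e : T.G x → V.Z x) y) ((f : T.G x → V.Z x) y) ∂(μ.measure x) :=
  integral_mul_left_eq_self (fun y => inner ℂ ((e : T.G x → V.Z x) y) ((f : T.G x → V.Z x) y)) a

lemma translate_translate (a b : T.G x) (e : FibreSections V x) :
    translate a (translate b e) = translate (b * a) e :=
  Subtype.ext (funext fun g => by simp [translate_apply, mul_assoc])

lemma translate_one (e : FibreSections V x) : translate 1 e = e :=
  Subtype.ext (funext fun g => by simp [translate_apply])

lemma integrable_inner (e f : FibreSections V x) :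
    Integrable (fun y => inner ℂ ((e : T.G x → V.Z x) y) ((f : T.G x → V.Z x) y))
      (μ.measure x) := by
  refine ((continuous e).inner (continuous f)).integrable_of_hasCompactSupport
    ((hasCompactSupport e).mono fun y hy h => hy ?_)
  simp only [h, inner_zero_left]

lemma eq_zero_of_integral_inner_self (e : FibreSections V x)
    (h : ∫ y, inner ℂ ((e : T.G x → V.Z x) y) ((e : T.G x → V.Z x) y) ∂(μ.measure x) = 0) :
    e = 0 := by
  by_contra he
  obtain ⟨g, hg⟩ : ∃ g, (e : T.G x → V.Z x) g ≠ 0 := by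
    by_contra! h'
    exact he (Subtype.ext (funext h'))
  have h1 : Continuous fun y => ‖(e : T.G x → V.Z x) y‖ ^ 2 := (continuous e).norm.pow 2
  have h2 : HasCompactSupport fun y => ‖(e : T.G x → V.Z x) y‖ ^ 2 :=
    (hasCompactSupport e).comp_left (g := fun z => ‖z‖ ^ 2) (by simp)
  have h3 := h1.integral_pos_of_hasCompactSupport_nonneg_nonzero (μ := μ.measure x) h2
    (fun y => by positivity) (x := g) (by simpa using hg)
  have h4 : ∀ y, inner ℂ ((e : T.G x → V.Z x) y) ((e : T.G x → V.Z x) y) =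
      ((‖(e : T.G x → V.Z x) y‖ ^ 2 : ℝ) : ℂ) := fun y => by
    rw [inner_self_eq_norm_sq_to_K]
    push_cast
    rfl
  simp only [h4, integral_complex_ofReal] at h
  exact h3.ne' (by exact_mod_cast h)

end FibreSections

lemma IsLeftInvariant.map_translate {F : OperatorFamily V} (hF : IsLeftInvariant F) (a : T.G x)
    (e : FibreSections V x) :
    F x (FibreSections.translate a e) = FibreSections.translate a (F x e) :=
  Subtype.ext (funext fun g => by
    have := hF x a⁻¹ e (FibreSections.translate a e) (fun g => by
      rw [inv_inv, FibreSections.translate_apply]) g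
    rwa [inv_inv] at this)

lemma AreFormallyAdjoint.symm {F F' : OperatorFamily V} (h : AreFormallyAdjoint μ F F') :
    AreFormallyAdjoint μ F' F := fun x e f => by
  have h1 := congrArg (starRingEnd ℂ) (h x f e)
  rw [← integral_conj, ← integral_conj] at h1
  simpa only [inner_conj_symm] using h1.symm

/-- A formal adjoint of a left-invariant family is left-invariant. -/
lemma AreFormallyAdjoint.isLeftInvariant {F F' : OperatorFamily V}
    (h : AreFormallyAdjoint μ F F') (hF : IsLeftInvariant F) : IsLeftInvariant F' := by
  have key : ∀ (x : X) (a : T.G x) (e : FibreSections V x),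
      F' x (FibreSections.translate a e) = FibreSections.translate a (F' x e) := by
    intro x a e
    have h1 : ∀ f : FibreSections V x,
        ∫ y, inner ℂ ((f : T.G x → V.Z x) y)
          ((F' x (FibreSections.translate a e) : T.G x → V.Z x) y) ∂(μ.measure x) =
        ∫ y, inner ℂ ((f : T.G x → V.Z x) y)
          ((FibreSections.translate a (F' x e) : T.G x → V.Z x) y) ∂(μ.measure x) := by
      intro f
      have hf : f = FibreSections.translate a (FibreSections.translate a⁻¹ f) := by
        rw [FibreSections.translate_translate, inv_mul_cancel, FibreSections.translate_one]
      rw [← h, hf, hF.map_translate, FibreSections.integral_translate, h,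
        ← FibreSections.integral_translate μ a]
    refine sub_eq_zero.1 (FibreSections.eq_zero_of_integral_inner_self μ _ ?_)
    set w := F' x (FibreSections.translate a e) - FibreSections.translate a (F' x e)
    have h2 := h1 w
    rw [← sub_eq_zero, ← integral_sub] at h2
    · simp only [← inner_sub_right] at h2
      exact h2
    · exact FibreSections.integrable_inner μ _ _
    · exact FibreSections.integrable_inner μ _ _
  intro x a e e' he g
  have h1 : e' = FibreSections.translate a⁻¹ e := Subtype.ext (funext he)
  rw [h1, key]
  rfl

lemma AreFormallyAdjoint.inner_actionOp {F F' : OperatorFamily V}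
    (h : AreFormallyAdjoint μ F F') (hF : IsLeftInvariant F) (e f : FibreSections V x)
    (φ φ' : L2 ℂ (μ.measure x)) :
    inner ℂ (FibreSections.actionOp μ (F x e) φ) (FibreSections.actionOp μ f φ') =
      inner ℂ (FibreSections.actionOp μ e φ) (FibreSections.actionOp μ (F' x f) φ') := by
  rw [FibreSections.inner_actionOp, FibreSections.inner_actionOp]
  simp only [← hF.map_translate, ← (h.isLeftInvariant μ hF).map_translate, h.symm μ x]

/-- The convolution kernel `κ` with `κ (g⁻¹) z = s z g`. -/
def kernelOf (s : V.Z x →ₗ[ℂ] FibreSections V x) (g : T.G x) : V.Z x →L[ℂ] V.Z x :=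
  LinearMap.toContinuousLinearMap
    { toFun := fun z => (s z : T.G x → V.Z x) g⁻¹
      map_add' := fun a b => by simp
      map_smul' := fun c a => by simp }

lemma kernelOf_apply (s : V.Z x →ₗ[ℂ] FibreSections V x) (g : T.G x) (z : V.Z x) :
    kernelOf s g z = (s z : T.G x → V.Z x) g⁻¹ := rfl

lemma continuous_kernelOf (s : V.Z x →ₗ[ℂ] FibreSections V x) : Continuous (kernelOf s) :=
  continuous_clm_apply.2 fun z => (FibreSections.continuous (s z)).comp continuous_inv

lemma eq_sum_frame {E : Type*} [NormedAddCommGroup E] [InnerProductSpace ℂ E]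
    (b : EuclideanSpace ℂ (Fin r) ≃ₗᵢ[ℂ] E) (z : E) :
    z = ∑ j, (b.symm z) j • b (EuclideanSpace.single j 1) := by
  conv_lhs => rw [← b.apply_symm_apply z, ← (EuclideanSpace.basisFun (Fin r) ℂ).sum_repr
    (b.symm z)]
  simp

lemma enorm_le_sum_frame {E : Type*} [NormedAddCommGroup E] [InnerProductSpace ℂ E]
    (b : EuclideanSpace ℂ (Fin r) ≃ₗᵢ[ℂ] E) (A : E →L[ℂ] E) :
    ‖A‖ₑ ≤ ∑ j, ‖A (b (EuclideanSpace.single j 1))‖ₑ := by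
  have h1 : ‖A‖ ≤ ∑ j, ‖A (b (EuclideanSpace.single j 1))‖ := by
    refine A.opNorm_le_bound (Finset.sum_nonneg fun _ _ => norm_nonneg _) fun z => ?_
    calc ‖A z‖ = ‖∑ j, (b.symm z) j • A (b (EuclideanSpace.single j 1))‖ := by
          conv_lhs => rw [eq_sum_frame b z]
          simp
      _ ≤ ∑ j, ‖z‖ * ‖A (b (EuclideanSpace.single j 1))‖ := by
          refine (norm_sum_le _ _).trans (Finset.sum_le_sum fun j _ => ?_)
          rw [norm_smul]
          refine mul_le_mul_of_nonneg_right ?_ (norm_nonneg _)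
          rw [← b.symm.norm_map z]
          exact PiLp.norm_apply_le _ _
      _ = _ := by rw [← Finset.mul_sum, mul_comm]
  rw [← ofReal_norm]
  refine (ENNReal.ofReal_le_ofReal h1).trans_eq ?_
  rw [ENNReal.ofReal_sum_of_nonneg fun _ _ => norm_nonneg _]
  simp only [ofReal_norm]

/-- Inversion invariance of `w dg` removes the inverse in the kernel, and the norm of an operator is
at most the sum of its norms on an orthonormal frame. -/
lemma lintegral_kernelOf_le (s : V.Z x →ₗ[ℂ] FibreSections V x)
    (b : EuclideanSpace ℂ (Fin r) ≃ₗᵢ[ℂ] V.Z x) :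
    ∫⁻ g, ‖kernelOf s g‖ₑ * modularWeight g ∂(μ.measure x) ≤
      ∑ j, ∫⁻ g, ‖(s (b (EuclideanSpace.single j 1)) : T.G x → V.Z x) g‖ₑ * modularWeight g
        ∂(μ.measure x) := by
  have h1 := lintegral_inv_mul_modularWeight (μ.measure x) (f := fun g => ‖kernelOf s g‖ₑ)
    (continuous_kernelOf s).enorm.measurable
  rw [← h1, ← lintegral_finsetSum]
  · refine lintegral_mono fun g => ?_
    rw [← Finset.sum_mul]
    refine mul_le_mul_left ((enorm_le_sum_frame b _).trans_eq ?_) _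
    simp [kernelOf_apply]
  · intro j _
    exact (FibreSections.continuous _).enorm.measurable.mul
      measurable_modularWeight.coe_nnreal_ennreal

lemma exists_lintegral_kernelOf_le (s : V.Z x →ₗ[ℂ] FibreSections V x) :
    ∃ N : NNReal, ∫⁻ g, ‖kernelOf s g‖ₑ * modularWeight g ∂(μ.measure x) ≤ N := by
  choose N hN using fun j => FibreSections.exists_lintegral_le μ
    (s (V.frame x x (EuclideanSpace.single j 1)))
  refine ⟨∑ j, N j, (lintegral_kernelOf_le μ s (V.frame x x)).trans ?_⟩
  push_cast
  exact Finset.sum_le_sum fun j _ => hN j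

/-- If `A` is the convolution operator with the kernel given by `s`, and `D` is symmetric and
left-invariant, then `D A` is bounded by the norm of the convolution kernel given by `D s`. -/
lemma norm_actionOp_comp_le {D : OperatorFamily V} (hD : AreFormallyAdjoint μ D D)
    (hD' : IsLeftInvariant D) (s : V.Z x →ₗ[ℂ] FibreSections V x)
    {A : FibreSections V x →ₗ[ℂ] FibreSections V x}
    (hA : ∀ e g, (A e : T.G x → V.Z x) g =
      ∫ h, kernelOf s h ((e : T.G x → V.Z x) (g * h)) ∂(μ.measure x))
    {N : NNReal}
    (hN : ∫⁻ g, ‖kernelOf (D x ∘ₗ s) g‖ₑ * modularWeight g ∂(μ.measure x) ≤ N)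
    (e : FibreSections V x) (φ : L2 ℂ (μ.measure x)) :
    ‖FibreSections.actionOp μ (D x (A e)) φ‖ ≤ N * ‖FibreSections.actionOp μ e φ‖ := by
  obtain ⟨N₀, hN₀⟩ := exists_lintegral_kernelOf_le μ s
  have k₀ := isSchurKernel_conv (μ.measure x) (continuous_kernelOf s) hN₀
  have k := isSchurKernel_conv (μ.measure x) (continuous_kernelOf (D x ∘ₗ s)) hN
  -- Associativity: right convolution with the kernel commutes with the action of functions from the
  -- other side.
  have h1 : k₀.toCLM (FibreSections.actionOp μ e φ) = FibreSections.actionOp μ (A e) φ := by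
    refine (FibreSections.isSchurKernel μ e).toCLM_comp_apply k₀
      (FibreSections.isSchurKernel μ (A e)) (fun y g z => ?_) φ
    simp only [actionKernel, ContinuousLinearMap.toSpanSingleton_apply, hA, map_smul,
      integral_smul, convKernel]
    congr 2
    rw [← integral_mul_left_eq_self (fun t => kernelOf s (y⁻¹ * t) ((e : T.G x → V.Z x) (g * t)))
      y]
    simp [mul_assoc]
  -- Weak form of `D (κ ∗ ψ) = (D κ) ∗ ψ`. After Fubini, symmetry of `D` is applied for each `t` to
  -- a translate of the smooth section `s (ψ t)`; nothing is differentiated under an integral, and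
  -- `ψ` need only be square integrable.
  have h2 : ∀ (f : FibreSections V x) (ψ : Lp (V.Z x) 2 (μ.measure x)),
      ∫ y, inner ℂ ((D x f : T.G x → V.Z x) y) (k₀.toCLM ψ y) ∂(μ.measure x) =
      ∫ y, inner ℂ ((f : T.G x → V.Z x) y) (k.toCLM ψ y) ∂(μ.measure x) := by
    intro f ψ
    rw [k₀.inner_toCLM ψ (FibreSections.continuous _).stronglyMeasurable (FibreSections.memLp μ _),
      k.inner_toCLM ψ (FibreSections.continuous _).stronglyMeasurable (FibreSections.memLp μ _)]
    refine integral_congr_ae (Filter.Eventually.of_forall fun t => ?_)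
    have h3 := hD x f (FibreSections.translate t⁻¹ (s (ψ t)))
    rw [hD'.map_translate] at h3
    simpa [convKernel, kernelOf_apply, FibreSections.translate_apply] using h3
  have h3 : ∀ (f : FibreSections V x) (ψ : L2 (V.Z x) (μ.measure x)),
      inner ℂ (show L2 (V.Z x) (μ.measure x) from k₀.toCLM ψ)
        (FibreSections.actionOp μ (D x f) φ) =
      inner ℂ (show L2 (V.Z x) (μ.measure x) from k.toCLM ψ) (FibreSections.actionOp μ f φ) := by
    intro f ψ
    refine (FibreSections.integral_inner_actionOp μ (D x f) φ
      (Lp.stronglyMeasurable (k₀.toCLM ψ)) (Lp.memLp _)).trans ?_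
    refine Eq.trans ?_ (FibreSections.integral_inner_actionOp μ f φ
      (Lp.stronglyMeasurable (k.toCLM ψ)) (Lp.memLp _)).symm
    refine integral_congr_ae (Filter.Eventually.of_forall fun g => ?_)
    have h4 := congrArg (starRingEnd ℂ) (h2 (FibreSections.translate g f) ψ)
    rw [← integral_conj, ← integral_conj, hD'.map_translate] at h4
    simp only [inner_conj_symm] at h4
    simp only [h4]
  set a := FibreSections.actionOp μ (D x (A e)) φ with ha
  -- Moving one `D` across gives `|a|² = ⟨(A e) · φ, (D D A e) · φ⟩`; the weak identity with `f = D
  -- A e` turns this into `⟨k (e · φ), a⟩`, and one factor `|a|` is cancelled.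
  have h4 : inner ℂ a a =
      inner ℂ (show L2 (V.Z x) (μ.measure x) from k.toCLM (FibreSections.actionOp μ e φ)) a := by
    rw [← h3 (D x (A e)), ha, hD.inner_actionOp μ hD', h1]
  have h5 : ‖(show L2 (V.Z x) (μ.measure x) from k.toCLM (FibreSections.actionOp μ e φ))‖ ≤
      N * ‖FibreSections.actionOp μ e φ‖ :=
    k.toCLM.le_of_opNorm_le k.norm_toCLM_le _
  have h6 : ‖a‖ * ‖a‖ ≤ (N * ‖FibreSections.actionOp μ e φ‖) * ‖a‖ := by
    have h7 : ‖inner ℂ a a‖ = ‖a‖ * ‖a‖ := by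
      rw [inner_self_eq_norm_sq_to_K]
      simp [sq]
    rw [← h7, h4]
    exact (norm_inner_le_norm _ _).trans (mul_le_mul_of_nonneg_right h5 (norm_nonneg _))
  rcases (norm_nonneg a).eq_or_lt with h7 | h7
  · rw [← h7]
    positivity
  · exact le_of_mul_le_mul_right h6 h7

end Fibre

/-! ### Smoothness in frames, and kernels of smoothing families -/

section Smoothness

variable [T2Space X] {T : TangentLieStructure.{u, v} n d X} {V : HermitianBundle.{u, v, w} T r}

/-- A family of sections that is smooth in one frame, over which it is supported, is smooth. -/
lemma isSmoothSection_of_frame {e : ∀ x, FibreSections V x} {i : X} {A : Set X} (hA : IsClosed A)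
    (hAU : A ⊆ V.U i) (he : ∀ x ∉ A, e x = 0)
    (hs : ContMDiffOn (𝓡 (n + d)) 𝓘(ℝ, EuclideanSpace ℂ (Fin r)) ∞
      (fun p : T.Tot => (V.frame i p.proj).symm ((e p.proj : T.G p.proj → V.Z p.proj) p.snd))
      {p | p.proj ∈ V.U i})
    (hc : IsCompact (closure {p : T.Tot | (e p.proj : T.G p.proj → V.Z p.proj) p.snd ≠ 0})) :
    IsSmoothSection V e := by
  refine ⟨fun j p hp => ?_, hc⟩
  -- Over `U i` the section is expanded in the frame `i` and the frames are changed smoothly. Off `U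
  -- i` it vanishes near `p`, because `A` is closed and contained in `U i`.
  by_cases hpi : p.proj ∈ V.U i
  · have hW : {q : T.Tot | q.proj ∈ V.U i ∩ V.U j} ∈ 𝓝 p :=
      (((V.isOpen_U i).inter (V.isOpen_U j)).preimage T.continuous_proj).mem_nhds ⟨hpi, hp⟩
    refine ContMDiffWithinAt.mono_of_mem_nhdsWithin (s := {q : T.Tot | q.proj ∈ V.U i ∩ V.U j})
      ?_ (nhdsWithin_le_nhds hW)
    have h1 : ContMDiffOn (𝓡 (n + d)) 𝓘(ℝ, EuclideanSpace ℂ (Fin r)) ∞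
        (fun q : T.Tot => ∑ k, ((V.frame i q.proj).symm
          ((e q.proj : T.G q.proj → V.Z q.proj) q.snd)) k •
            (V.frame j q.proj).symm (V.frame i q.proj (EuclideanSpace.single k 1)))
        {q : T.Tot | q.proj ∈ V.U i ∩ V.U j} := by
      refine contMDiffOn_finsetSum fun k _ => ?_
      have h2 : ContMDiffOn (𝓡 (n + d)) 𝓘(ℝ, ℂ) ∞ (fun q : T.Tot => ((V.frame i q.proj).symm
          ((e q.proj : T.G q.proj → V.Z q.proj) q.snd)) k)
          {q : T.Tot | q.proj ∈ V.U i ∩ V.U j} :=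
        (((EuclideanSpace.proj (𝕜 := ℂ) k).restrictScalars ℝ).contMDiff.comp_contMDiffOn hs).mono
          fun q hq => hq.1
      have h3 : ContMDiffOn (𝓡 (n + d)) 𝓘(ℝ, EuclideanSpace ℂ (Fin r)) ∞
          (fun q : T.Tot => (V.frame j q.proj).symm
            (V.frame i q.proj (EuclideanSpace.single k 1)))
          {q : T.Tot | q.proj ∈ V.U i ∩ V.U j} :=
        (V.smooth_frame i j (EuclideanSpace.single k 1)).comp
          T.submersion_proj.contMDiff.contMDiffOn fun q hq => hq
      have h4 := (ContinuousLinearMap.lsmul ℝ ℂ :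
        ℂ →L[ℝ] EuclideanSpace ℂ (Fin r) →L[ℝ] _).isBoundedBilinearMap.contDiff (n := ∞)
      exact h4.contMDiff.comp_contMDiffOn (h2.prodMk_space h3)
    refine h1.congr (fun q _ => ?_) p ⟨hpi, hp⟩
    conv_lhs => rw [eq_sum_frame (V.frame i q.proj) ((e q.proj : T.G q.proj → V.Z q.proj) q.snd)]
    simp only [map_sum, map_smul]
  · have hW : {q : T.Tot | q.proj ∈ Aᶜ} ∈ 𝓝 p :=
      (hA.isOpen_compl.preimage T.continuous_proj).mem_nhds fun h => hpi (hAU h)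
    refine (contMDiffWithinAt_const (c := (0 : EuclideanSpace ℂ (Fin r)))).congr_of_eventuallyEq
      (f := _) (Filter.mem_of_superset (mem_nhdsWithin_of_mem_nhds hW) fun q hq => ?_) ?_
    · have : e q.proj = 0 := he _ hq
      simp [this]
    · have : e p.proj = 0 := he _ fun h => hpi (hAU h)
      simp [this]

lemma frame_symm_ofReal_smul (i x : X) (a : ℝ) (z : V.Z x) :
    (V.frame i x).symm ((a : ℂ) • z) = a • (V.frame i x).symm z := by
  rw [map_smul, Complex.coe_smul]

/-- Multiplication by a smooth function on `X`. -/
def mulFunction (χ : X → ℝ) (hχ : ContMDiff (𝓡 n) 𝓘(ℝ, ℝ) ∞ χ) :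
    SmoothSections V →ₗ[ℂ] SmoothSections V where
  toFun e := .mk (fun x => (χ x : ℂ) • e.1 x) ⟨fun i => by
      have h1 : ContMDiffOn (𝓡 (n + d)) 𝓘(ℝ, ℝ) ∞ (fun p : T.Tot => χ p.proj)
          {p | p.proj ∈ V.U i} := (hχ.comp T.submersion_proj.contMDiff).contMDiffOn
      refine (h1.smul (e.2.1 i)).congr fun p _ => ?_
      exact frame_symm_ofReal_smul i p.proj _ _,
    e.2.2.of_isClosed_subset isClosed_closure (closure_mono fun p hp h => hp (by simp [h]))⟩
  map_add' a b := SmoothSections.ext_family fun x => smul_add (χ x : ℂ) (a.1 x) (b.1 x)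
  map_smul' c a := SmoothSections.ext_family fun x => smul_comm (χ x : ℂ) c (a.1 x)

/-- The formula `g ↦ κ(g⁻¹) z` for the kernel `κ` of a smoothing family defines a section. -/
lemma exists_kernelOf_eq {κ : ∀ x, T.G x → (V.Z x →L[ℂ] V.Z x)}
    (hκ : ∀ (i : X) (z : EuclideanSpace ℂ (Fin r)),
      ContMDiffOn (𝓡 (n + d)) 𝓘(ℝ, EuclideanSpace ℂ (Fin r)) ∞
        (fun p : T.Tot => (V.frame i p.proj).symm (κ p.proj p.snd (V.frame i p.proj z)))
        {p | p.proj ∈ V.U i})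
    (hc : ∀ L : Set X, IsCompact L →
      IsCompact (closure {p : T.Tot | p.proj ∈ L ∧ κ p.proj p.snd ≠ 0}))
    (hK : ∀ (x : X) (k k' : T.K x) (h : T.G x) (z : V.Z x),
      κ x (k * h * k') z = V.act x k (κ x h (V.act x k' z))) :
    ∃ s : ∀ x, V.Z x →ₗ[ℂ] FibreSections V x, ∀ x, kernelOf (s x) = κ x := by
  have hmem : ∀ x z, (fun g : T.G x => κ x g⁻¹ z) ∈ FibreSections V x := by
    intro x z
    refine ⟨?_, ?_, fun g k => ?_⟩
    · have h1 : ContMDiff (𝓡 d) 𝓘(ℝ, EuclideanSpace ℂ (Fin r)) ∞ fun g : T.G x =>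
          (V.frame x x).symm (κ x g⁻¹ (V.frame x x ((V.frame x x).symm z))) :=
        ((hκ x ((V.frame x x).symm z)).comp_contMDiff (T.contMDiff_incl x)
          fun g => V.mem_U x).comp (contMDiff_inv (𝓡 d) ∞)
      have h2 : ContMDiff 𝓘(ℝ, EuclideanSpace ℂ (Fin r)) 𝓘(ℝ, V.Z x) ∞ (V.frame x x) :=
        ((V.frame x x).toContinuousLinearEquiv.toContinuousLinearMap.restrictScalars ℝ).contMDiff
      refine (h2.comp h1).congr fun g => ?_
      simp
    · have h1 : IsCompact (T.incl x ⁻¹'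
          closure {p : T.Tot | p.proj ∈ ({x} : Set X) ∧ κ p.proj p.snd ≠ 0}) :=
        (T.isClosedEmbedding_incl x).isCompact_preimage (hc {x} isCompact_singleton)
      refine HasCompactSupport.intro h1.inv fun g hg => ?_
      by_contra h
      refine hg (subset_closure ⟨rfl, fun h' => h ?_⟩)
      change κ x g⁻¹ = 0 at h'
      rw [h', zero_apply]
    · have h1 := hK x k⁻¹ 1 g⁻¹ z
      simp only [map_one, Subgroup.coe_one, mul_one] at h1
      simp only [mul_inv_rev]
      rw [← Subgroup.coe_inv, h1, map_inv]
      rfl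
  refine ⟨fun x => { toFun := fun z => ⟨_, hmem x z⟩, map_add' := fun a b => Subtype.ext (by
      funext g
      exact map_add _ _ _), map_smul' := fun c a => Subtype.ext (by
      funext g
      exact map_smul _ _ _) }, fun x => ?_⟩
  ext g z
  rw [kernelOf_apply]
  change κ x g⁻¹⁻¹ z = κ x g z
  rw [inv_inv]

variable (μ : SmoothHaarSystem T)

/-- The weighted integrals of the kernels of `D A`, for a smoothing family `A`, are locally
bounded. -/
lemma eventually_lintegral_kernelOf_le {s : ∀ x, V.Z x →ₗ[ℂ] FibreSections V x}
    (hs : ∀ (i : X) (z : EuclideanSpace ℂ (Fin r)),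
      ContMDiffOn (𝓡 (n + d)) 𝓘(ℝ, EuclideanSpace ℂ (Fin r)) ∞
        (fun p : T.Tot => (V.frame i p.proj).symm
          (kernelOf (s p.proj) p.snd (V.frame i p.proj z)))
        {p | p.proj ∈ V.U i})
    (hc : ∀ L : Set X, IsCompact L →
      IsCompact (closure {p : T.Tot | p.proj ∈ L ∧ kernelOf (s p.proj) p.snd ≠ 0}))
    {D : OperatorFamily V} (hD : IsSmoothFamily D) [SecondCountableTopology X] (x₀ : X) :
    ∃ N : NNReal, ∀ᶠ x in 𝓝 x₀,
      ∫⁻ g, ‖kernelOf (D x ∘ₗ s x) g‖ₑ * modularWeight g ∂(μ.measure x) ≤ N := by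
  obtain ⟨χ, hχ, hχc, hχU, -, hχ1⟩ := exists_smooth_cutoff (k := n) (Y := X)
    (isCompact_singleton (x := x₀)) (V.isOpen_U x₀) (Set.singleton_subset_iff.2 (V.mem_U x₀))
  rw [nhdsSet_singleton] at hχ1
  let b : Fin r → EuclideanSpace ℂ (Fin r) := fun j => EuclideanSpace.single j 1
  -- The kernel applied to a frame and cut off near `x₀` gives finitely many smooth compactly
  -- supported sections. `D` maps them to sections of the same kind, whose weighted integrals are
  -- uniformly bounded, and near `x₀` the cutoff is `1`.
  let e : Fin r → ∀ x, FibreSections V x := fun j x => (χ x : ℂ) • s x (V.frame x₀ x (b j))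
  have he : ∀ j, IsSmoothSection V (e j) := by
    intro j
    refine isSmoothSection_of_frame (i := x₀) (isClosed_tsupport χ) hχU (fun x hx => ?_) ?_ ?_
    · simp only [e, image_eq_zero_of_notMem_tsupport hx, Complex.ofReal_zero, zero_smul]
    · have h1 : ContMDiffOn (𝓡 (n + d)) 𝓘(ℝ, ℝ) ∞ (fun p : T.Tot => χ p.proj)
          {p | p.proj ∈ V.U x₀} := (hχ.comp T.submersion_proj.contMDiff).contMDiffOn
      have h2 := (hs x₀ (b j)).comp (T.smooth_inv.contMDiffOn (s := {p : T.Tot | p.proj ∈ V.U x₀}))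
        fun p hp => hp
      refine (h1.smul h2).congr fun p _ => ?_
      refine (frame_symm_ofReal_smul x₀ p.proj _ _).trans ?_
      simp [kernelOf_apply]
    · refine ((hc _ hχc).image T.smooth_inv.continuous).of_isClosed_subset isClosed_closure
        (closure_minimal (fun p hp => ?_) ((hc _ hχc).image T.smooth_inv.continuous).isClosed)
      refine ⟨⟨p.proj, p.snd⁻¹⟩, subset_closure ⟨?_, fun h => hp ?_⟩, ?_⟩
      · by_contra h
        refine hp ?_
        simp only [e, image_eq_zero_of_notMem_tsupport h, Complex.ofReal_zero, zero_smul]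
        rfl
      · have h1 := congrArg (fun A => A (V.frame x₀ p.proj (b j))) h
        simp only [kernelOf_apply, inv_inv, zero_apply] at h1
        change (χ p.proj : ℂ) • (s p.proj (V.frame x₀ p.proj (b j)) : T.G p.proj → V.Z p.proj)
          p.snd = 0
        rw [h1, smul_zero]
      · simp
  choose N hN using fun j => (hD _ (he j)).exists_lintegral_le μ
  refine ⟨∑ j, N j, hχ1.mono fun x hx => (lintegral_kernelOf_le μ _ (V.frame x₀ x)).trans ?_⟩
  push_cast
  refine Finset.sum_le_sum fun j _ => le_trans (le_of_eq ?_) (hN j x)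
  simp only [e, hx, Complex.ofReal_one, one_smul]
  rfl

lemma exists_lintegral_kernelOf_le_of_isCompact {s : ∀ x, V.Z x →ₗ[ℂ] FibreSections V x}
    (hs : ∀ (i : X) (z : EuclideanSpace ℂ (Fin r)),
      ContMDiffOn (𝓡 (n + d)) 𝓘(ℝ, EuclideanSpace ℂ (Fin r)) ∞
        (fun p : T.Tot => (V.frame i p.proj).symm
          (kernelOf (s p.proj) p.snd (V.frame i p.proj z)))
        {p | p.proj ∈ V.U i})
    (hc : ∀ L : Set X, IsCompact L →
      IsCompact (closure {p : T.Tot | p.proj ∈ L ∧ kernelOf (s p.proj) p.snd ≠ 0}))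
    {D : OperatorFamily V} (hD : IsSmoothFamily D) [SecondCountableTopology X] {L : Set X}
    (hL : IsCompact L) :
    ∃ N : NNReal, ∀ x ∈ L,
      ∫⁻ g, ‖kernelOf (D x ∘ₗ s x) g‖ₑ * modularWeight g ∂(μ.measure x) ≤ N := by
  refine hL.induction_on (p := fun L => ∃ N : NNReal, ∀ x ∈ L,
      ∫⁻ g, ‖kernelOf (D x ∘ₗ s x) g‖ₑ * modularWeight g ∂(μ.measure x) ≤ N)
    ⟨0, by simp⟩ ?_ ?_ ?_
  · rintro A B hAB ⟨N, hN⟩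
    exact ⟨N, fun x hx => hN x (hAB hx)⟩
  · rintro A B ⟨N, hN⟩ ⟨N', hN'⟩
    refine ⟨max N N', fun x hx => ?_⟩
    rcases hx with hx | hx
    · exact (hN x hx).trans (by exact_mod_cast le_max_left _ _)
    · exact (hN' x hx).trans (by exact_mod_cast le_max_right _ _)
  · intro x _
    obtain ⟨N, hN⟩ := eventually_lintegral_kernelOf_le μ hs hc hD x
    exact ⟨_, mem_nhdsWithin_of_mem_nhds hN, N, fun y hy => hy⟩

end Smoothness

/-! ### Regularity of cosymbols with a parametrix -/

section Parametrix

variable [T2Space X] {T : TangentLieStructure.{u, v} n d X} (μ : SmoothHaarSystem T)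
  {V : HermitianBundle.{u, v, w} T r}

lemma AreFormallyAdjoint.areCoreAdjoint {F F' : OperatorFamily V} (h : AreFormallyAdjoint μ F F')
    (hF : IsLeftInvariant F) (sF : IsSmoothFamily F) (sF' : IsSmoothFamily F') :
    AreCoreAdjoint (toHilbertModule μ V) (onSections F sF)
      (onSections F' sF') :=
  fun e f x φ => h.inner_actionOp μ hF (e.1 x) (f.1 x) φ φ

lemma id_sub_onSections_apply {F G : OperatorFamily V} (sF : IsSmoothFamily F)
    (sG : IsSmoothFamily G) (e : SmoothSections V) (x : X) :
    ((LinearMap.id - onSections F sF ∘ₗ onSections G sG : SmoothSections V →ₗ[ℂ] SmoothSections V)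
      e).1 x =
      (LinearMap.id - F x ∘ₗ G x : FibreSections V x →ₗ[ℂ] FibreSections V x) (e.1 x) := by
  rfl

/-- The operator on smooth sections given by a family with a compact closure extends to a compact
operator. -/
lemma ExtendsToCompact.exists_compactOps {F : OperatorFamily V} (h : ExtendsToCompact μ F)
    {f : SmoothSections V →ₗ[ℂ] SmoothSections V} (hf : ∀ e x, (f e).1 x = F x (e.1 x)) :
    ∃ S ∈ compactOps (hilbertModule V μ),
      ∀ e, S (toHilbertModule μ V e) = toHilbertModule μ V (f e) := by
  obtain ⟨S, hS, h⟩ := h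
  refine ⟨S, hS, fun e => h e.1 e.2 _ _ (represents_toHilbertModule μ e) ?_⟩
  have h1 : (fun x => F x (e.1 x)) = (f e).1 := funext fun x => (hf e x).symm
  rw [h1]
  exact represents_toHilbertModule μ (f e)

lemma isCoreBounded_of_extension {f : SmoothSections V →ₗ[ℂ] SmoothSections V}
    {S : Ops (hilbertModule V μ)}
    (hS : ∀ e, S (toHilbertModule μ V e) = toHilbertModule μ V (f e)) :
    IsCoreBounded (toHilbertModule μ V) f :=
  ⟨‖S‖, fun e => by
    rw [← hS]
    exact S.le_opNorm _⟩

/-- If `A` is a smoothing family and `D` is a symmetric cosymbol, then `D A` is bounded over the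
compact subsets of `X`. -/
lemma IsSmoothing.isCoreBounded_mulFunction [SecondCountableTopology X] {D A : OperatorFamily V}
    (hD : IsLeftInvariant D) (sD : IsSmoothFamily D) (hsymm : AreFormallyAdjoint μ D D)
    (hA : IsSmoothing μ A) {f : SmoothSections V →ₗ[ℂ] SmoothSections V}
    (hf : ∀ e x, (f e).1 x = A x (e.1 x)) (χ : X → ℝ) (hχ : ContMDiff (𝓡 n) 𝓘(ℝ, ℝ) ∞ χ)
    (hχc : HasCompactSupport χ) (hχ1 : ∀ x, 0 ≤ χ x ∧ χ x ≤ 1) :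
    IsCoreBounded (toHilbertModule μ V)
      (mulFunction χ hχ ∘ₗ onSections D sD ∘ₗ f) := by
  obtain ⟨κ, hκ, hc, hK, hAκ⟩ := hA
  obtain ⟨s, hs⟩ := exists_kernelOf_eq hκ hc hK
  simp only [← hs] at hκ hc hAκ
  obtain ⟨N, hN⟩ := exists_lintegral_kernelOf_le_of_isCompact μ hκ hc sD hχc
  refine ⟨N, fun e => OperatorFields.norm_le (by positivity) fun x φ => ?_⟩
  have h1 : (toHilbertModule μ V ((mulFunction χ hχ ∘ₗ onSections D sD ∘ₗ f) e)).1.op x φ =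
      (χ x : ℂ) • FibreSections.actionOp μ (D x (A x (e.1 x))) φ := by
    rw [← hf]
    exact congrArg (fun B => B φ) (FibreSections.actionOp_smul μ (χ x : ℂ) (D x ((f e).1 x)))
  refine (congrArg norm h1).trans_le ?_
  by_cases hx : x ∈ tsupport χ
  · have h2 := norm_actionOp_comp_le μ hsymm hD (s x) (hAκ x) (hN x hx) (e.1 x) φ
    have h3 := OperatorFields.norm_op_apply_le (toHilbertModule μ V e).1 x φ
    rw [norm_smul, Complex.norm_real, Real.norm_of_nonneg (hχ1 x).1]
    calc _ ≤ 1 * (N * (‖toHilbertModule μ V e‖ * ‖φ‖)) :=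
          mul_le_mul (hχ1 x).2 (h2.trans (mul_le_mul_of_nonneg_left h3 N.2)) (norm_nonneg _)
            zero_le_one
      _ = _ := by ring
  · rw [image_eq_zero_of_notMem_tsupport hx, Complex.ofReal_zero, zero_smul, norm_zero]
    positivity

/-- Surjectivity of `T ± i` is checked on one smooth section `e` at a time, with a cutoff equal to
`1` over the compact projection of its support. Of the compactness of the closures of `P`, `1 - P D`
and `1 - D P` only boundedness enters here; smoothness of the kernel of `1 - P D` provides the bound
on `D (1 - P D)` over the support of the cutoff. -/
lemma isSelfAdjointRegular_of_parametrix [SecondCountableTopology X] {D P : OperatorFamily V}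
    (hD : IsCosymbol D) (hsymm : AreFormallyAdjoint μ D D) (hP : IsCosymbolParametrix μ D P) :
    IsSelfAdjointRegular (closureGraph μ D) := by
  rw [closureGraph_eq μ D hD.smooth]
  have hDadj := hsymm.areCoreAdjoint μ hD.leftInvariant hD.smooth hD.smooth
  refine isSelfAdjointRegular_coreGraph (denseRange_toHilbertModule μ) hDadj
    fun ζ hζ hζ1 e => ?_
  obtain ⟨P', sP', hPP'⟩ := hP.adjoint
  obtain ⟨_, -, hp⟩ := hP.compact.exists_compactOps μ (f := onSections P hP.smooth)
    fun _ _ => rfl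
  obtain ⟨_, -, hr⟩ := hP.compact_left.exists_compactOps μ
    (f := LinearMap.id - onSections P hP.smooth ∘ₗ onSections D hD.smooth)
    (id_sub_onSections_apply _ _)
  obtain ⟨_, -, hs⟩ := hP.compact_right.exists_compactOps μ
    (f := LinearMap.id - onSections D hD.smooth ∘ₗ onSections P hP.smooth)
    (id_sub_onSections_apply _ _)
  obtain ⟨χ, hχ, hχc, -, hχ01, hχ1⟩ := exists_smooth_cutoff (k := n) (Y := X)
    (e.2.2.image T.continuous_proj) isOpen_univ (Set.subset_univ _)
  refine exists_add_smul_eq_of_parametrix (denseRange_toHilbertModule μ) hDadj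
    (hPP'.areCoreAdjoint μ hP.leftInvariant hP.smooth sP')
    (isCoreBounded_of_extension μ hp) (isCoreBounded_of_extension μ hr)
    (isCoreBounded_of_extension μ hs) (m := mulFunction χ hχ) (χ := χ) (fun f x φ => ?_) hχ01
    (fun x hx φ => ?_) (fun f => ?_) (fun f => ?_)
    (hP.smoothing_left.isCoreBounded_mulFunction μ hD.leftInvariant hD.smooth hsymm
      (id_sub_onSections_apply _ _) χ hχ hχc hχ01) hζ hζ1
  · exact congrArg (fun B => B φ) (FibreSections.actionOp_smul μ (χ x : ℂ) (f.1 x))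
  · have h1 : e.1 x = 0 := by
      refine Subtype.ext (funext fun g => ?_)
      by_contra h
      exact hx (hχ1.self_of_nhdsSet x ⟨⟨x, g⟩, subset_closure h, rfl⟩)
    have h2 : FibreSections.actionOp μ (0 : FibreSections V x) = 0 := by
      have := FibreSections.actionOp_smul μ (0 : ℂ) (0 : FibreSections V x)
      rwa [zero_smul, zero_smul] at this
    rw [ev_apply, op_toHilbertModule, h1, h2, zero_apply]
  · exact SmoothSections.ext_family (fun x => map_smul (D x) (χ x : ℂ) (f.1 x))
  · exact SmoothSections.ext_family (fun x => map_smul (P' x) (χ x : ℂ) (f.1 x))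

/-- A parametrix inverts the closure of `D` up to compact operators. -/
lemma exists_compactOps_of_parametrix {D P : OperatorFamily V} (hD : IsSmoothFamily D)
    (hP : IsCosymbolParametrix μ D P) :
    ∃ p ∈ compactOps (hilbertModule V μ), ∃ r ∈ compactOps (hilbertModule V μ),
      ∀ u v, (u, v) ∈ closureGraph μ D → u = p v + r u := by
  obtain ⟨p, hp, hpe⟩ := hP.compact.exists_compactOps μ (f := onSections P hP.smooth)
    fun _ _ => rfl
  obtain ⟨r, hr, hre⟩ := hP.compact_left.exists_compactOps μ
    (f := LinearMap.id - onSections P hP.smooth ∘ₗ onSections D hD)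
    (id_sub_onSections_apply _ _)
  refine ⟨p, hp, r, hr, fun u v huv => ?_⟩
  rw [closureGraph_eq μ D hD] at huv
  refine coreGraph_induction (P := fun u v => u = p v + r u) (isClosed_eq continuous_fst
    ((p.continuous.comp continuous_snd).add (r.continuous.comp continuous_fst))) (fun e => ?_) huv
  rw [hpe, hre, ← map_add]
  congr 1
  rw [LinearMap.sub_apply, LinearMap.id_apply, LinearMap.comp_apply, add_sub_cancel]

end Parametrix

end CoarsePDO

end

open CoarsePDO in
theorem proposition9p3 {n d r : ℕ} {X : Type*} [TopologicalSpace X]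
    [ChartedSpace (EuclideanSpace ℝ (Fin n)) X] [IsManifold (𝓡 n) ∞ X]
    [T2Space X] [SecondCountableTopology X]
    (T : TangentLieStructure n d X) (μ : SmoothHaarSystem T) (V : HermitianBundle T r)
    (D : OperatorFamily V) (hD : IsCosymbol D)
    (hsymm : AreFormallyAdjoint μ D D)
    (hP : ∃ P : OperatorFamily V, IsCosymbolParametrix μ D P) :
    IsOperatorGraph (closureGraph μ D) ∧
    ∃ σ : Ops (hilbertModule V μ),
      IsBoundedTransform (closureGraph μ D) σ ∧
      (∀ σ' : Ops (hilbertModule V μ),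
        IsBoundedTransform (closureGraph μ D) σ' → σ' = σ) ∧
      IsAdjointable σ ∧
      ContinuousLinearMap.id ℂ _ - σ.comp σ ∈
        compactOps (hilbertModule V μ) := by
  obtain ⟨P, hP⟩ := hP
  have hT := isSelfAdjointRegular_of_parametrix μ hD hsymm hP
  obtain ⟨p, hp, r, hr, hpr⟩ := exists_compactOps_of_parametrix μ hD.smooth hP
  exact ⟨isOperatorGraph_of_symm hT.symm hT.dense, hT.exists_boundedTransform hp hr hpr⟩
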